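/- Let $M$ be a smooth (Hausdorff, second countable) manifold with an HKT-structure: smooth integrable complex structures $I_1,I_2,I_3$ with $I_1I_2=I_3=-I_2I_1$, a Riemannian metric $g$ with $g(I_aX,I_aY)=g(X,Y)$ for $a=1,2,3$, and an HKT-connection $\nabla$, that is, a linear connection with $\nabla g=0$, $\nabla I_1=\nabla I_2=\nabla I_3=0$ for which $c(X,Y,Z)=g(X,T(Y,Z))$ is totally skew-symmetric, $T$ being the torsion of $\nabla$. Let $G$ be a compact Lie group with Lie algebra $\mathfrak g$ acting smoothly on $M$ by isometries that preserve $I_1,I_2,I_3$; identify $X\in\mathfrak g$ with the Killing field it generates on $M$. Let $\nu=(\nu_1,\nu_2,\nu_3):M\to\mathbb R^3\otimes\mathfrak g$ be a $G$-moment map: a smooth $G$-equivariant map (for the adjoint action on $\mathfrak g$) such that $I_1d\nu_1=I_2d\nu_2=I_3d\nu_3$, where $(I\omega)(v)=-\omega(Iv)$, and such that $I_ad\nu_a(X)$ is nowhere zero on $M$ for every $0\ne X\in\mathfrak g$ and every $a$. Let $\zeta\in\mathbb R^3\otimes\mathfrak g$ be such that the level set $P=\nu^{-1}(\zeta)$ is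 $G$-invariant and $G$ acts freely on $P$. For $m\in P$ put $$U_m=\{t\in T_mM:\ d\nu_a(t)=0 \text{ and } (I_ad\nu_a)(t)=0 \text{ for } a=1,2,3\},$$ and suppose that $U_m$ is $g$-orthogonal to the Killing fields generated by $\mathfrak g$ at each $m\in P$. Then $P$ is an embedded submanifold of $M$, the quotient $N=P/G$ (with the quotient topology) is Hausdorff and second countable, and it is a smooth manifold for which the quotient map $\pi:P\to N$ is a submersion. For $m\in P$, every $v\in T_{\pi(m)}N$ has a unique lift $\tilde v\in U_m\subset T_mP$ with $d\pi(\tilde v)=v$. There is an HKT-structure $(I_1^N,I_2^N,I_3^N,h)$ on $N$, with HKT-connection $D$, such that $$\widetilde{I_a^Nv}=I_a\tilde v,\qquad h(v,w)=g(\tilde v,\tilde w),\qquad \widetilde{D_vw}=\theta(\nabla_{\tilde v}\tilde w),$$ where $\theta:T_mM\to U_m$ is the $g$-orthogonal projection and, for a local vector field $w$ on $N$, $\nabla_{\tilde v}\tilde w$ is computed at $m$ with any smooth local extension of $\tilde w$ from $P$ to $M$. -/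

import Mathlib

open Set Filter Topology Bundle Manifold
open scoped Manifold ContDiff

noncomputable section

namespace HKT

/-- Euclidean space of dimension `n`, the model of all manifolds below. -/
abbrev Eu (n : ℕ) : Type := EuclideanSpace ℝ (Fin n)

/-! ### Hypercomplex structures, Riemannian metrics, HKT connections -/

section Structures

variable (n : ℕ) (M : Type*) [TopologicalSpace M] [ChartedSpace (Eu n) M]

/-- A field of endomorphisms of the tangent bundle. -/
abbrev EndField : Type _ :=
  (x : M) → TangentSpace (𝓡 n) x →L[ℝ] TangentSpace (𝓡 n) x

variable {n M} [IsManifold (𝓡 n) ∞ M]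

/-- Integrability of an almost complex structure: the Nijenhuis tensor
`[JX, JY] - J[JX, Y] - J[X, JY] - [X, Y]` vanishes. -/
def IsIntegrable (J : EndField n M) : Prop :=
  ∀ (X Y : (x : M) → TangentSpace (𝓡 n) x) (x : M),
    MDifferentiableAt (𝓡 n) (𝓡 n).tangent (fun y => (⟨y, X y⟩ : TangentBundle (𝓡 n) M)) x →
    MDifferentiableAt (𝓡 n) (𝓡 n).tangent (fun y => (⟨y, Y y⟩ : TangentBundle (𝓡 n) M)) x →
    VectorField.mlieBracket (𝓡 n) (fun y => J y (X y)) (fun y => J y (Y y)) x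
      - J x (VectorField.mlieBracket (𝓡 n) (fun y => J y (X y)) Y x)
      - J x (VectorField.mlieBracket (𝓡 n) X (fun y => J y (Y y)) x)
      - VectorField.mlieBracket (𝓡 n) X Y x = 0

variable (n M) in
/-- A hypercomplex structure: three smooth integrable complex structures `I 0, I 1, I 2`
(the `I₁, I₂, I₃` of the literature) with `I₁ I₂ = I₃ = - I₂ I₁`. -/
structure HypercomplexStructure where
  I : Fin 3 → EndField n M
  smooth : ∀ a, ContMDiff (𝓡 n) ((𝓡 n).prod 𝓘(ℝ, Eu n →L[ℝ] Eu n)) ∞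
    (fun x => TotalSpace.mk' (Eu n →L[ℝ] Eu n)
      (E := fun x : M => TangentSpace (𝓡 n) x →L[ℝ] TangentSpace (𝓡 n) x) x (I a x))
  sq : ∀ a x (v : TangentSpace (𝓡 n) x), I a x (I a x v) = -v
  mul_eq : ∀ x (v : TangentSpace (𝓡 n) x), I 0 x (I 1 x v) = I 2 x v
  anticomm : ∀ x (v : TangentSpace (𝓡 n) x), I 1 x (I 0 x v) = -I 2 x v
  integrable : ∀ a, IsIntegrable (I a)

variable (n M) in
/-- A smooth Riemannian metric on `M`. -/
abbrev Metric : Type _ :=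
  ContMDiffRiemannianMetric (𝓡 n) ∞ (Eu n) (fun x : M => TangentSpace (𝓡 n) x)

variable (n M) in
/-- A linear connection on `M`; `D Y x v` is `(∇_v Y)(x)`. -/
abbrev Connection : Type _ :=
  CovariantDerivative (𝓡 n) (Eu n) (fun x : M => TangentSpace (𝓡 n) x)

/-- `g(X, Y) = g(I_a X, I_a Y)` for `a = 1, 2, 3`. -/
def IsHyperHermitian (𝓘c : HypercomplexStructure n M) (g : Metric n M) : Prop :=
  ∀ a x (v w : TangentSpace (𝓡 n) x), g.inner x (𝓘c.I a x v) (𝓘c.I a x w) = g.inner x v w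

/-- `D` is a smooth connection on the hyper-Hermitian manifold `(M, 𝓘c, g)` with `∇g = 0`,
`∇I₁ = ∇I₂ = ∇I₃ = 0` and totally skew-symmetric torsion `c(X, Y, Z) = g(X, T(Y, Z))`. -/
structure IsHKTConnection (𝓘c : HypercomplexStructure n M) (g : Metric n M)
    (D : Connection n M) : Prop where
  hyperHermitian : IsHyperHermitian 𝓘c g
  smooth : CovariantDerivative.ContMDiffCovariantDerivative D ∞
  metric : ∀ (Y Z : (x : M) → TangentSpace (𝓡 n) x) (x : M) (v : TangentSpace (𝓡 n) x),
    MDifferentiableAt (𝓡 n) (𝓡 n).tangent (fun y => (⟨y, Y y⟩ : TangentBundle (𝓡 n) M)) x →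
    MDifferentiableAt (𝓡 n) (𝓡 n).tangent (fun y => (⟨y, Z y⟩ : TangentBundle (𝓡 n) M)) x →
    (mfderiv (𝓡 n) 𝓘(ℝ, ℝ) (fun y => g.inner y (Y y) (Z y)) x v : ℝ)
      = g.inner x (D Y x v) (Z x) + g.inner x (Y x) (D Z x v)
  complex : ∀ (a : Fin 3) (Y : (x : M) → TangentSpace (𝓡 n) x) (x : M)
      (v : TangentSpace (𝓡 n) x),
    MDifferentiableAt (𝓡 n) (𝓡 n).tangent (fun y => (⟨y, Y y⟩ : TangentBundle (𝓡 n) M)) x →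
    D (fun y => 𝓘c.I a y (Y y)) x v = 𝓘c.I a x (D Y x v)
  torsion_skew : ∀ x (u v w : TangentSpace (𝓡 n) x),
    g.inner x u (D.torsion x v w) = -g.inner x v (D.torsion x u w) ∧
    g.inner x u (D.torsion x v w) = -g.inner x u (D.torsion x w v)

end Structures

/-! ### Group actions and moment maps

The Lie algebra `𝔤 = T₁G` of a Lie group `G` modelled on `Eu d` is the vector space `Eu d`. -/

section Actions

variable {n d : ℕ} {M : Type*} [TopologicalSpace M] [ChartedSpace (Eu n) M]
  [IsManifold (𝓡 n) ∞ M]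
  {G : Type*} [TopologicalSpace G] [ChartedSpace (Eu d) G] [Group G]

/-- The adjoint representation, `Ad γ = d(x ↦ γ x γ⁻¹)` at `1`. -/
def Ad (γ : G) : Eu d →L[ℝ] Eu d :=
  mfderiv (𝓡 d) (𝓡 d) (fun x : G => γ * x * γ⁻¹) 1

variable [MulAction G M]

/-- The vector field on `M` generated by `X ∈ 𝔤`: the derivative of `γ ↦ γ • m` at `1`
in the direction `X`. -/
def fundVec (G : Type*) [TopologicalSpace G] [ChartedSpace (Eu d) G] [Group G] [MulAction G M]
    (X : Eu d) (m : M) : TangentSpace (𝓡 n) m :=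
  mfderiv (𝓡 d) (𝓡 n) (fun γ : G => γ • m) 1 X

/-- `G` acts by diffeomorphisms that commute with `I₁, I₂, I₃` and preserve `g`. -/
structure ActsByHypercomplexIsometries (G : Type*) [Group G] [MulAction G M]
    (𝓘c : HypercomplexStructure n M) (g : Metric n M) : Prop where
  hypercomplex : ∀ (γ : G) (a : Fin 3) (m : M) (v : TangentSpace (𝓡 n) m),
    mfderiv (𝓡 n) (𝓡 n) (fun x : M => γ • x) m (𝓘c.I a m v)
      = 𝓘c.I a (γ • m) (mfderiv (𝓡 n) (𝓡 n) (fun x : M => γ • x) m v)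
  isometry : ∀ (γ : G) (m : M) (v w : TangentSpace (𝓡 n) m),
    g.inner (γ • m) (mfderiv (𝓡 n) (𝓡 n) (fun x : M => γ • x) m v)
      (mfderiv (𝓡 n) (𝓡 n) (fun x : M => γ • x) m w) = g.inner m v w

/-- The differential at `m` of a `𝔤`-valued function. -/
def dval (f : M → Eu d) (m : M) : TangentSpace (𝓡 n) m →L[ℝ] Eu d :=
  mfderiv (𝓡 n) 𝓘(ℝ, Eu d) f m

/-- The `𝔤`-valued 1-form `I_a dν_a` at `m`, with the convention `(Jω)(v) = -ω(Jv)`. -/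
def twisted (𝓘c : HypercomplexStructure n M) (ν : Fin 3 → M → Eu d) (a : Fin 3) (m : M) :
    TangentSpace (𝓡 n) m →L[ℝ] Eu d :=
  -((dval (ν a) m).comp (𝓘c.I a m))

/-- `ν = (ν₁, ν₂, ν₃) : M → ℝ³ ⊗ 𝔤` is a `G`-moment map: smooth, `G`-equivariant for the adjoint
action on `𝔤`, with `I₁dν₁ = I₂dν₂ = I₃dν₃` (Cauchy-Riemann condition) and with `I_a dν_a (X)`
nowhere zero for `0 ≠ X ∈ 𝔤` (transversality condition). -/
structure IsMomentMap (G : Type*) [TopologicalSpace G] [ChartedSpace (Eu d) G] [Group G]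
    [MulAction G M] (𝓘c : HypercomplexStructure n M) (ν : Fin 3 → M → Eu d) : Prop where
  smooth : ∀ a, ContMDiff (𝓡 n) 𝓘(ℝ, Eu d) ∞ (ν a)
  equivariant : ∀ a (γ : G) (m : M), ν a (γ • m) = Ad γ (ν a m)
  cauchyRiemann : ∀ a b (m : M), twisted 𝓘c ν a m = twisted 𝓘c ν b m
  transversal : ∀ a (m : M) (X : Eu d), X ≠ 0 → twisted 𝓘c ν a m (fundVec G X m) ≠ 0

/-- The level set `ν⁻¹(ζ)`. -/
def levelSet (ν : Fin 3 → M → Eu d) (ζ : Fin 3 → Eu d) : Set M := {m | ∀ a, ν a m = ζ a}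

/-- An invariant level set, as a space with `G`-action. -/
def invariantLevelSet (G : Type*) [Group G] [MulAction G M] (ν : Fin 3 → M → Eu d)
    (ζ : Fin 3 → Eu d)
    (h : ∀ (γ : G), ∀ m ∈ levelSet ν ζ, γ • m ∈ levelSet ν ζ) : SubMulAction G M where
  carrier := levelSet ν ζ
  smul_mem' γ {m} hm := h γ m hm

/-- An invariant level set `P = ν⁻¹(ζ)`, as a topological subspace of `M`. -/
abbrev LevelSpace (G : Type*) [Group G] [MulAction G M] (ν : Fin 3 → M → Eu d)
    (ζ : Fin 3 → Eu d)
    (h : ∀ (γ : G), ∀ m ∈ levelSet ν ζ, γ • m ∈ levelSet ν ζ) : Type _ :=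
  ↥(invariantLevelSet G ν ζ h)

/-- The orbit space `N = P / G` of an invariant level set, with the quotient topology. -/
abbrev ReducedSpace (G : Type*) [Group G] [MulAction G M] (ν : Fin 3 → M → Eu d)
    (ζ : Fin 3 → Eu d)
    (h : ∀ (γ : G), ∀ m ∈ levelSet ν ζ, γ • m ∈ levelSet ν ζ) : Type _ :=
  MulAction.orbitRel.Quotient G (LevelSpace G ν ζ h)

/-- The inclusion `P → M`. -/
def incl (G : Type*) [Group G] [MulAction G M] (ν : Fin 3 → M → Eu d)
    (ζ : Fin 3 → Eu d)
    (h : ∀ (γ : G), ∀ m ∈ levelSet ν ζ, γ • m ∈ levelSet ν ζ) : LevelSpace G ν ζ h → M :=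
  Subtype.val

/-- The quotient map `P → N = P / G`. -/
def proj (G : Type*) [Group G] [MulAction G M] (ν : Fin 3 → M → Eu d)
    (ζ : Fin 3 → Eu d)
    (h : ∀ (γ : G), ∀ m ∈ levelSet ν ζ, γ • m ∈ levelSet ν ζ) :
    LevelSpace G ν ζ h → ReducedSpace G ν ζ h :=
  Quotient.mk _

/-- The hypercomplex distribution: `U_m` is the space of all `t` with
`dν₁(t) = dν₂(t) = dν₃(t) = 0` (that is, `t` tangent to the level set) and
`I₁dν₁(t) = I₂dν₂(t) = I₃dν₃(t) = 0`. -/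
def distU (𝓘c : HypercomplexStructure n M) (ν : Fin 3 → M → Eu d) (m : M) :
    Submodule ℝ (TangentSpace (𝓡 n) m) where
  carrier := {t | (∀ a, dval (ν a) m t = 0) ∧ ∀ a, twisted 𝓘c ν a m t = 0}
  add_mem' := fun ha hb => ⟨fun a => by rw [map_add, ha.1, hb.1, add_zero],
    fun a => by rw [map_add, ha.2, hb.2, add_zero]⟩
  zero_mem' := ⟨fun a => map_zero _, fun a => map_zero _⟩
  smul_mem' := fun c _ h => ⟨fun a => by rw [map_smul, h.1, smul_zero],
    fun a => by rw [map_smul, h.2, smul_zero]⟩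

/-- `y` is the orthogonal projection of `x` onto the subspace `U` of `T_m M`. -/
def IsOrthProj (g : Metric n M) {m : M} (U : Submodule ℝ (TangentSpace (𝓡 n) m))
    (x y : TangentSpace (𝓡 n) m) : Prop :=
  y ∈ U ∧ ∀ u ∈ U, g.inner m (x - y) u = 0

end Actions

/-! ### Lifts and induced structures on a quotient of a submanifold -/

section Induced

variable {n p q : ℕ} {M P N : Type*}
  [TopologicalSpace M] [ChartedSpace (Eu n) M] [IsManifold (𝓡 n) ∞ M]
  [TopologicalSpace P] [ChartedSpace (Eu p) P]
  [TopologicalSpace N] [ChartedSpace (Eu q) N] [IsManifold (𝓡 q) ∞ N]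

/-- Let `i : P → M` be the inclusion of a submanifold, `pr : P → N` a submersion, and `U_m` a
subspace of `T_m M` for each `m`. For `m : P` the vector `t` is a lift to `U` of the tangent
vector `v` of `N`: it lies in `U`, is tangent to `P`, and is mapped to `v` by the differential
of `pr`. -/
def IsLift (i : P → M) (pr : P → N) (U : (x : M) → Submodule ℝ (TangentSpace (𝓡 n) x))
    (m : P) (t : TangentSpace (𝓡 n) (i m)) (v : TangentSpace (𝓡 q) (pr m)) : Prop :=
  t ∈ U (i m) ∧ ∃ s : TangentSpace (𝓡 p) m,
    mfderiv (𝓡 p) (𝓡 n) i m s = t ∧ mfderiv (𝓡 p) (𝓡 q) pr m s = v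

/-- The hypercomplex structure `𝓘N`, the metric `h` and the connection `D` on `N` are the ones
induced by `𝓘c`, `g` and `nabla` on `M`. Below `L v` is the lift of `v` to `U`. -/
structure IsInduced (i : P → M) (pr : P → N) (U : (x : M) → Submodule ℝ (TangentSpace (𝓡 n) x))
    (𝓘c : HypercomplexStructure n M) (g : Metric n M) (nabla : Connection n M)
    (𝓘N : HypercomplexStructure q N) (h : Metric q N) (D : Connection q N) : Prop where
  /-- every tangent vector of `N` has exactly one lift at each point of the fibre -/
  lift : ∀ (m : P) (v : TangentSpace (𝓡 q) (pr m)), ∃! t, IsLift (p := p) i pr U m t v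
  /-- the lift of `I_a v` is `I_a (L v)` -/
  hypercomplex : ∀ (m : P) (v : TangentSpace (𝓡 q) (pr m)) (t : TangentSpace (𝓡 n) (i m)),
    IsLift (p := p) i pr U m t v →
    ∀ a, IsLift (p := p) i pr U m (𝓘c.I a (i m) t) (𝓘N.I a (pr m) v)
  /-- `h(v, w) = g(L v, L w)` -/
  metric : ∀ (m : P) (v w : TangentSpace (𝓡 q) (pr m)) (t s : TangentSpace (𝓡 n) (i m)),
    IsLift (p := p) i pr U m t v → IsLift (p := p) i pr U m s w →
    h.inner (pr m) v w = g.inner (i m) t s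
  /-- `L (D_v w)` is the orthogonal projection to `U` of the derivative `∇_{L v} (L w)` along `P`;
  here `w` is a vector field on `N` smooth at `pr m`, and `W` is any vector field on `M` that is
  smooth at `i m` and equals `L w` on `P` near `m` -/
  connection : ∀ (m : P) (w : (y : N) → TangentSpace (𝓡 q) y)
    (W : (x : M) → TangentSpace (𝓡 n) x)
    (v : TangentSpace (𝓡 q) (pr m)) (t s : TangentSpace (𝓡 n) (i m)),
    ContMDiffAt (𝓡 q) (𝓡 q).tangent ∞ (fun y => (⟨y, w y⟩ : TangentBundle (𝓡 q) N)) (pr m) →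
    ContMDiffAt (𝓡 n) (𝓡 n).tangent ∞ (fun x => (⟨x, W x⟩ : TangentBundle (𝓡 n) M)) (i m) →
    (∀ᶠ m' in 𝓝 m, IsLift (p := p) i pr U m' (W (i m')) (w (pr m'))) →
    IsLift (p := p) i pr U m t v →
    IsLift (p := p) i pr U m s (D w (pr m) v) →
    IsOrthProj g (U (i m)) (nabla W (i m) t) s

end Induced

end HKT

end

/-! Write ω for the common form `I_a dν_a`. Composing with `I_a` exchanges ω and `dν_a` up to sign,
so `U = ker ω ∩ ker dν` is stable under the complex structures. Transversality makes ω an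
isomorphism from the Killing directions onto 𝔤, while every `dν_a` kills these directions along the
invariant level set. Applying `I_a` to Killing fields then shows that `(ω, dν)` maps onto 𝔤⁴ at
points of P (`IsMomentMap.exists_vector`). Hence P is a regular level set of codimension 3d, and its
tangent space is the direct sum of U and the orbit directions. Since G is compact and acts freely on
P, there are slices transverse to the orbits (`exists_orbitSlice`); they are charts of N and supply
local sections of π.

Near a point of P choose a smooth extension R of π to M. The form `(ω, dν, dR)`, read in a chart of
N, is invertible there. Its inverse lifts a field w on N to a field W that lies in U and is
R-related to w on an open subset of M, not merely on P (`exists_extension_lift`). So the bracket of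
two such lifts is tangent to P and projects to the bracket on N.

Let L be the lift and Λ the orthogonal projection to U followed by the inverse of L. The induced
connection at a point m of a fibre is `Λ(∇_{Lv} W)`. As U is orthogonal to the Killing fields, Λ
restricted to tangent vectors of P is dπ. Therefore the torsion on N is `Λ T(L·, L·)`, which is
again totally skew. Metricity and parallelism of the complex structures descend because Λ is adjoint
to L and commutes with each `I_a` (`isHKTAt_cov`).

Two points need more. First, the value must not depend on the point of the fibre. Invariance of ∇
under G is not checked directly: a connection satisfying the HKT conditions at one point is
determined there by one complex structure and the metric (`IsHKTAt.unique`), so all points of a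
fibre give the same answer. Secondly, the induced structures must be integrable: when the complex
structure is parallel its Nijenhuis tensor is an algebraic expression in the torsion, and that
expression is carried from M to N by Λ. -/

noncomputable section

namespace HKT

/-! ### Differentials applied to vector fields -/

section Calculus

variable {E : Type*} [NormedAddCommGroup E] [NormedSpace ℝ E]
  {H : Type*} [TopologicalSpace H] {I : ModelWithCorners ℝ E H}
  {M : Type*} [TopologicalSpace M] [ChartedSpace H M] [IsManifold I ∞ M]
  {E' : Type*} [NormedAddCommGroup E'] [NormedSpace ℝ E']
  {H' : Type*} [TopologicalSpace H'] {J : ModelWithCorners ℝ E' H'}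
  {N : Type*} [TopologicalSpace N] [ChartedSpace H' N] [IsManifold J ∞ N]

theorem contMDiffAt_mfderiv_section {f : M → N} {W : (x : M) → TangentSpace I x} {x₀ : M}
    (hf : ContMDiffAt I J ∞ f x₀)
    (hW : ContMDiffAt I I.tangent ∞ (fun x => (⟨x, W x⟩ : TangentBundle I M)) x₀) :
    ContMDiffAt I J.tangent ∞
      (fun x => (⟨f x, mfderiv I J f x (W x)⟩ : TangentBundle J N)) x₀ :=
  ContMDiffAt.clm_apply_of_inCoordinates (F₁ := E) (F₂ := E') (b₁ := id) (b₂ := f)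
    (E₁ := (TangentSpace I : M → Type _)) (E₂ := (TangentSpace J : N → Type _))
    (ϕ := fun x => mfderiv I J f x) (v := W) (hf.mfderiv_const (by simp)) hW hf

theorem mdifferentiableAt_mfderiv_section {f : M → N} {W : (x : M) → TangentSpace I x} {x₀ : M}
    (hf : ContMDiffAt I J ∞ f x₀)
    (hW : MDifferentiableAt I I.tangent (fun x => (⟨x, W x⟩ : TangentBundle I M)) x₀) :
    MDifferentiableAt I J.tangent
      (fun x => (⟨f x, mfderiv I J f x (W x)⟩ : TangentBundle J N)) x₀ :=
  MDifferentiableAt.clm_apply_of_inCoordinates (F₁ := E) (F₂ := E') (b₁ := id) (b₂ := f)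
    (E₁ := (TangentSpace I : M → Type _)) (E₂ := (TangentSpace J : N → Type _))
    (ϕ := fun x => mfderiv I J f x) (v := W)
    ((hf.mfderiv_const (m := 1) (by decide)).mdifferentiableAt one_ne_zero) hW
    (hf.mdifferentiableAt (by decide))

variable {F : Type*} [NormedAddCommGroup F] [NormedSpace ℝ F]

theorem contMDiffAt_mfderiv_apply {f : M → F} {W : (x : M) → TangentSpace I x} {x₀ : M}
    (hf : ContMDiffAt I 𝓘(ℝ, F) ∞ f x₀)
    (hW : ContMDiffAt I I.tangent ∞ (fun x => (⟨x, W x⟩ : TangentBundle I M)) x₀) :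
    ContMDiffAt I 𝓘(ℝ, F) ∞ (fun x => mvfderiv I f x (W x)) x₀ :=
  (contMDiff_snd_tangentBundle_modelSpace F 𝓘(ℝ, F)).contMDiffAt.comp x₀
    (contMDiffAt_mfderiv_section hf hW)

theorem mdifferentiableAt_mfderiv_apply {f : M → F} {W : (x : M) → TangentSpace I x} {x₀ : M}
    (hf : ContMDiffAt I 𝓘(ℝ, F) ∞ f x₀)
    (hW : MDifferentiableAt I I.tangent (fun x => (⟨x, W x⟩ : TangentBundle I M)) x₀) :
    MDifferentiableAt I 𝓘(ℝ, F) (fun x => mvfderiv I f x (W x)) x₀ :=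
  ((contMDiff_snd_tangentBundle_modelSpace F 𝓘(ℝ, F) (n := 1)).contMDiffAt.mdifferentiableAt
    one_ne_zero).comp x₀ (mdifferentiableAt_mfderiv_section hf hW)

end Calculus

section Composition

variable {E : Type*} [NormedAddCommGroup E] [NormedSpace ℝ E]
  {H : Type*} [TopologicalSpace H] {I : ModelWithCorners ℝ E H}
  {M : Type*} [TopologicalSpace M] [ChartedSpace H M]
  {E' : Type*} [NormedAddCommGroup E'] [NormedSpace ℝ E']
  {H' : Type*} [TopologicalSpace H'] {J : ModelWithCorners ℝ E' H'}
  {N : Type*} [TopologicalSpace N] [ChartedSpace H' N]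
  {F : Type*} [NormedAddCommGroup F] [NormedSpace ℝ F]

theorem mvfderiv_comp_mfderiv {k : N → F} {f : M → N} {x : M}
    (hk : MDifferentiableAt J 𝓘(ℝ, F) k (f x)) (hf : MDifferentiableAt I J f x)
    (t : TangentSpace I x) :
    mvfderiv I (k ∘ f) x t = mvfderiv J k (f x) (mfderiv I J f x t) :=
  DFunLike.congr_fun (mfderiv_comp x hk hf) t

end Composition

/-! ### Lie brackets as commutators, and related vector fields -/

section Bracket

variable {n : ℕ} {M : Type*} [TopologicalSpace M] [ChartedSpace (Eu n) M] [IsManifold (𝓡 n) ∞ M]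
  {F : Type*} [NormedAddCommGroup F] [NormedSpace ℝ F]

/-- The derivative along a Lie bracket is the commutator of the derivatives. -/
theorem mfderiv_mlieBracket {f : M → F} {V W : (x : M) → TangentSpace (𝓡 n) x} {x₀ : M}
    (hf : ContMDiffAt (𝓡 n) 𝓘(ℝ, F) ∞ f x₀)
    (hV : MDifferentiableAt (𝓡 n) (𝓡 n).tangent (fun x => (⟨x, V x⟩ : TangentBundle (𝓡 n) M)) x₀)
    (hW : MDifferentiableAt (𝓡 n) (𝓡 n).tangent (fun x => (⟨x, W x⟩ : TangentBundle (𝓡 n) M)) x₀) :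
    mvfderiv (𝓡 n) f x₀ (VectorField.mlieBracket (𝓡 n) V W x₀)
      = mvfderiv (𝓡 n) (fun x => mvfderiv (𝓡 n) f x (W x)) x₀ (V x₀)
        - mvfderiv (𝓡 n) (fun x => mvfderiv (𝓡 n) f x (V x)) x₀ (W x₀) := by
  have : IsManifold (𝓡 n) 2 M := IsManifold.of_le (n := ∞) (by decide)
  have : IsManifold (𝓡 n) 1 M := IsManifold.of_le (n := ∞) (by decide)
  set φ := extChartAt (𝓡 n) x₀ with hφ
  have hr : range (𝓡 n) = univ := (𝓡 n).range_eq_univ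
  set V' : Eu n → Eu n := VectorField.mpullbackWithin 𝓘(ℝ, Eu n) (𝓡 n) φ.symm V univ with hV'
  set W' : Eu n → Eu n := VectorField.mpullbackWithin 𝓘(ℝ, Eu n) (𝓡 n) φ.symm W univ with hW'
  have hVd : DifferentiableAt ℝ V' (φ x₀) := by
    have := MDifferentiableWithinAt.differentiableWithinAt_mpullbackWithin_vectorField
      (mdifferentiableWithinAt_univ.2 hV)
    rw [hr, preimage_univ, inter_univ] at this
    exact differentiableWithinAt_univ.1 this
  have hWd : DifferentiableAt ℝ W' (φ x₀) := by
    have := MDifferentiableWithinAt.differentiableWithinAt_mpullbackWithin_vectorField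
      (mdifferentiableWithinAt_univ.2 hW)
    rw [hr, preimage_univ, inter_univ] at this
    exact differentiableWithinAt_univ.1 this
  have hx : φ.symm (φ x₀) = x₀ := extChartAt_to_inv x₀
  have hf' : ContDiffAt ℝ ∞ (f ∘ φ.symm) (φ x₀) := by
    have h1 := (contMDiffAt_iff.1 hf).2
    rw [hr, contDiffWithinAt_univ] at h1
    exact h1
  -- Pulling the field back by `φ.symm` and differentiating `f ∘ φ.symm` introduces a differential
  -- and its inverse, which cancel. The claim thus reduces to the commutator formula in the model
  -- space.
  have key : ∀ U : (x : M) → TangentSpace (𝓡 n) x, ∀ z ∈ φ.target,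
      MDifferentiableAt (𝓡 n) 𝓘(ℝ, F) f (φ.symm z) →
      fderiv ℝ (f ∘ φ.symm) z (VectorField.mpullbackWithin 𝓘(ℝ, Eu n) (𝓡 n) φ.symm U
        univ z) = mvfderiv (𝓡 n) f (φ.symm z) (U (φ.symm z)) := by
    intro U z hz hfz
    have h1 : MDifferentiableAt 𝓘(ℝ, Eu n) (𝓡 n) φ.symm z := by
      have := mdifferentiableWithinAt_extChartAt_symm hz
      rwa [hr, mdifferentiableWithinAt_univ] at this
    have h2 := isInvertible_mfderivWithin_extChartAt_symm hz
    rw [hr] at h2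
    have h3 : mfderiv 𝓘(ℝ, Eu n) 𝓘(ℝ, F) (f ∘ φ.symm) z
      = (mfderiv (𝓡 n) 𝓘(ℝ, F) f (φ.symm z)).comp (mfderiv 𝓘(ℝ, Eu n) (𝓡 n) φ.symm z) :=
      mfderiv_comp z hfz h1
    rw [mfderiv_eq_fderiv] at h3
    rw [mfderivWithin_univ] at h2
    have h4 : VectorField.mpullbackWithin 𝓘(ℝ, Eu n) (𝓡 n) φ.symm U univ z
      = (mfderiv 𝓘(ℝ, Eu n) (𝓡 n) φ.symm z).inverse (U (φ.symm z)) := by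
      rw [VectorField.mpullbackWithin_apply, mfderivWithin_univ]
    rw [h4]
    obtain ⟨e, he⟩ := h2
    rw [← he, ContinuousLinearMap.inverse_equiv]
    have h5 := DFunLike.congr_fun h3 (e.symm (U (φ.symm z)))
    refine h5.trans ?_
    rw [← he]
    change mfderiv (𝓡 n) 𝓘(ℝ, F) f (φ.symm z) (e (e.symm (U (φ.symm z)))) = _
    rw [e.apply_symm_apply]
    rfl
  -- At the centre of its own chart the chart has identity differential, so the comparison maps at
  -- `x₀` disappear.
  have hid : ∀ v : Eu n, (ContinuousLinearMap.id ℝ (Eu n)).inverse v = v := by simp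
  have hbr : VectorField.mlieBracket (𝓡 n) V W x₀ = VectorField.lieBracket ℝ V' W' (φ x₀) := by
    rw [← VectorField.mlieBracketWithin_univ, VectorField.mlieBracketWithin_apply,
      mfderiv_extChartAt_self]
    refine (hid _).trans ?_
    rw [hr, preimage_univ, inter_univ]
    exact congrFun VectorField.lieBracketWithin_univ (φ x₀)
  have hnear : ∀ᶠ z in 𝓝 (φ x₀), z ∈ φ.target ∧
      MDifferentiableAt (𝓡 n) 𝓘(ℝ, F) f (φ.symm z) := by
    refine Filter.Eventually.and (extChartAt_target_mem_nhds x₀) ?_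
    have h1 : ∀ᶠ x in 𝓝 x₀, MDifferentiableAt (𝓡 n) 𝓘(ℝ, F) f x := by
      have := (contMDiffAt_iff_contMDiffAt_nhds (n := 1) (by decide)).1 (hf.of_le (by decide))
      exact this.mono fun x hx => hx.mdifferentiableAt one_ne_zero
    have h2 : ContinuousAt φ.symm (φ x₀) := continuousAt_extChartAt_symm x₀
    exact h2.eventually (by rwa [hx])
  have hpt : ∀ U : (x : M) → TangentSpace (𝓡 n) x,
      VectorField.mpullbackWithin 𝓘(ℝ, Eu n) (𝓡 n) φ.symm U univ (φ x₀) = U x₀ := by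
    intro U
    rw [VectorField.mpullbackWithin_apply, ← hr, mfderivWithin_range_extChartAt_symm]
    refine (hid _).trans ?_
    rw [hx]
  have hfd : ∀ k : M → F, MDifferentiableAt (𝓡 n) 𝓘(ℝ, F) k x₀ → ∀ v : Eu n,
      fderiv ℝ (k ∘ φ.symm) (φ x₀) v = mvfderiv (𝓡 n) k x₀ v := by
    intro k hk v
    have : mfderiv (𝓡 n) 𝓘(ℝ, F) k x₀ = fderivWithin ℝ (k ∘ φ.symm) (range (𝓡 n)) (φ x₀) := by
      rw [hk.mfderiv]; rfl
    rw [hr, fderivWithin_univ] at this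
    exact (DFunLike.congr_fun this v).symm
  have hder : ∀ U : (x : M) → TangentSpace (𝓡 n) x,
      MDifferentiableAt (𝓡 n) (𝓡 n).tangent (fun x => (⟨x, U x⟩ : TangentBundle (𝓡 n) M)) x₀ →
      ∀ v : Eu n, fderiv ℝ (fun z => fderiv ℝ (f ∘ φ.symm) z
        (VectorField.mpullbackWithin 𝓘(ℝ, Eu n) (𝓡 n) φ.symm U univ z)) (φ x₀) v
        = mvfderiv (𝓡 n) (fun x => mvfderiv (𝓡 n) f x (U x)) x₀ v := by
    intro U hU v
    rw [← hfd _ (mdifferentiableAt_mfderiv_apply hf hU)]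
    congr 1
    apply Filter.EventuallyEq.fderiv_eq
    filter_upwards [hnear] with z hz
    exact key U z hz.1 hz.2
  have h := VectorField.fderiv_apply_lieBracket (V := V') (W := W') hf'
    (by rw [minSmoothness_of_isRCLikeNormedField]; decide) hWd hVd
  rw [hfd f (hf.mdifferentiableAt (by decide)), hder W hW, hder V hV] at h
  rw [hbr]
  refine h.trans ?_
  rw [hV', hW']
  congr 1
  · exact congrArg _ (hpt V)
  · exact congrArg _ (hpt W)

variable {q : ℕ} {N : Type*} [TopologicalSpace N] [ChartedSpace (Eu q) N] [IsManifold (𝓡 q) ∞ N]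

/-- Lie brackets of related vector fields are related. -/
theorem mfderiv_mlieBracket_of_related {R : M → N} {V W : (x : M) → TangentSpace (𝓡 n) x}
    {v w : (y : N) → TangentSpace (𝓡 q) y} {x₀ : M}
    (hR : ContMDiffAt (𝓡 n) (𝓡 q) ∞ R x₀)
    (hV : MDifferentiableAt (𝓡 n) (𝓡 n).tangent (fun x => (⟨x, V x⟩ : TangentBundle (𝓡 n) M)) x₀)
    (hW : MDifferentiableAt (𝓡 n) (𝓡 n).tangent (fun x => (⟨x, W x⟩ : TangentBundle (𝓡 n) M)) x₀)
    (hv : MDifferentiableAt (𝓡 q) (𝓡 q).tangent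
      (fun x => (⟨x, v x⟩ : TangentBundle (𝓡 q) N)) (R x₀))
    (hw : MDifferentiableAt (𝓡 q) (𝓡 q).tangent
      (fun x => (⟨x, w x⟩ : TangentBundle (𝓡 q) N)) (R x₀))
    (hVv : ∀ᶠ x in 𝓝 x₀, mfderiv (𝓡 n) (𝓡 q) R x (V x) = v (R x))
    (hWw : ∀ᶠ x in 𝓝 x₀, mfderiv (𝓡 n) (𝓡 q) R x (W x) = w (R x)) :
    mfderiv (𝓡 n) (𝓡 q) R x₀ (VectorField.mlieBracket (𝓡 n) V W x₀)
      = VectorField.mlieBracket (𝓡 q) v w (R x₀) := by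
  have : IsManifold (𝓡 q) 1 N := IsManifold.of_le (n := ∞) (by decide)
  -- A chart of the target turns the claim into the commutator formula for the vector-valued
  -- functions `c` and `c ∘ R`; the differential of `c` is injective and can be cancelled at the
  -- end.
  set c : N → Eu q := ⇑(extChartAt (𝓡 q) (R x₀)) with hc
  have hcs : ContMDiffAt (𝓡 q) 𝓘(ℝ, Eu q) ∞ c (R x₀) := contMDiffAt_extChartAt
  have hcR : ContMDiffAt (𝓡 n) 𝓘(ℝ, Eu q) ∞ (c ∘ R) x₀ := hcs.comp x₀ hR
  have hnear : ∀ᶠ x in 𝓝 x₀, MDifferentiableAt (𝓡 n) (𝓡 q) R x ∧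
      MDifferentiableAt (𝓡 q) 𝓘(ℝ, Eu q) c (R x) := by
    refine Filter.Eventually.and ?_ ?_
    · have := (contMDiffAt_iff_contMDiffAt_nhds (n := 1) (by decide)).1 (hR.of_le (by decide))
      exact this.mono fun x hx => hx.mdifferentiableAt one_ne_zero
    · have := (contMDiffAt_iff_contMDiffAt_nhds (n := 1) (by decide)).1 (hcs.of_le (by decide))
      exact hR.continuousAt.eventually
        (this.mono fun x hx => hx.mdifferentiableAt one_ne_zero)
  have hcomp : ∀ x, MDifferentiableAt (𝓡 n) (𝓡 q) R x ∧
      MDifferentiableAt (𝓡 q) 𝓘(ℝ, Eu q) c (R x) → ∀ t : TangentSpace (𝓡 n) x,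
      mvfderiv (𝓡 n) (c ∘ R) x t = mvfderiv (𝓡 q) c (R x) (mfderiv (𝓡 n) (𝓡 q) R x t) := by
    intro x hx t
    exact mvfderiv_comp_mfderiv hx.2 hx.1 t
  have hd : ∀ (U : (x : M) → TangentSpace (𝓡 n) x) (u : (y : N) → TangentSpace (𝓡 q) y),
      MDifferentiableAt (𝓡 q) (𝓡 q).tangent
        (fun x => (⟨x, u x⟩ : TangentBundle (𝓡 q) N)) (R x₀) →
      (∀ᶠ x in 𝓝 x₀, mfderiv (𝓡 n) (𝓡 q) R x (U x) = u (R x)) → ∀ t : TangentSpace (𝓡 n) x₀,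
      mvfderiv (𝓡 n) (fun x => mvfderiv (𝓡 n) (c ∘ R) x (U x)) x₀ t
        = mvfderiv (𝓡 q) (fun y => mvfderiv (𝓡 q) c y (u y)) (R x₀)
          (mfderiv (𝓡 n) (𝓡 q) R x₀ t) := by
    intro U u hu hUu t
    have h1 : (fun x => mvfderiv (𝓡 n) (c ∘ R) x (U x)) =ᶠ[𝓝 x₀]
        (fun y => mvfderiv (𝓡 q) c y (u y)) ∘ R := by
      filter_upwards [hnear, hUu] with x hx hx'
      rw [hcomp x hx, hx']; rfl
    refine Eq.trans ?_ (mvfderiv_comp_mfderiv (mdifferentiableAt_mfderiv_apply hcs hu)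
      hnear.self_of_nhds.1 t)
    exact DFunLike.congr_fun h1.mfderiv_eq t
  have h1 := mfderiv_mlieBracket hcR hV hW
  have h2 := mfderiv_mlieBracket hcs hv hw
  rw [hd W w hw hWw, hd V v hv hVv, hVv.self_of_nhds, hWw.self_of_nhds, ← h2,
    hcomp x₀ hnear.self_of_nhds] at h1
  have hinv : (mfderiv (𝓡 q) 𝓘(ℝ, Eu q) c (R x₀)).IsInvertible :=
    isInvertible_mfderiv_extChartAt (mem_extChartAt_source _)
  exact hinv.injective h1

end Bracket

/-! ### Smoothness tests for bundle homomorphisms -/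

section HomSections

variable {n : ℕ} {M : Type*} [TopologicalSpace M] [ChartedSpace (Eu n) M] [IsManifold (𝓡 n) ∞ M]

/-- In finite dimension a linear map is the finite sum of the rank-one maps `coord_i ⊗ Φ(b_i)` over
a basis, so its values on the basis control it. -/
theorem contMDiffAt_clm_of_apply {E F : Type*} [NormedAddCommGroup E] [NormedSpace ℝ E]
    [FiniteDimensional ℝ E] [NormedAddCommGroup F] [NormedSpace ℝ F] {Φ : M → E →L[ℝ] F} {x₀ : M}
    (h : ∀ v, ContMDiffAt (𝓡 n) 𝓘(ℝ, F) ∞ (fun x => Φ x v) x₀) :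
    ContMDiffAt (𝓡 n) 𝓘(ℝ, E →L[ℝ] F) ∞ Φ x₀ := by
  let b := Module.finBasis ℝ E
  have hΦ : Φ = fun x => ∑ i, ContinuousLinearMap.smulRightL ℝ E F
      (LinearMap.toContinuousLinearMap (b.coord i)) (Φ x (b i)) := by
    funext x
    ext v
    conv_lhs => rw [← b.sum_repr v, map_sum]
    simp
  rw [hΦ]
  have : ∀ i ∈ Finset.univ, ContMDiffAt (𝓡 n) 𝓘(ℝ, E →L[ℝ] F) ∞
      (fun x => ContinuousLinearMap.smulRightL ℝ E F
      (LinearMap.toContinuousLinearMap (b.coord i)) (Φ x (b i))) x₀ := fun i _ =>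
    (ContinuousLinearMap.contMDiff _).contMDiffAt.comp x₀ (h (b i))
  exact ContMDiffAt.sum this

variable {F : Type*} [NormedAddCommGroup F] [NormedSpace ℝ F] {V : M → Type*}
  [TopologicalSpace (TotalSpace F V)] [∀ x, AddCommGroup (V x)] [∀ x, Module ℝ (V x)]
  [∀ x, TopologicalSpace (V x)] [∀ x, IsTopologicalAddGroup (V x)] [∀ x, ContinuousSMul ℝ (V x)]
  [FiberBundle F V] [VectorBundle ℝ F V]

/-- A homomorphism from the tangent bundle is smooth if it maps the standard local vector fields
to smooth sections. -/
theorem contMDiffAt_hom_section {A : (x : M) → TangentSpace (𝓡 n) x →L[ℝ] V x} {x₀ : M}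
    (h : ∀ v : TangentSpace (𝓡 n) x₀, ContMDiffAt (𝓡 n) ((𝓡 n).prod 𝓘(ℝ, F)) ∞
      (fun x => TotalSpace.mk' F x (A x (FiberBundle.extend (Eu n) v x))) x₀) :
    ContMDiffAt (𝓡 n) ((𝓡 n).prod 𝓘(ℝ, Eu n →L[ℝ] F)) ∞
      (fun x => TotalSpace.mk' (Eu n →L[ℝ] F)
        (E := fun x : M => TangentSpace (𝓡 n) x →L[ℝ] V x) x (A x)) x₀ := by
  rw [contMDiffAt_hom_bundle]
  refine ⟨contMDiffAt_id, contMDiffAt_clm_of_apply fun u => ?_⟩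
  set t := trivializationAt (Eu n) (TangentSpace (𝓡 n) : M → Type _) x₀
  have h0 : x₀ ∈ t.baseSet := FiberBundle.mem_baseSet_trivializationAt' x₀
  have h1 := (contMDiffAt_section x₀).1 (h (t.symm x₀ u))
  refine h1.congr_of_eventuallyEq ?_
  filter_upwards [t.open_baseSet.mem_nhds h0,
    (trivializationAt F V x₀).open_baseSet.mem_nhds (FiberBundle.mem_baseSet_trivializationAt' x₀)]
    with x hx hx'
  rw [ContinuousLinearMap.inCoordinates_eq hx hx']
  have h2 : (t ⟨x₀, t.symm x₀ u⟩).2 = u := by rw [Bundle.Trivialization.apply_mk_symm t h0 u]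
  have h3 := congrArg (fun z => (trivializationAt F V x₀ ⟨x, A x (t.symm x z)⟩).2) h2.symm
  simpa [FiberBundle.extend, t] using h3

end HomSections

/-! ### Locality of smooth connections -/

section Connections

variable {n : ℕ} {M : Type*} [TopologicalSpace M] [T2Space M] [ChartedSpace (Eu n) M]
  [IsManifold (𝓡 n) ∞ M]

/-- A locally smooth vector field agrees near each point with a globally smooth one. -/
theorem exists_contMDiff_eventuallyEq {W : (x : M) → TangentSpace (𝓡 n) x} {x₀ : M}
    (hW : ∀ᶠ x in 𝓝 x₀, ContMDiffAt (𝓡 n) (𝓡 n).tangent ∞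
      (fun x => (⟨x, W x⟩ : TangentBundle (𝓡 n) M)) x) :
    ∃ W' : (x : M) → TangentSpace (𝓡 n) x,
      ContMDiff (𝓡 n) (𝓡 n).tangent ∞ (fun x => (⟨x, W' x⟩ : TangentBundle (𝓡 n) M)) ∧
      ∀ᶠ x in 𝓝 x₀, W' x = W x := by
  obtain ⟨u, hu, huo, hx⟩ := eventually_nhds_iff.1 hW
  obtain ⟨f, -, hf⟩ := (SmoothBumpFunction.nhds_basis_tsupport (I := 𝓡 n) x₀).mem_iff.1
    (huo.mem_nhds hx)
  refine ⟨fun x => f x • W x, ?_, ?_⟩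
  · exact ContMDiffOn.smul_section_of_tsupport (u := u) f.contMDiff.contMDiffOn huo hf
      fun x hx => (hu x hx).contMDiffWithinAt
  · filter_upwards [f.eventuallyEq_one] with x hx
    rw [hx, Pi.one_apply, one_smul]

/-- Smoothness of `D` is a statement about globally smooth fields. A bump function supplies one with
the same germ as `W`, and `D` depends only on the germ. -/
theorem contMDiffAt_covariantDerivative_apply {D : Connection n M}
    (hD : CovariantDerivative.ContMDiffCovariantDerivative D ∞)
    {W V : (x : M) → TangentSpace (𝓡 n) x} {x₀ : M}
    (hW : ∀ᶠ x in 𝓝 x₀, ContMDiffAt (𝓡 n) (𝓡 n).tangent ∞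
      (fun x => (⟨x, W x⟩ : TangentBundle (𝓡 n) M)) x)
    (hV : ContMDiffAt (𝓡 n) (𝓡 n).tangent ∞
      (fun x => (⟨x, V x⟩ : TangentBundle (𝓡 n) M)) x₀) :
    ContMDiffAt (𝓡 n) (𝓡 n).tangent ∞
      (fun x => (⟨x, D W x (V x)⟩ : TangentBundle (𝓡 n) M)) x₀ := by
  obtain ⟨W', hW', he⟩ := exists_contMDiff_eventuallyEq hW
  have h1 := hD.contMDiff.contMDiff (σ := W') (by simpa using hW'.contMDiffOn)
  have h2 := ContMDiffAt.clm_bundle_apply (h1.contMDiffAt univ_mem) hV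
  refine h2.congr_of_eventuallyEq ?_
  filter_upwards [he.eventually_nhds, hW.mono fun x hx => hx.mdifferentiableAt (by decide)]
    with x hx hx'
  have h3 := D.isCovariantDerivativeOnUniv.congr_of_eventuallyEq
    (hW'.contMDiffAt.mdifferentiableAt (by decide)) hx' univ_mem hx
  exact congrArg (fun A : TangentSpace (𝓡 n) x →L[ℝ] TangentSpace (𝓡 n) x =>
    (⟨x, A (V x)⟩ : TangentBundle (𝓡 n) M)) h3.symm

end Connections

/-! ### HKT conditions at a point: uniqueness and the Nijenhuis tensor -/

section PointwiseHKT

variable {q : ℕ} {N : Type*} [TopologicalSpace N] [ChartedSpace (Eu q) N] [IsManifold (𝓡 q) ∞ N]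

/-- The vector field `V` is differentiable at `x`. -/
abbrev DiffField (V : (x : N) → TangentSpace (𝓡 q) x) (x : N) : Prop :=
  MDifferentiableAt (𝓡 q) (𝓡 q).tangent (fun y => (⟨y, V y⟩ : TangentBundle (𝓡 q) N)) x

/-- The vector field `V` is smooth at `x`. -/
abbrev SmoothField (V : (x : N) → TangentSpace (𝓡 q) x) (x : N) : Prop :=
  ContMDiffAt (𝓡 q) (𝓡 q).tangent ∞ (fun y => (⟨y, V y⟩ : TangentBundle (𝓡 q) N)) x

/-- `cov` satisfies at the point `y` the conditions on an HKT connection for the endomorphisms `J`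
and the metric `h`, and its torsion at `y` is `T`. -/
structure IsHKTAt (J : Fin 3 → EndField q N) (h : Metric q N)
    (cov : ((x : N) → TangentSpace (𝓡 q) x) →
      ((x : N) → TangentSpace (𝓡 q) x →L[ℝ] TangentSpace (𝓡 q) x))
    (y : N) (T : TangentSpace (𝓡 q) y → TangentSpace (𝓡 q) y → TangentSpace (𝓡 q) y) : Prop where
  isCov : IsCovariantDerivativeOn (Eu q) cov {y}
  metric : ∀ (Y Z : (x : N) → TangentSpace (𝓡 q) x) (v : TangentSpace (𝓡 q) y),
    DiffField Y y → DiffField Z y →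
    mvfderiv (𝓡 q) (fun x => h.inner x (Y x) (Z x)) y v
      = h.inner y (cov Y y v) (Z y) + h.inner y (Y y) (cov Z y v)
  complex : ∀ (a : Fin 3) (Y : (x : N) → TangentSpace (𝓡 q) x) (v : TangentSpace (𝓡 q) y),
    DiffField Y y → cov (fun x => J a x (Y x)) y v = J a y (cov Y y v)
  torsion : ∀ (V W : (x : N) → TangentSpace (𝓡 q) x), DiffField V y → DiffField W y →
    cov W y (V y) - cov V y (W y) - VectorField.mlieBracket (𝓡 q) V W y = T (V y) (W y)
  skew : ∀ u v w, h.inner y u (T v w) = -h.inner y v (T u w) ∧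
    h.inner y u (T v w) = -h.inner y u (T w v)

theorem diffField_extend {y : N} (v : TangentSpace (𝓡 q) y) :
    DiffField (FiberBundle.extend (Eu q) v) y := by
  have : IsManifold (𝓡 q) 1 N := IsManifold.of_le (n := ∞) (by decide)
  exact FiberBundle.mdifferentiableAt_extend (𝓡 q) (Eu q) v

theorem smoothField_extend {y : N} (v : TangentSpace (𝓡 q) y) :
    SmoothField (FiberBundle.extend (Eu q) v) y :=
  FiberBundle.contMDiffAt_extend (𝓡 q) (Eu q) v

theorem smoothField_extend_eventually {y : N} (v : TangentSpace (𝓡 q) y) :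
    ∀ᶠ x in 𝓝 y, SmoothField (FiberBundle.extend (Eu q) v) x := by
  obtain ⟨s, hs, h⟩ := FiberBundle.exists_contMDiffOn_extend (k := ∞) (𝓡 q) (Eu q) v
  filter_upwards [eventually_mem_nhds_iff.2 hs] with x hx
  exact h.contMDiffAt hx

/-- A totally skew form that is invariant under a complex structure in its last two arguments
vanishes. -/
theorem eq_zero_of_skew_of_invariant {V : Type*} [AddCommGroup V] (a : V → V → V → ℝ) (J : V → V)
    (hJ : ∀ v, J (J v) = -v) (hneg : ∀ u v w, a u v (-w) = - a u v w)
    (h1 : ∀ u v w, a u v w = - a v u w) (h2 : ∀ u v w, a u v w = - a u w v)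
    (hinv : ∀ u v w, a u (J v) (J w) = a u v w) (u v w : V) : a u v w = 0 := by
  have k23 : ∀ u v w, a u (J v) w = - a u v (J w) := fun u v w => by
    have := hinv u v (J w)
    rw [hJ, hneg] at this
    linarith
  have k12 : ∀ u v w, a (J u) v w = - a u (J v) w := fun u v w => by
    have e1 := h2 (J u) v w
    have e2 := h1 (J u) w v
    have e3 := k23 w u v
    have e4 := h1 w u (J v)
    have e5 := h2 u w (J v)
    linarith
  have k13 : ∀ u v w, a (J u) v w = - a u v (J w) := fun u v w => by
    have e1 := h1 (J u) v w
    have e2 := k23 v u w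
    have e3 := h1 v u (J w)
    linarith
  -- Each of the three pairs of slots allows `J` to pass with a sign. Evaluating the form at `(J u,
  -- v, J w)` by way of the second slot or directly by the third gives opposite multiples of `a u v
  -- w`.
  have := k12 u v (J w)
  have h3 := k13 u v (J w)
  have h4 := k23 u v (J w)
  rw [hJ, hneg] at h3 h4
  linarith

variable {J : Fin 3 → EndField q N} {h : Metric q N}
  {cov cov' : ((x : N) → TangentSpace (𝓡 q) x) →
      ((x : N) → TangentSpace (𝓡 q) x →L[ℝ] TangentSpace (𝓡 q) x)}
  {y : N} {T T' : TangentSpace (𝓡 q) y → TangentSpace (𝓡 q) y → TangentSpace (𝓡 q) y}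

/-- An HKT connection is unique at each point. -/
theorem IsHKTAt.unique (hc : IsHKTAt J h cov y T) (hc' : IsHKTAt J h cov' y T')
    (hJ : ∀ v : TangentSpace (𝓡 q) y, J 0 y (J 0 y v) = -v)
    (hJh : ∀ v w : TangentSpace (𝓡 q) y, h.inner y (J 0 y v) (J 0 y w) = h.inner y v w)
    (hJs : ∀ V, DiffField V y → DiffField (fun x => J 0 x (V x)) y)
    {W : (x : N) → TangentSpace (𝓡 q) x} (hW : DiffField W y) : cov W y = cov' W y := by
  have : IsManifold (𝓡 q) 1 N := IsManifold.of_le (n := ∞) (by decide)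
  -- The difference of two connections is a tensor at `y`. Metricity makes it skew, parallelism
  -- makes it commute with `J 0`, and its antisymmetrization is the difference of the torsions.
  set A := IsCovariantDerivativeOn.difference hc.isCov hc'.isCov y with hA
  have hAd : ∀ V, DiffField V y → A (V y) = cov V y - cov' V y := fun V hV =>
    IsCovariantDerivativeOn.difference_apply hc.isCov hc'.isCov (mem_singleton y) hV
  have hext : ∀ v : TangentSpace (𝓡 q) y, FiberBundle.extend (Eu q) v y = v := fun v => by simp
  let E := fun v : TangentSpace (𝓡 q) y => FiberBundle.extend (Eu q) v
  have hE : ∀ v, E v y = v := hext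
  have hEd : ∀ v, DiffField (E v) y := fun v => diffField_extend v
  have hAE : ∀ w v, A w v = cov (E w) y v - cov' (E w) y v := fun w v => by
    have := hAd (E w) (hEd w)
    rw [hE] at this
    rw [this]; rfl
  have hsymm : ∀ v w : TangentSpace (𝓡 q) y, h.inner y v w = h.inner y w v := h.symm y
  have hskew : ∀ v w z, h.inner y (A w v) z = - h.inner y (A z v) w := by
    intro v w z
    have e1 := hc.metric (E w) (E z) v (hEd w) (hEd z)
    have e2 := hc'.metric (E w) (E z) v (hEd w) (hEd z)
    rw [e1] at e2
    rw [hE, hE] at e2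
    rw [hAE, hAE, map_sub, map_sub]
    simp only [sub_apply]
    have e3 := hsymm (cov (E z) y v) w
    have e4 := hsymm (cov' (E z) y v) w
    linarith
  have hcomm : ∀ v w, A (J 0 y w) v = J 0 y (A w v) := by
    intro v w
    have e1 := hc.complex 0 (E w) v (hEd w)
    have e2 := hc'.complex 0 (E w) v (hEd w)
    have e3 := DFunLike.congr_fun (hAd _ (hJs _ (hEd w))) v
    rw [hE] at e3
    rw [e3, hAE, map_sub, ← e1, ← e2]; rfl
  have htor : ∀ v w, A w v - A v w = T v w - T' v w := by
    intro v w
    have e1 := hc.torsion (E v) (E w) (hEd v) (hEd w)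
    have e2 := hc'.torsion (E v) (E w) (hEd v) (hEd w)
    rw [hE, hE] at e1 e2
    rw [← e1, ← e2, hAE, hAE]
    abel
  have hs : ∀ u v w, h.inner y u (A w v) - h.inner y u (A v w)
      = h.inner y u (T v w) - h.inner y u (T' v w) := by
    intro u v w
    rw [← map_sub, ← map_sub, htor]
  let a : TangentSpace (𝓡 q) y → TangentSpace (𝓡 q) y → TangentSpace (𝓡 q) y → ℝ :=
    fun v w u => h.inner y (A w v) u
  have ha : ∀ v w u, h.inner y u (A w v) = a v w u := fun v w u => hsymm _ _
  have h23 : ∀ v w u, a v w u = - a v u w := fun v w u => hskew v w u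
  -- The antisymmetrization S of `a` in its first two slots is totally skew. Then `a - S/2` is
  -- symmetric in the first pair of slots and skew in the last pair, hence zero, so `a` itself is
  -- totally skew.
  have h12 : ∀ v w u, a v w u = - a w v u := by
    intro v w u
    have l1 := hs u v w
    have l2 := hs u w v
    have l3 := hs v u w
    have l4 := hs v w u
    have l5 := hs w u v
    have l6 := hs w v u
    simp only [ha] at l1 l2 l3 l4 l5 l6
    have t1 := hc.skew u v w
    have t2 := hc.skew u w v
    have t3 := hc.skew v u w
    have t4 := hc.skew v w u
    have t5 := hc.skew w u v
    have t6 := hc.skew w v u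
    have t1' := hc'.skew u v w
    have t2' := hc'.skew u w v
    have t3' := hc'.skew v u w
    have t4' := hc'.skew v w u
    have t5' := hc'.skew w u v
    have t6' := hc'.skew w v u
    have k1 := h23 u v w
    have k2 := h23 v w u
    have k3 := h23 w u v
    linarith [t1.1, t1.2, t2.1, t2.2, t3.1, t3.2, t4.1, t4.2, t5.1, t5.2, t6.1, t6.2,
      t1'.1, t1'.2, t2'.1, t2'.2, t3'.1, t3'.2, t4'.1, t4'.2, t5'.1, t5'.2, t6'.1, t6'.2]
  have hinv : ∀ u v w, a u (J 0 y v) (J 0 y w) = a u v w := by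
    intro u v w
    show h.inner y (A (J 0 y v) u) (J 0 y w) = h.inner y (A v u) w
    rw [hcomm, hJh]
  have hzero := eq_zero_of_skew_of_invariant a (J 0 y) hJ (fun u v w => by simp [a])
    h12 h23 hinv
  have hA0 : A (W y) = 0 := by
    ext1 v
    by_contra hne
    have := h.pos y (A (W y) v) hne
    exact this.ne' (hzero _ _ _)
  rw [hAd W hW] at hA0
  exact sub_eq_zero.1 hA0

/-- The torsion of a connection satisfies the Nijenhuis condition for `S`. -/
def NijenhuisCondition {V : Type*} [AddCommGroup V] (S : V → V) (T : V → V → V) : Prop :=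
  ∀ v w, T (S v) (S w) - S (T (S v) w) - S (T v (S w)) - T v w = 0

/-- Replace every bracket by `∇_V W - ∇_W V - T(V, W)`. Since `J` is parallel and squares to -1, all
covariant derivatives cancel and only torsion is left. -/
theorem IsHKTAt.nijenhuis (hc : IsHKTAt J h cov y T) (a : Fin 3)
    (hJ : ∀ v : TangentSpace (𝓡 q) y, J a y (J a y v) = -v)
    (hJs : ∀ V, DiffField V y → DiffField (fun x => J a x (V x)) y)
    {X Y : (x : N) → TangentSpace (𝓡 q) x} (hX : DiffField X y) (hY : DiffField Y y) :
    VectorField.mlieBracket (𝓡 q) (fun y => J a y (X y)) (fun y => J a y (Y y)) y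
      - J a y (VectorField.mlieBracket (𝓡 q) (fun y => J a y (X y)) Y y)
      - J a y (VectorField.mlieBracket (𝓡 q) X (fun y => J a y (Y y)) y)
      - VectorField.mlieBracket (𝓡 q) X Y y =
    - (T (J a y (X y)) (J a y (Y y)) - J a y (T (J a y (X y)) (Y y))
        - J a y (T (X y) (J a y (Y y))) - T (X y) (Y y)) := by
  have t1 := hc.torsion _ _ (hJs _ hX) (hJs _ hY)
  have t2 := hc.torsion _ _ (hJs _ hX) hY
  have t3 := hc.torsion _ _ hX (hJs _ hY)
  have t4 := hc.torsion _ _ hX hY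
  simp only [hc.complex a _ _ hX, hc.complex a _ _ hY] at t1 t2 t3
  rw [← t1, ← t2, ← t3, ← t4]
  simp only [map_sub, hJ]
  abel

end PointwiseHKT

/-! ### Pointwise consequences of an HKT structure -/

section HKTManifold

variable {q : ℕ} {N : Type*} [TopologicalSpace N] [ChartedSpace (Eu q) N] [IsManifold (𝓡 q) ∞ N]

theorem HypercomplexStructure.smoothField (𝓘c : HypercomplexStructure q N) (a : Fin 3)
    {V : (x : N) → TangentSpace (𝓡 q) x} {x : N} (hV : SmoothField V x) :
    SmoothField (fun x => 𝓘c.I a x (V x)) x :=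
  ContMDiffAt.clm_bundle_apply (𝓘c.smooth a x) hV

theorem diffField_endField {J : EndField q N} {x : N}
    (hJ : ContMDiffAt (𝓡 q) ((𝓡 q).prod 𝓘(ℝ, Eu q →L[ℝ] Eu q)) ∞
    (fun x => TotalSpace.mk' (Eu q →L[ℝ] Eu q)
      (E := fun x : N => TangentSpace (𝓡 q) x →L[ℝ] TangentSpace (𝓡 q) x) x (J x)) x)
    {V : (x : N) → TangentSpace (𝓡 q) x} (hV : DiffField V x) :
    DiffField (fun x => J x (V x)) x :=
  MDifferentiableAt.clm_bundle_apply (hJ.mdifferentiableAt (by decide)) hV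

theorem HypercomplexStructure.diffField (𝓘c : HypercomplexStructure q N) (a : Fin 3)
    {V : (x : N) → TangentSpace (𝓡 q) x} {x : N} (hV : DiffField V x) :
    DiffField (fun x => 𝓘c.I a x (V x)) x :=
  diffField_endField (𝓘c.smooth a x) hV

theorem contMDiffAt_inner (g : Metric q N) {V W : (x : N) → TangentSpace (𝓡 q) x} {x : N}
    (hV : SmoothField V x) (hW : SmoothField W x) :
    ContMDiffAt (𝓡 q) 𝓘(ℝ, ℝ) ∞ (fun x => g.inner x (V x) (W x)) x := by
  have := ContMDiffAt.clm_bundle_apply₂ (F₁ := Eu q) (F₂ := Eu q) (g.contMDiff x) hV hW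
  exact (contMDiffAt_section x).1 this

theorem mdifferentiableAt_inner (g : Metric q N) {V W : (x : N) → TangentSpace (𝓡 q) x} {x : N}
    (hV : DiffField V x) (hW : DiffField W x) :
    MDifferentiableAt (𝓡 q) 𝓘(ℝ, ℝ) (fun x => g.inner x (V x) (W x)) x := by
  have := MDifferentiableAt.clm_bundle_apply₂ (F₁ := Eu q) (F₂ := Eu q)
    ((g.contMDiff x).mdifferentiableAt (by decide)) hV hW
  exact (mdifferentiableAt_section (𝓡 q) _).1 this

theorem IsHKTConnection.isHKTAt {𝓘c : HypercomplexStructure q N} {g : Metric q N}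
    {D : Connection q N} (hD : IsHKTConnection 𝓘c g D) (x : N) :
    IsHKTAt 𝓘c.I g D x (fun v w => D.torsion x v w) where
  isCov := D.isCovariantDerivativeOn
  metric := fun Y Z v hY hZ => hD.metric Y Z x v hY hZ
  complex := fun a Y v hY => hD.complex a Y x v hY
  torsion := fun V W hV hW => (D.torsion_apply hV hW).symm
  skew := hD.torsion_skew x

/-- This turns integrability into an algebraic condition on the torsion at each point, a form in
which it can be pushed forward by a linear map. -/
theorem IsHKTConnection.nijenhuisCondition {𝓘c : HypercomplexStructure q N} {g : Metric q N}
    {D : Connection q N} (hD : IsHKTConnection 𝓘c g D) (a : Fin 3) (x : N) :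
    NijenhuisCondition (𝓘c.I a x) (fun v w => D.torsion x v w) := by
  intro v w
  have h1 := (hD.isHKTAt x).nijenhuis a (𝓘c.sq a x) (fun _ hV => 𝓘c.diffField a hV)
    (diffField_extend v) (diffField_extend w)
  have h2 := 𝓘c.integrable a _ _ x (diffField_extend v) (diffField_extend w)
  rw [h2] at h1
  have h3 := neg_eq_zero.1 h1.symm
  simpa using h3

end HKTManifold

/-! ### Inverting smooth families of forms -/

section Inverse

theorem isInvertible_of_injective {E F : Type*} [NormedAddCommGroup E] [NormedSpace ℝ E]
    [FiniteDimensional ℝ E] [NormedAddCommGroup F] [NormedSpace ℝ F] [FiniteDimensional ℝ F]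
    (A : E →L[ℝ] F) (hA : Function.Injective A) (h : Module.finrank ℝ E = Module.finrank ℝ F) :
    A.IsInvertible :=
  ⟨(LinearMap.linearEquivOfInjective (A : E →ₗ[ℝ] F) hA h).toContinuousLinearEquiv, by
    ext v; rfl⟩

variable {n : ℕ} {M : Type*} [TopologicalSpace M] [ChartedSpace (Eu n) M] [IsManifold (𝓡 n) ∞ M]
  {F : Type*} [NormedAddCommGroup F] [NormedSpace ℝ F]

theorem extend_symm {x₀ : M} (u : Eu n) :
    FiberBundle.extend (Eu n) ((trivializationAt (Eu n) (TangentSpace (𝓡 n) : M → Type _) x₀).symm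
      x₀ u) = fun x => (trivializationAt (Eu n) (TangentSpace (𝓡 n) : M → Type _) x₀).symm x u := by
  funext x
  have h0 : x₀ ∈ (trivializationAt (Eu n) (TangentSpace (𝓡 n) : M → Type _) x₀).baseSet :=
    FiberBundle.mem_baseSet_trivializationAt' x₀
  simp only [FiberBundle.extend]
  rw [Bundle.Trivialization.apply_mk_symm _ h0 u]

/-- A field of forms in a frame. -/
theorem contMDiffAt_frame {B : (x : M) → TangentSpace (𝓡 n) x →L[ℝ] F} {x₀ : M}
    (hB : ∀ v : TangentSpace (𝓡 n) x₀,
      ContMDiffAt (𝓡 n) 𝓘(ℝ, F) ∞ (fun x => B x (FiberBundle.extend (Eu n) v x)) x₀) :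
    ContMDiffAt (𝓡 n) 𝓘(ℝ, Eu n →L[ℝ] F) ∞ (fun x => ((B x).comp
      ((trivializationAt (Eu n) (TangentSpace (𝓡 n) : M → Type _) x₀).symmL ℝ x) :
        Eu n →L[ℝ] F)) x₀ := by
  refine contMDiffAt_clm_of_apply fun u => ?_
  have h1 := hB ((trivializationAt (Eu n) (TangentSpace (𝓡 n) : M → Type _) x₀).symm x₀ u)
  rw [extend_symm] at h1
  refine h1.congr_of_eventuallyEq ?_
  filter_upwards [(trivializationAt (Eu n) (TangentSpace (𝓡 n) : M → Type _)
    x₀).open_baseSet.mem_nhds (FiberBundle.mem_baseSet_trivializationAt' x₀)] with x hx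
  exact congrArg (B x) (Bundle.Trivialization.symmL_apply _ hx u)


/-- In a trivialization the family maps into a fixed space of operators, where inversion is smooth
near an invertible one. The version for merely differentiable data is needed because metricity,
parallelism and torsion are tested on differentiable fields. -/
theorem eventually_inverse {B : (x : M) → TangentSpace (𝓡 n) x →L[ℝ] F} {x₀ : M}
    (hB : ∀ v : TangentSpace (𝓡 n) x₀,
      ContMDiffAt (𝓡 n) 𝓘(ℝ, F) ∞ (fun x => B x (FiberBundle.extend (Eu n) v x)) x₀)
    (hinv : (B x₀).IsInvertible) :
    (∀ᶠ x in 𝓝 x₀, (B x).IsInvertible) ∧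
    (∀ f : M → F, ContMDiffAt (𝓡 n) 𝓘(ℝ, F) ∞ f x₀ →
      SmoothField (fun x => (B x).inverse (f x)) x₀) ∧
    (∀ f : M → F, MDifferentiableAt (𝓡 n) 𝓘(ℝ, F) f x₀ →
      DiffField (fun x => (B x).inverse (f x)) x₀) := by
  set t := trivializationAt (Eu n) (TangentSpace (𝓡 n) : M → Type _) x₀ with ht
  have h0 : x₀ ∈ t.baseSet := FiberBundle.mem_baseSet_trivializationAt' x₀
  set Φ : M → (Eu n →L[ℝ] F) := fun x => (B x).comp (t.symmL ℝ x) with hΦ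
  have hΦs : ContMDiffAt (𝓡 n) 𝓘(ℝ, Eu n →L[ℝ] F) ∞ Φ x₀ := contMDiffAt_frame hB
  let e : ∀ x ∈ t.baseSet, TangentSpace (𝓡 n) x ≃L[ℝ] Eu n := fun x hx =>
    t.continuousLinearEquivAt ℝ x hx
  have hΦe : ∀ x (hx : x ∈ t.baseSet), Φ x = (B x).comp ((e x hx).symm : Eu n →L[ℝ] _) := by
    intro x hx
    rw [hΦ]
    simp only [e]
    congr 1
    exact (Bundle.Trivialization.symm_continuousLinearEquivAt_eq' (R := ℝ) t hx).symm
  obtain ⟨e₀, he₀⟩ := hinv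
  have hΦ0 : Φ x₀ = (((e x₀ h0).symm.trans e₀ : Eu n ≃L[ℝ] F) : Eu n →L[ℝ] F) := by
    rw [hΦe x₀ h0, ← he₀]; rfl
  have hinvs : ContMDiffAt (𝓡 n) 𝓘(ℝ, F →L[ℝ] Eu n) ∞ (fun x => (Φ x).inverse) x₀ := by
    have h1 : ContDiffAt ℝ ∞ ContinuousLinearMap.inverse (Φ x₀) := by
      rw [hΦ0]; exact contDiffAt_map_inverse _
    exact h1.contMDiffAt.comp x₀ hΦs
  have hev : ∀ᶠ x in 𝓝 x₀, (Φ x).IsInvertible := by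
    have := (hΦs.continuousAt).eventually (ContinuousLinearEquiv.nhds ((e x₀ h0).symm.trans e₀) |>
      fun h => hΦ0 ▸ h)
    exact this
  have heq : ∀ᶠ x in 𝓝 x₀, ∀ v, (t ⟨x, (B x).inverse v⟩).2 = (Φ x).inverse v := by
    filter_upwards [t.open_baseSet.mem_nhds h0] with x hx v
    rw [hΦe x hx, ContinuousLinearMap.inverse_comp_equiv]
    rfl
  have hsec : ∀ f : M → F, (fun x => (t ⟨x, (B x).inverse (f x)⟩).2) =ᶠ[𝓝 x₀]
      fun x => (Φ x).inverse (f x) := fun f => heq.mono fun x hx => hx (f x)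
  refine ⟨?_, fun f hf => ?_, fun f hf => ?_⟩
  · filter_upwards [hev, t.open_baseSet.mem_nhds h0] with x h hx
    rw [hΦe x hx] at h
    exact (ContinuousLinearMap.isInvertible_comp_equiv).1 h
  · refine (contMDiffAt_section x₀).2 ?_
    exact (hinvs.clm_apply hf).congr_of_eventuallyEq (hsec f)
  · refine (mdifferentiableAt_section (𝓡 n) _).2 ?_
    exact ((hinvs.mdifferentiableAt (by decide)).clm_apply hf).congr_of_eventuallyEq (hsec f)

/-- The form `u ↦ b (u, s ·)`. -/
def pullRight {E F : Type*} [NormedAddCommGroup E] [NormedSpace ℝ E]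
    [NormedAddCommGroup F] [NormedSpace ℝ F] (b : F →L[ℝ] F →L[ℝ] ℝ) (s : E →L[ℝ] F) :
    F →L[ℝ] E →L[ℝ] ℝ :=
  (b.flip.comp s).flip

/-- Vector fields are smooth if their inner products with smooth vector fields are smooth. -/
theorem smoothField_of_inner (h : Metric n M) {K : (y : M) → TangentSpace (𝓡 n) y} {y : M}
    (hK : ∀ z : TangentSpace (𝓡 n) y, ContMDiffAt (𝓡 n) 𝓘(ℝ, ℝ) ∞
      (fun x => h.inner x (K x) (FiberBundle.extend (Eu n) z x)) y) : SmoothField K y := by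
  set t := trivializationAt (Eu n) (TangentSpace (𝓡 n) : M → Type _) y with ht
  have h0 : y ∈ t.baseSet := FiberBundle.mem_baseSet_trivializationAt' y
  -- This is the isomorphism from vectors to covectors given by the metric, with covectors expressed
  -- in a frame. The hypothesis says that `B x (K x)` is smooth, and `K` is recovered by inverting
  -- `B`.
  let B : (x : M) → TangentSpace (𝓡 n) x →L[ℝ] (Eu n →L[ℝ] ℝ) := fun x =>
    pullRight (E := Eu n) (F := Eu n) (h.inner x) (t.symmL ℝ x)
  have hBa : ∀ x ∈ t.baseSet, ∀ u z, B x u z = h.inner x u (t.symm x z) := fun x hx u z =>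
    congrArg (h.inner x u) (Bundle.Trivialization.symmL_apply t hx z)
  have hKB : ∀ K : (y : M) → TangentSpace (𝓡 n) y, (∀ z : TangentSpace (𝓡 n) y,
      ContMDiffAt (𝓡 n) 𝓘(ℝ, ℝ) ∞
      (fun x => h.inner x (K x) (FiberBundle.extend (Eu n) z x)) y) →
      ContMDiffAt (𝓡 n) 𝓘(ℝ, Eu n →L[ℝ] ℝ) ∞ (fun x => B x (K x)) y := by
    intro K hK
    refine contMDiffAt_clm_of_apply fun z => ?_
    have h1 := hK (t.symm y z)
    rw [extend_symm] at h1
    refine h1.congr_of_eventuallyEq ?_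
    filter_upwards [t.open_baseSet.mem_nhds h0] with x hx
    exact hBa x hx _ _
  have hBinj : Function.Injective (B y) := by
    rw [injective_iff_map_eq_zero]
    intro u hu
    by_contra hne
    have h1 := hBa y h0 u (t ⟨y, u⟩).2
    rw [hu, Bundle.Trivialization.symm_proj_apply t ⟨y, u⟩ h0] at h1
    exact (h.pos y u hne).ne h1
  have hBinv : (B y).IsInvertible := isInvertible_of_injective (E := Eu n) _ hBinj (by
    rw [← LinearMap.toContinuousLinearMap.finrank_eq, Module.finrank_linearMap,
      Module.finrank_self, mul_one])
  obtain ⟨h1, h2, -⟩ := eventually_inverse (B := B) (x₀ := y) (fun v => hKB _ fun z =>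
    contMDiffAt_inner h (smoothField_extend v) (smoothField_extend z)) hBinv
  refine (h2 _ (hKB K hK)).congr_of_eventuallyEq ?_
  filter_upwards [h1] with x hx
  exact congrArg (TotalSpace.mk x) (hx.inverse_apply_self _).symm

end Inverse

/-! ### Reduction data, lifts and orthogonal projection -/

section Retraction

variable {n p q : ℕ} {M P N : Type*}
  [TopologicalSpace M] [ChartedSpace (Eu n) M]
  [TopologicalSpace P] [ChartedSpace (Eu p) P]
  [TopologicalSpace N] [ChartedSpace (Eu q) N]

/-- The chain rule for `R ∘ i = pr`. It serves for extensions of a projection, for retractions (`pr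
= id`), and for sections (`i = σ`, `R` the projection). -/
theorem mfderiv_retraction {i : P → M} {pr : P → N} {R : M → N} {m : P}
    (hi : MDifferentiableAt (𝓡 p) (𝓡 n) i m) (hR : MDifferentiableAt (𝓡 n) (𝓡 q) R (i m))
    (h : ∀ᶠ m' in 𝓝 m, R (i m') = pr m') (τ : TangentSpace (𝓡 p) m) :
    (mfderiv (𝓡 n) (𝓡 q) R (i m) (mfderiv (𝓡 p) (𝓡 n) i m τ) : Eu q)
      = mfderiv (𝓡 p) (𝓡 q) pr m τ := by
  have h1 : mfderiv (𝓡 p) (𝓡 q) pr m = mfderiv (𝓡 p) (𝓡 q) (R ∘ i) m :=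
    Filter.EventuallyEq.mfderiv_eq (h.mono fun x hx => hx.symm)
  rw [mfderiv_comp m hR hi] at h1
  exact (DFunLike.congr_fun h1 τ).symm

end Retraction

section Reduction

variable {n p q : ℕ} {M P N : Type*}
  [TopologicalSpace M] [ChartedSpace (Eu n) M] [IsManifold (𝓡 n) ∞ M]
  [TopologicalSpace P] [ChartedSpace (Eu p) P] [IsManifold (𝓡 p) ∞ P]
  [TopologicalSpace N] [ChartedSpace (Eu q) N] [IsManifold (𝓡 q) ∞ N]

/-- The properties of a submanifold `i : P → M`, a quotient `pr : P → N` and a distribution `U`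
along `P` that make the geometric structures of `M` descend to `N`. -/
structure IsReduction (i : P → M) (pr : P → N) (U : (x : M) → Submodule ℝ (TangentSpace (𝓡 n) x))
    (𝓘c : HypercomplexStructure n M) (g : Metric n M) : Prop where
  smooth_incl : ContMDiff (𝓡 p) (𝓡 n) ∞ i
  smooth_proj : ContMDiff (𝓡 p) (𝓡 q) ∞ pr
  surjective_proj : Function.Surjective pr
  invariant : ∀ m a, ∀ t ∈ U (i m), 𝓘c.I a (i m) t ∈ U (i m)
  exists_lift : ∀ m, ∃ L : TangentSpace (𝓡 q) (pr m) →L[ℝ] TangentSpace (𝓡 n) (i m),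
    ∀ t v, IsLift (p := p) i pr U m t v ↔ t = L v
  tangent : ∀ m, ∀ t ∈ U (i m), ∃ τ : TangentSpace (𝓡 p) m, mfderiv (𝓡 p) (𝓡 n) i m τ = t
  orth : ∀ m (τ : TangentSpace (𝓡 p) m), ∀ u ∈ U (i m), mfderiv (𝓡 p) (𝓡 q) pr m τ = 0 →
    g.inner (i m) (mfderiv (𝓡 p) (𝓡 n) i m τ) u = 0
  fibre : ∀ m m', pr m = pr m' → ∃ φ : TangentSpace (𝓡 n) (i m) → TangentSpace (𝓡 n) (i m'),
    (∀ a t, φ (𝓘c.I a (i m) t) = 𝓘c.I a (i m') (φ t)) ∧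
    (∀ t t', g.inner (i m') (φ t) (φ t') = g.inner (i m) t t') ∧
    ∀ t (v : Eu q), IsLift (p := p) i pr U m t v → IsLift (p := p) i pr U m' (φ t) v
  exists_section : ∀ m, ∃ σ : N → P, σ (pr m) = m ∧
    ∀ᶠ y in 𝓝 (pr m), ContMDiffAt (𝓡 q) (𝓡 p) ∞ σ y ∧ pr (σ y) = y
  exists_extension : ∀ m, ∃ (R : M → N)
    (W : ((y : N) → TangentSpace (𝓡 q) y) → (x : M) → TangentSpace (𝓡 n) x),
    (∀ᶠ x in 𝓝 (i m), ContMDiffAt (𝓡 n) (𝓡 q) ∞ R x) ∧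
    (∀ᶠ m' in 𝓝 m, R (i m') = pr m') ∧
    (∀ᶠ m' in 𝓝 m, ∀ w, IsLift (p := p) i pr U m' (W w (i m')) (w (pr m'))) ∧
    (∀ w, DiffField w (pr m) → DiffField (W w) (i m)) ∧
    (∀ w, (∀ᶠ y in 𝓝 (pr m), SmoothField w y) → ∀ᶠ x in 𝓝 (i m), SmoothField (W w) x) ∧
    (∀ v w, DiffField v (pr m) → DiffField w (pr m) → ∃ τ : TangentSpace (𝓡 p) m,
      mfderiv (𝓡 p) (𝓡 n) i m τ = VectorField.mlieBracket (𝓡 n) (W v) (W w) (i m) ∧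
      mfderiv (𝓡 p) (𝓡 q) pr m τ = VectorField.mlieBracket (𝓡 q) v w (pr m))

/-- By positivity `v ↦ b (L v) (L ·)` is injective from E to its dual, hence bijective by dimension.
When `b` is symmetric, Λ is the orthogonal projection to the range of `L` followed by the inverse of
`L`. -/
theorem exists_adjoint {E F : Type*} [NormedAddCommGroup E] [NormedSpace ℝ E]
    [FiniteDimensional ℝ E] [NormedAddCommGroup F] [NormedSpace ℝ F] [FiniteDimensional ℝ F]
    (b : F →L[ℝ] F →L[ℝ] ℝ) (hpos : ∀ v, v ≠ 0 → 0 < b v v)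
    (L : E →L[ℝ] F) (hL : Function.Injective L) :
    ∃ Λ : F →L[ℝ] E, ∀ t u, b (L (Λ t)) (L u) = b t (L u) := by
  let β : F →ₗ[ℝ] (E →ₗ[ℝ] ℝ) := LinearMap.mk₂ ℝ (fun t u => b t (L u)) (by simp) (by simp)
    (by simp) (by simp)
  have hinj : Function.Injective (β ∘ₗ (L : E →ₗ[ℝ] F)) := by
    rw [← LinearMap.ker_eq_bot, LinearMap.ker_eq_bot']
    intro v hv
    by_contra hne
    have h1 : L v ≠ 0 := fun h => hne (hL (by rw [h, map_zero]))
    have h2 : b (L v) (L v) = 0 := LinearMap.congr_fun hv v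
    exact (hpos _ h1).ne' h2
  let e := LinearMap.linearEquivOfInjective (β ∘ₗ (L : E →ₗ[ℝ] F)) hinj
    (by rw [Module.finrank_linearMap, Module.finrank_self, mul_one])
  refine ⟨LinearMap.toContinuousLinearMap (e.symm.toLinearMap ∘ₗ β), fun t u => ?_⟩
  have h1 : e (e.symm (β t)) = β t := e.apply_symm_apply _
  exact LinearMap.congr_fun h1 u

namespace IsReduction

variable {i : P → M} {pr : P → N} {U : (x : M) → Submodule ℝ (TangentSpace (𝓡 n) x)}
  {𝓘c : HypercomplexStructure n M} {g : Metric n M}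

/-- The lift of tangent vectors. -/
def L (hr : IsReduction (p := p) (q := q) i pr U 𝓘c g) (m : P) :
    TangentSpace (𝓡 q) (pr m) →L[ℝ] TangentSpace (𝓡 n) (i m) :=
  (hr.exists_lift m).choose

variable (hr : IsReduction (p := p) (q := q) i pr U 𝓘c g)

theorem isLift_iff (m : P) (t : TangentSpace (𝓡 n) (i m)) (v : TangentSpace (𝓡 q) (pr m)) :
    IsLift (p := p) i pr U m t v ↔ t = hr.L m v :=
  (hr.exists_lift m).choose_spec t v

theorem isLift_L (m : P) (v : TangentSpace (𝓡 q) (pr m)) :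
    IsLift (p := p) i pr U m (hr.L m v) v := (hr.isLift_iff m _ _).2 rfl

theorem L_mem (m : P) (v : TangentSpace (𝓡 q) (pr m)) : hr.L m v ∈ U (i m) := (hr.isLift_L m v).1

theorem L_injective (m : P) : Function.Injective (hr.L m) := by
  rw [injective_iff_map_eq_zero]
  intro v hv
  obtain ⟨hu, τ, hτ, hv'⟩ := hr.isLift_L m v
  obtain ⟨R, -, hR, hRi, -⟩ := hr.exists_extension m
  have h1 := mfderiv_retraction (hr.smooth_incl.mdifferentiable (by decide) m)
    (hR.self_of_nhds.mdifferentiableAt (by decide)) hRi τ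
  rw [hτ, hv, hv'] at h1
  rw [← h1]
  exact map_zero _

theorem exists_adjoint_L (m : P) : ∃ Λ : TangentSpace (𝓡 n) (i m) →L[ℝ] TangentSpace (𝓡 q) (pr m),
    ∀ t u, g.inner (i m) (hr.L m (Λ t)) (hr.L m u) = g.inner (i m) t (hr.L m u) :=
  exists_adjoint (E := Eu q) (F := Eu n) (g.inner (i m)) (g.pos (i m)) (hr.L m) (hr.L_injective m)

/-- The left inverse of the lift with kernel orthogonal to `U`. -/
def Λ (m : P) : TangentSpace (𝓡 n) (i m) →L[ℝ] TangentSpace (𝓡 q) (pr m) :=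
  (hr.exists_adjoint_L m).choose

theorem inner_L_Λ (m : P) (t : TangentSpace (𝓡 n) (i m)) (u : TangentSpace (𝓡 q) (pr m)) :
    g.inner (i m) (hr.L m (hr.Λ m t)) (hr.L m u) = g.inner (i m) t (hr.L m u) :=
  (hr.exists_adjoint_L m).choose_spec t u

theorem Λ_eq (m : P) {t : TangentSpace (𝓡 n) (i m)} {k : TangentSpace (𝓡 q) (pr m)}
    (h : ∀ u, g.inner (i m) (hr.L m k) (hr.L m u) = g.inner (i m) t (hr.L m u)) :
    hr.Λ m t = k := by
  by_contra hne
  have h1 : hr.L m (hr.Λ m t - k) ≠ 0 := fun h0 =>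
    hne (sub_eq_zero.1 (hr.L_injective m (h0.trans (map_zero _).symm)))
  refine (g.pos (i m) _ h1).ne' ?_
  have h2 := hr.inner_L_Λ m t (hr.Λ m t - k)
  have h3 := h (hr.Λ m t - k)
  rw [← h3] at h2
  conv_lhs => enter [1]; rw [map_sub, map_sub]
  exact sub_eq_zero.2 h2

theorem Λ_L (m : P) (v : TangentSpace (𝓡 q) (pr m)) : hr.Λ m (hr.L m v) = v :=
  hr.Λ_eq m fun _ => rfl

theorem exists_isLift (m : P) {t : TangentSpace (𝓡 n) (i m)} (ht : t ∈ U (i m)) :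
    ∃ v, t = hr.L m v := by
  obtain ⟨τ, hτ⟩ := hr.tangent m t ht
  exact ⟨_, (hr.isLift_iff m _ _).1 ⟨ht, τ, hτ, rfl⟩⟩

theorem L_Λ (m : P) {t : TangentSpace (𝓡 n) (i m)} (ht : t ∈ U (i m)) :
    hr.L m (hr.Λ m t) = t := by
  obtain ⟨v, rfl⟩ := hr.exists_isLift m ht
  rw [Λ_L]

/-- A tangent vector of P and the lift of its projection differ by a vertical vector, which is
orthogonal to U and so does not contribute to Λ. Here the orthogonality assumption enters. -/
theorem Λ_tangent (m : P) (τ : TangentSpace (𝓡 p) m) :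
    hr.Λ m (mfderiv (𝓡 p) (𝓡 n) i m τ) = mfderiv (𝓡 p) (𝓡 q) pr m τ := by
  obtain ⟨hu, σ, hσ, hσ'⟩ := hr.isLift_L m (mfderiv (𝓡 p) (𝓡 q) pr m τ)
  refine hr.Λ_eq m fun u => ?_
  have h := hr.orth m (σ - τ) (hr.L m u) (hr.L_mem m u) (by rw [map_sub, hσ', sub_self])
  rw [map_sub, hσ, map_sub] at h
  exact sub_eq_zero.1 h

theorem fibre_L {m m' : P} (h : pr m = pr m') :
    ∃ φ : TangentSpace (𝓡 n) (i m) → TangentSpace (𝓡 n) (i m'),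
    (∀ a t, φ (𝓘c.I a (i m) t) = 𝓘c.I a (i m') (φ t)) ∧
    (∀ t t', g.inner (i m') (φ t) (φ t') = g.inner (i m) t t') ∧
    ∀ v : Eu q, φ (hr.L m v) = hr.L m' v := by
  obtain ⟨φ, h1, h2, h3⟩ := hr.fibre m m' h
  exact ⟨φ, h1, h2, fun v => (hr.isLift_iff m' _ _).1 (h3 _ v (hr.isLift_L m v))⟩

/-- A point in each fibre. -/
def point (y : N) : P := (hr.surjective_proj y).choose

theorem proj_point (y : N) : pr (hr.point y) = y := (hr.surjective_proj y).choose_spec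

/-- The endomorphisms induced on the quotient. -/
def redI (a : Fin 3) : EndField q N := fun y =>
  (hr.Λ (hr.point y)).comp ((𝓘c.I a (i (hr.point y))).comp (hr.L (hr.point y)))

/-- `redI` is defined at a chosen point of the fibre. The map φ between points of a fibre commutes
with `I_a` and carries lifts to lifts, so the same relation holds at every `m`. -/
theorem L_redI (m : P) (a : Fin 3) (v : TangentSpace (𝓡 q) (pr m)) :
    hr.L m (hr.redI a (pr m) v) = 𝓘c.I a (i m) (hr.L m v) := by
  obtain ⟨φ, h1, -, h3⟩ := hr.fibre_L (hr.proj_point (pr m))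
  have h4 : hr.L (hr.point (pr m)) (hr.redI a (pr m) v)
      = 𝓘c.I a (i (hr.point (pr m))) (hr.L (hr.point (pr m)) v) :=
    hr.L_Λ (hr.point (pr m)) (hr.invariant _ a _ (hr.L_mem (hr.point (pr m)) v))
  have h5 := congrArg φ h4
  refine (h3 _).symm.trans (h5.trans ((h1 _ _).trans ?_))
  exact congrArg _ (h3 v)

/-- The pullback of a bilinear form. -/
def _root_.HKT.pullbackForm {E F : Type*} [NormedAddCommGroup E] [NormedSpace ℝ E]
    [NormedAddCommGroup F] [NormedSpace ℝ F] (b : F →L[ℝ] F →L[ℝ] ℝ) (L : E →L[ℝ] F) :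
    E →L[ℝ] E →L[ℝ] ℝ :=
  b.bilinearComp L L

/-- The metric induced on the quotient, as a field of bilinear forms. -/
def redInner (y : N) : TangentSpace (𝓡 q) y →L[ℝ] TangentSpace (𝓡 q) y →L[ℝ] ℝ :=
  pullbackForm (E := Eu q) (F := Eu n) (g.inner (i (hr.point y))) (hr.L (hr.point y))

theorem redInner_eq (m : P) (v w : TangentSpace (𝓡 q) (pr m)) :
    hr.redInner (pr m) v w = g.inner (i m) (hr.L m v) (hr.L m w) := by
  obtain ⟨φ, -, h2, h3⟩ := hr.fibre_L (hr.proj_point (pr m))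
  have h4 := h2 (hr.L (hr.point (pr m)) v) (hr.L (hr.point (pr m)) w)
  have e1 : φ (hr.L (hr.point (pr m)) v) = hr.L m v := h3 v
  have e2 : φ (hr.L (hr.point (pr m)) w) = hr.L m w := h3 w
  rw [e1, e2] at h4
  exact h4.symm

section Extension

variable (m : P)

/-- A smooth extension of `pr` to a neighbourhood of `i m`. -/
def R (m : P) : M → N := (hr.exists_extension m).choose

/-- An extension of the lift of a vector field to a neighbourhood of `i m`. -/
def ext (m : P) : ((y : N) → TangentSpace (𝓡 q) y) → (x : M) → TangentSpace (𝓡 n) x :=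
  (hr.exists_extension m).choose_spec.choose

theorem R_smooth : ∀ᶠ x in 𝓝 (i m), ContMDiffAt (𝓡 n) (𝓡 q) ∞ (hr.R m) x :=
  (hr.exists_extension m).choose_spec.choose_spec.1

theorem R_incl : ∀ᶠ m' in 𝓝 m, hr.R m (i m') = pr m' :=
  (hr.exists_extension m).choose_spec.choose_spec.2.1

theorem isLift_ext : ∀ᶠ m' in 𝓝 m, ∀ w, IsLift (p := p) i pr U m' (hr.ext m w (i m')) (w (pr m')) :=
  (hr.exists_extension m).choose_spec.choose_spec.2.2.1

theorem diffField_ext {w : (y : N) → TangentSpace (𝓡 q) y} (hw : DiffField w (pr m)) :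
    DiffField (hr.ext m w) (i m) :=
  (hr.exists_extension m).choose_spec.choose_spec.2.2.2.1 w hw

theorem smoothField_ext {w : (y : N) → TangentSpace (𝓡 q) y}
    (hw : ∀ᶠ y in 𝓝 (pr m), SmoothField w y) :
    ∀ᶠ x in 𝓝 (i m), SmoothField (hr.ext m w) x :=
  (hr.exists_extension m).choose_spec.choose_spec.2.2.2.2.1 w hw

theorem exists_bracket {v w : (y : N) → TangentSpace (𝓡 q) y} (hv : DiffField v (pr m))
    (hw : DiffField w (pr m)) : ∃ τ : TangentSpace (𝓡 p) m,
      mfderiv (𝓡 p) (𝓡 n) i m τ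
        = VectorField.mlieBracket (𝓡 n) (hr.ext m v) (hr.ext m w) (i m) ∧
      mfderiv (𝓡 p) (𝓡 q) pr m τ = VectorField.mlieBracket (𝓡 q) v w (pr m) :=
  (hr.exists_extension m).choose_spec.choose_spec.2.2.2.2.2 v w hv hw

theorem ext_eq : ∀ᶠ m' in 𝓝 m, ∀ w, hr.ext m w (i m') = hr.L m' (w (pr m')) :=
  (hr.isLift_ext m).mono fun m' h w => (hr.isLift_iff m' _ _).1 (h w)

/-- The local section through `m`. -/
def σ (m : P) : N → P := (hr.exists_section m).choose

theorem σ_proj : hr.σ m (pr m) = m := (hr.exists_section m).choose_spec.1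

theorem σ_smooth : ∀ᶠ y in 𝓝 (pr m), ContMDiffAt (𝓡 q) (𝓡 p) ∞ (hr.σ m) y :=
  (hr.exists_section m).choose_spec.2.mono fun _ h => h.1

theorem proj_σ : ∀ᶠ y in 𝓝 (pr m), pr (hr.σ m y) = y :=
  (hr.exists_section m).choose_spec.2.mono fun _ h => h.2

theorem tendsto_σ : Tendsto (hr.σ m) (𝓝 (pr m)) (𝓝 m) := by
  have := (hr.σ_smooth m).self_of_nhds.continuousAt.tendsto
  rwa [hr.σ_proj] at this

theorem incl_σ_smooth : ContMDiffAt (𝓡 q) (𝓡 n) ∞ (fun y => i (hr.σ m y)) (pr m) :=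
  hr.smooth_incl.contMDiffAt.comp (pr m) (hr.σ_smooth m).self_of_nhds

/-- A function on `M` that is smooth at `i m` gives by restriction a smooth function on `N`. -/
theorem contMDiffAt_comp_σ {E : Type*} [NormedAddCommGroup E] [NormedSpace ℝ E] {f : M → E}
    (hf : ContMDiffAt (𝓡 n) 𝓘(ℝ, E) ∞ f (i m)) :
    ContMDiffAt (𝓡 q) 𝓘(ℝ, E) ∞ (fun y => f (i (hr.σ m y))) (pr m) := by
  refine ContMDiffAt.comp (I' := 𝓡 n) (pr m) ?_ (hr.incl_σ_smooth m)
  rwa [hr.σ_proj]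

/-- Locally this function is the restriction along `i ∘ σ` of the inner product of two smooth fields
on M. -/
theorem redInner_smooth (m : P) {v w : (y : N) → TangentSpace (𝓡 q) y}
    (hv : ∀ᶠ y in 𝓝 (pr m), SmoothField v y) (hw : ∀ᶠ y in 𝓝 (pr m), SmoothField w y) :
    ContMDiffAt (𝓡 q) 𝓘(ℝ, ℝ) ∞ (fun y => hr.redInner y (v y) (w y)) (pr m) := by
  have h1 := hr.contMDiffAt_comp_σ m (contMDiffAt_inner g (hr.smoothField_ext m hv).self_of_nhds
    (hr.smoothField_ext m hw).self_of_nhds)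
  refine h1.congr_of_eventuallyEq ?_
  filter_upwards [(hr.tendsto_σ m).eventually (hr.ext_eq m), hr.proj_σ m] with y h2 h3
  have h4 := hr.redInner_eq (hr.σ m y) (v (pr (hr.σ m y))) (w (pr (hr.σ m y)))
  rw [← h2, ← h2] at h4
  rw [← h4, h3]

theorem redInner_contMDiff : ContMDiff (𝓡 q) ((𝓡 q).prod 𝓘(ℝ, Eu q →L[ℝ] Eu q →L[ℝ] ℝ)) ∞
    (fun y => TotalSpace.mk' (Eu q →L[ℝ] Eu q →L[ℝ] ℝ)
      (E := fun y : N => TangentSpace (𝓡 q) y →L[ℝ] TangentSpace (𝓡 q) y →L[ℝ] ℝ) y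
      (hr.redInner y)) := by
  intro y
  obtain ⟨m, rfl⟩ := hr.surjective_proj y
  refine contMDiffAt_hom_section (V := fun y : N => TangentSpace (𝓡 q) y →L[ℝ] ℝ) fun v => ?_
  refine contMDiffAt_hom_section (V := fun _ : N => ℝ) fun w => ?_
  rw [contMDiffAt_section]
  exact hr.redInner_smooth m (smoothField_extend_eventually v) (smoothField_extend_eventually w)

end Extension

end IsReduction
end Reduction

/-! ### Covariant derivatives along a submanifold -/

section Connection

variable {n p : ℕ} {M P : Type*}
  [TopologicalSpace M] [ChartedSpace (Eu n) M] [IsManifold (𝓡 n) ∞ M]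
  [TopologicalSpace P] [ChartedSpace (Eu p) P]

/-- For a metric connection, the derivative along a submanifold depends only on the restriction
to the submanifold. -/
theorem IsHKTConnection.congr_along {𝓘c : HypercomplexStructure n M} {g : Metric n M}
    {D : Connection n M} (hD : IsHKTConnection 𝓘c g D) {i : P → M} {m : P}
    (hi : MDifferentiableAt (𝓡 p) (𝓡 n) i m) {W W' : (x : M) → TangentSpace (𝓡 n) x}
    (hW : DiffField W (i m)) (hW' : DiffField W' (i m))
    (h : ∀ᶠ m' in 𝓝 m, W (i m') = W' (i m')) (τ : TangentSpace (𝓡 p) m) :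
    D W (i m) (mfderiv (𝓡 p) (𝓡 n) i m τ) = D W' (i m) (mfderiv (𝓡 p) (𝓡 n) i m τ) := by
  set t := mfderiv (𝓡 p) (𝓡 n) i m τ
  by_contra hne
  -- By metricity the product of `∇_t W` with a fixed field is determined by derivatives along P and
  -- by values at the point, hence is the same for `W'`. Choosing the field to extend `z` itself
  -- gives `g(z, z) = 0`.
  set z := D W (i m) t - D W' (i m) t with hz
  have hz0 : z ≠ 0 := sub_ne_zero.2 hne
  let Y : (x : M) → TangentSpace (𝓡 n) x := FiberBundle.extend (Eu n) z
  have hY : DiffField Y (i m) := diffField_extend z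
  have hYm : Y (i m) = z := by simp [Y]
  have e1 := hD.metric W Y (i m) t hW hY
  have e2 := hD.metric W' Y (i m) t hW' hY
  have e3 : mvfderiv (𝓡 n) (fun x => g.inner x (W x) (Y x)) (i m) t
      = mvfderiv (𝓡 n) (fun x => g.inner x (W' x) (Y x)) (i m) t := by
    rw [← mvfderiv_comp_mfderiv (mdifferentiableAt_inner g hW hY) hi,
      ← mvfderiv_comp_mfderiv (mdifferentiableAt_inner g hW' hY) hi]
    have : (fun x => g.inner x (W x) (Y x)) ∘ i =ᶠ[𝓝 m] (fun x => g.inner x (W' x) (Y x)) ∘ i := by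
      filter_upwards [h] with m' hm'
      simp only [Function.comp_apply, hm']
    exact DFunLike.congr_fun this.mfderiv_eq τ
  have e4 := e1.symm.trans (Eq.trans e3 e2)
  rw [h.self_of_nhds, hYm] at e4
  have e5 : g.inner (i m) z z = 0 := by
    conv_lhs => enter [1]; rw [hz, map_sub]
    exact sub_eq_zero.2 (add_right_cancel e4)
  exact (g.pos (i m) z hz0).ne' e5

end Connection

/-! ### The induced metric, hypercomplex structure and connection -/

namespace IsReduction

variable {n p q : ℕ} {M P N : Type*}
  [TopologicalSpace M] [ChartedSpace (Eu n) M] [IsManifold (𝓡 n) ∞ M]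
  [TopologicalSpace P] [ChartedSpace (Eu p) P] [IsManifold (𝓡 p) ∞ P]
  [TopologicalSpace N] [ChartedSpace (Eu q) N] [IsManifold (𝓡 q) ∞ N]

variable {i : P → M} {pr : P → N} {U : (x : M) → Submodule ℝ (TangentSpace (𝓡 n) x)}
  {𝓘c : HypercomplexStructure n M} {g : Metric n M}
  (hr : IsReduction (p := p) (q := q) i pr U 𝓘c g)

theorem isVonNBounded_redInner (y : N) :
    Bornology.IsVonNBounded ℝ {v : TangentSpace (𝓡 q) y | hr.redInner y v v < 1} := by
  obtain ⟨m, rfl⟩ := hr.surjective_proj y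
  have h1 := (g.isVonNBounded (i m)).image (hr.Λ m)
  refine Bornology.IsVonNBounded.subset (s₁ := {v : TangentSpace (𝓡 q) (pr m) |
    hr.redInner (pr m) v v < 1}) (fun v hv => ?_) h1
  exact ⟨hr.L m v, (hr.redInner_eq m v v).symm.trans_lt hv, hr.Λ_L m v⟩

/-- The metric induced on the quotient. -/
def redMetric : Metric q N where
  inner := hr.redInner
  symm y v w := by
    obtain ⟨m, rfl⟩ := hr.surjective_proj y
    rw [hr.redInner_eq, hr.redInner_eq]
    exact g.symm _ _ _
  pos y v hv := by
    obtain ⟨m, rfl⟩ := hr.surjective_proj y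
    rw [hr.redInner_eq]
    exact g.pos _ _ fun h => hv (hr.L_injective m (h.trans (map_zero _).symm))
  isVonNBounded := hr.isVonNBounded_redInner
  contMDiff := hr.redInner_contMDiff

theorem redMetric_inner (m : P) (v w : TangentSpace (𝓡 q) (pr m)) :
    hr.redMetric.inner (pr m) v w = g.inner (i m) (hr.L m v) (hr.L m w) :=
  hr.redInner_eq m v w

theorem totalSpace_mk_congr {y y' : N} (h : y = y') {v : TangentSpace (𝓡 q) y}
    {v' : TangentSpace (𝓡 q) y'} (hv : (v : Eu q) = v') :
    (⟨y, v⟩ : TangentBundle (𝓡 q) N) = ⟨y', v'⟩ := by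
  subst h
  exact congrArg _ hv

theorem mfderiv_R (m : P) : ∀ᶠ m' in 𝓝 m, ∀ t (v : TangentSpace (𝓡 q) (pr m')),
    IsLift (p := p) i pr U m' t v → (mfderiv (𝓡 n) (𝓡 q) (hr.R m) (i m') t : Eu q) = v := by
  filter_upwards [(hr.R_incl m).eventually_nhds,
    hr.smooth_incl.continuous.continuousAt.eventually (hr.R_smooth m)] with m' h1 h2 t v
  rintro ⟨-, τ, rfl, rfl⟩
  exact mfderiv_retraction (hr.smooth_incl.mdifferentiable (by decide) m')
    (h2.mdifferentiableAt (by decide)) h1 τ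

/-- Near `pr m` the induced endomorphism applied to a field is `dR (I_a (ext V))` evaluated along
the smooth section `i ∘ σ`. -/
theorem redI_contMDiff (a : Fin 3) :
    ContMDiff (𝓡 q) ((𝓡 q).prod 𝓘(ℝ, Eu q →L[ℝ] Eu q)) ∞
    (fun x => TotalSpace.mk' (Eu q →L[ℝ] Eu q)
      (E := fun x : N => TangentSpace (𝓡 q) x →L[ℝ] TangentSpace (𝓡 q) x) x (hr.redI a x)) := by
  intro y
  obtain ⟨m, rfl⟩ := hr.surjective_proj y
  refine contMDiffAt_hom_section (V := fun y : N => TangentSpace (𝓡 q) y) fun v => ?_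
  set V : (y : N) → TangentSpace (𝓡 q) y := FiberBundle.extend (Eu q) v
  have hV := hr.smoothField_ext m (smoothField_extend_eventually v)
  have h1 := contMDiffAt_mfderiv_section (hr.R_smooth m).self_of_nhds
    (𝓘c.smoothField a hV.self_of_nhds)
  have h2 : ContMDiffAt (𝓡 q) (𝓡 q).tangent ∞ (fun y => (⟨hr.R m (i (hr.σ m y)),
      mfderiv (𝓡 n) (𝓡 q) (hr.R m) (i (hr.σ m y))
        (𝓘c.I a (i (hr.σ m y)) (hr.ext m V (i (hr.σ m y))))⟩ : TangentBundle (𝓡 q) N)) (pr m) := by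
    refine ContMDiffAt.comp (I' := 𝓡 n) (f := fun y => i (hr.σ m y)) (pr m)
      (g := fun x => (⟨hr.R m x, mfderiv (𝓡 n) (𝓡 q) (hr.R m) x
        (𝓘c.I a x (hr.ext m V x))⟩ : TangentBundle (𝓡 q) N)) ?_ (hr.incl_σ_smooth m)
    rwa [hr.σ_proj]
  refine h2.congr_of_eventuallyEq ?_
  filter_upwards [(hr.tendsto_σ m).eventually (hr.ext_eq m), hr.proj_σ m,
    (hr.tendsto_σ m).eventually (hr.R_incl m), (hr.tendsto_σ m).eventually (hr.mfderiv_R m)]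
    with y h3 h4 h5 h6
  refine totalSpace_mk_congr (h5.trans h4).symm ?_
  have h7 := h6 (𝓘c.I a (i (hr.σ m y)) (hr.ext m V (i (hr.σ m y))))
    (hr.redI a (pr (hr.σ m y)) (V (pr (hr.σ m y))))
    ((hr.isLift_iff _ _ _).2 (by rw [hr.L_redI, h3]))
  refine Eq.trans ?_ h7.symm
  rw [h4]

/-- Each `I_a` is skew for g and preserves U, so it preserves the orthogonal complement too and
commutes with the projection. -/
theorem Λ_I (hh : IsHyperHermitian 𝓘c g) (m : P) (a : Fin 3) (t : TangentSpace (𝓡 n) (i m)) :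
    hr.Λ m (𝓘c.I a (i m) t) = hr.redI a (pr m) (hr.Λ m t) := by
  refine hr.Λ_eq m fun u => ?_
  have hskew : ∀ s s' : TangentSpace (𝓡 n) (i m),
      g.inner (i m) (𝓘c.I a (i m) s) s' = - g.inner (i m) s (𝓘c.I a (i m) s') := by
    intro s s'
    have := hh a (i m) s (𝓘c.I a (i m) s')
    rw [𝓘c.sq, map_neg] at this
    linarith
  rw [hr.L_redI, hskew, hskew, ← hr.L_redI, hr.inner_L_Λ]

section Cov

variable (D : Connection n M)

/-- The connection induced at the point `pr m` of the quotient. -/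
def cov (m : P) (w : (y : N) → TangentSpace (𝓡 q) y) (y : N) :
    TangentSpace (𝓡 q) y →L[ℝ] TangentSpace (𝓡 q) y :=
  -- All tangent spaces of N are the same model space, so the expression has a formal value at every
  -- `y`; only `y = pr m` is meaningful.
  ((hr.Λ m).comp ((D (hr.ext m w) (i m)).comp (hr.L m)) :
    TangentSpace (𝓡 q) (pr m) →L[ℝ] TangentSpace (𝓡 q) (pr m))

variable {D}

/-- Lifted vectors are tangent to P, so the derivative sees only the restriction of the extension to
P. This freedom lets sums, products and complex structures be handled by convenient extensions. -/
theorem cov_eq (hD : IsHKTConnection 𝓘c g D) (m : P) {w : (y : N) → TangentSpace (𝓡 q) y} {W : (x : M) → TangentSpace (𝓡 n) x}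
    (hw : DiffField w (pr m)) (hW : DiffField W (i m))
    (h : ∀ᶠ m' in 𝓝 m, W (i m') = hr.L m' (w (pr m'))) (v : TangentSpace (𝓡 q) (pr m)) :
    hr.cov D m w (pr m) v = hr.Λ m (D W (i m) (hr.L m v)) := by
  obtain ⟨-, τ, hτ, -⟩ := hr.isLift_L m v
  have h1 : D (hr.ext m w) (i m) (hr.L m v) = D W (i m) (hr.L m v) := by
    rw [← hτ]
    refine hD.congr_along (hr.smooth_incl.mdifferentiable (by decide) m) (hr.diffField_ext m hw)
      hW ?_ τ
    filter_upwards [h, hr.ext_eq m] with m' h2 h3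
    rw [h2, h3]
  exact congrArg (hr.Λ m) h1

theorem diffField_redI (a : Fin 3) {y : N} {V : (y : N) → TangentSpace (𝓡 q) y}
    (hV : DiffField V y) : DiffField (fun x => hr.redI a x (V x)) y :=
  diffField_endField (hr.redI_contMDiff a y) hV

/-- Each condition holds on M for the extended lifts and is projected by Λ. For the torsion, the
bracket of the lifts is tangent to P and Λ sends it to the bracket on N. The torsion 3-form on N is
the pullback of c by the lift, so it stays skew. -/
theorem isHKTAt_cov (hD : IsHKTConnection 𝓘c g D) (m : P) : IsHKTAt hr.redI hr.redMetric (hr.cov D m) (pr m)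
    (fun v w => hr.Λ m (D.torsion (i m) (hr.L m v) (hr.L m w))) where
  isCov := {
    add := by
      intro w w' y hw hw' hy
      obtain rfl : y = pr m := hy
      ext1 v
      have hd := hr.diffField_ext m hw
      have hd' := hr.diffField_ext m hw'
      rw [hr.cov_eq hD m (W := hr.ext m w + hr.ext m w') (mdifferentiableAt_add_section hw hw')
        (mdifferentiableAt_add_section hd hd') ?_ v, D.isCovariantDerivativeOnUniv.add hd hd']
      · rw [add_apply, map_add]
        rfl
      · filter_upwards [hr.ext_eq m] with m' h
        rw [Pi.add_apply, Pi.add_apply, map_add, h, h]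
    leibniz := by
      intro w f y hw hf hy
      obtain rfl : y = pr m := hy
      ext1 v
      obtain ⟨-, τ, hτ, hτ'⟩ := hr.isLift_L m v
      have hi := hr.smooth_incl.mdifferentiable (by decide) m
      have hpr := hr.smooth_proj.mdifferentiable (by decide) m
      have hd := hr.diffField_ext m hw
      have hRm := (hr.R_incl m).self_of_nhds
      -- `f ∘ R` extends `f ∘ pr` to M, so multiplying the extended lift by it gives an extension of
      -- the lift of `f w`.
      have hF : MDifferentiableAt (𝓡 n) 𝓘(ℝ, ℝ) (fun x => f (hr.R m x)) (i m) := by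
        refine MDifferentiableAt.comp (I' := 𝓡 q) (i m) ?_
          ((hr.R_smooth m).self_of_nhds.mdifferentiableAt (by decide))
        rwa [hRm]
      have e1 : mvfderiv (𝓡 n) (fun x => f (hr.R m x)) (i m) (hr.L m v)
          = mvfderiv (𝓡 q) f (pr m) v := by
        rw [← hτ, ← hτ', ← mvfderiv_comp_mfderiv hF hi, ← mvfderiv_comp_mfderiv hf hpr]
        have : (fun x => f (hr.R m x)) ∘ i =ᶠ[𝓝 m] f ∘ pr := by
          filter_upwards [hr.R_incl m] with m' h
          exact congrArg f h
        exact DFunLike.congr_fun this.mfderiv_eq τ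
      rw [hr.cov_eq hD m (W := (fun x => f (hr.R m x)) • hr.ext m w)
        (MDifferentiableAt.smul_section hf hw) (MDifferentiableAt.smul_section hF hd) ?_ v,
        D.isCovariantDerivativeOnUniv.leibniz hd hF]
      · simp only [add_apply, smul_apply, map_add, map_smul,
          ContinuousLinearMap.smulRight_apply]
        rw [e1, hRm, (hr.ext_eq m).self_of_nhds, hr.Λ_L]
        rfl
      · filter_upwards [hr.ext_eq m, hr.R_incl m] with m' h h'
        rw [Pi.smul_apply', Pi.smul_apply', map_smul, h, h'] }
  metric := by
    intro Y Z v hY hZ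
    obtain ⟨-, τ, hτ, hτ'⟩ := hr.isLift_L m v
    have hi := hr.smooth_incl.mdifferentiable (by decide) m
    have hpr := hr.smooth_proj.mdifferentiable (by decide) m
    have hY' := hr.diffField_ext m hY
    have hZ' := hr.diffField_ext m hZ
    have e1 := hD.metric _ _ (i m) (hr.L m v) hY' hZ'
    have e2 : mvfderiv (𝓡 q) (fun x => hr.redMetric.inner x (Y x) (Z x)) (pr m) v
      = mvfderiv (𝓡 n) (fun x => g.inner x (hr.ext m Y x) (hr.ext m Z x)) (i m) (hr.L m v) := by
      rw [← hτ, ← hτ', ← mvfderiv_comp_mfderiv (mdifferentiableAt_inner _ hY hZ) hpr,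
        ← mvfderiv_comp_mfderiv (mdifferentiableAt_inner _ hY' hZ') hi]
      have : (fun x => hr.redMetric.inner x (Y x) (Z x)) ∘ pr =ᶠ[𝓝 m]
          (fun x => g.inner x (hr.ext m Y x) (hr.ext m Z x)) ∘ i := by
        filter_upwards [hr.ext_eq m] with m' h
        simp only [Function.comp_apply]
        rw [h, h, hr.redMetric_inner]
      exact DFunLike.congr_fun this.mfderiv_eq τ
    rw [e2]
    refine Eq.trans e1 ?_
    rw [(hr.ext_eq m).self_of_nhds, (hr.ext_eq m).self_of_nhds, hr.redMetric_inner,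
      hr.redMetric_inner]
    have e3 := hr.inner_L_Λ m (D (hr.ext m Y) (i m) (hr.L m v)) (Z (pr m))
    have e4 := hr.inner_L_Λ m (D (hr.ext m Z) (i m) (hr.L m v)) (Y (pr m))
    rw [g.symm (i m) (hr.L m (Y (pr m))), g.symm (i m) (hr.L m (Y (pr m))), ← e3, ← e4]
    rfl
  complex := by
    intro a Y v hY
    have hY' := hr.diffField_ext m hY
    rw [hr.cov_eq hD m (W := fun x => 𝓘c.I a x (hr.ext m Y x)) (hr.diffField_redI a hY)
      (𝓘c.diffField a hY') ?_ v, hD.complex a _ _ _ hY', hr.Λ_I hD.hyperHermitian]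
    · rfl
    · filter_upwards [hr.ext_eq m] with m' h
      rw [h, hr.L_redI]
  torsion := by
    intro V W hV hW
    have hV' := hr.diffField_ext m hV
    have hW' := hr.diffField_ext m hW
    obtain ⟨τ, h1, h2⟩ := hr.exists_bracket m hV hW
    have h3 := D.torsion_apply hV' hW'
    have h4 := (hr.ext_eq m).self_of_nhds
    rw [← h1, h4, h4] at h3
    rw [h3, map_sub, map_sub, hr.Λ_tangent, h2]
    rfl
  skew := by
    intro u v w
    obtain ⟨h1, h2⟩ := hD.torsion_skew (i m) (hr.L m u) (hr.L m v) (hr.L m w)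
    have key : ∀ (u : TangentSpace (𝓡 q) (pr m)) (t : TangentSpace (𝓡 n) (i m)),
        hr.redMetric.inner (pr m) u (hr.Λ m t) = g.inner (i m) (hr.L m u) t := by
      intro u t
      rw [hr.redMetric_inner, g.symm, hr.inner_L_Λ, g.symm]
    rw [key, key, key]
    exact ⟨h1, h2⟩

theorem IsHKTAt.congr_cov {J : Fin 3 → EndField q N} {h : Metric q N}
    {cov cov' : ((x : N) → TangentSpace (𝓡 q) x) →
      ((x : N) → TangentSpace (𝓡 q) x →L[ℝ] TangentSpace (𝓡 q) x)} {y : N}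
    {T : TangentSpace (𝓡 q) y → TangentSpace (𝓡 q) y → TangentSpace (𝓡 q) y}
    (hc : IsHKTAt J h cov y T) (he : ∀ w, cov' w y = cov w y) : IsHKTAt J h cov' y T where
  isCov := {
    add := by
      intro w w' x hw hw' hx
      obtain rfl : x = y := hx
      rw [he, he, he]
      exact hc.isCov.add hw hw'
    leibniz := by
      intro w w' x hw hw' hx
      obtain rfl : x = y := hx
      rw [he, he]
      exact hc.isCov.leibniz hw hw' }
  metric := fun Y Z v hY hZ => by rw [he, he]; exact hc.metric Y Z v hY hZ
  complex := fun a Y v hY => by rw [he, he]; exact hc.complex a Y v hY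
  torsion := fun V W hV hW => by rw [he, he]; exact hc.torsion V W hV hW
  skew := hc.skew

variable (D) in
/-- The covariant derivative induced on the quotient. -/
def redCov (w : (y : N) → TangentSpace (𝓡 q) y) (y : N) :
    TangentSpace (𝓡 q) y →L[ℝ] TangentSpace (𝓡 q) y :=
  hr.cov D (hr.point y) w y

theorem redI_sq (a : Fin 3) (y : N) (v : TangentSpace (𝓡 q) y) :
    hr.redI a y (hr.redI a y v) = -v := by
  obtain ⟨m, rfl⟩ := hr.surjective_proj y
  apply hr.L_injective m
  rw [hr.L_redI, hr.L_redI, 𝓘c.sq, map_neg]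

theorem redI_inner (hh : IsHyperHermitian 𝓘c g) (a : Fin 3) (y : N) (v w : TangentSpace (𝓡 q) y) :
    hr.redMetric.inner y (hr.redI a y v) (hr.redI a y w) = hr.redMetric.inner y v w := by
  obtain ⟨m, rfl⟩ := hr.surjective_proj y
  rw [hr.redMetric_inner, hr.redMetric_inner, hr.L_redI, hr.L_redI, hh]

theorem isHKTAt_cov_point (hD : IsHKTConnection 𝓘c g D) (y : N) :
    ∃ T, IsHKTAt hr.redI hr.redMetric (hr.cov D (hr.point y)) y T ∧
      ∀ a, NijenhuisCondition (hr.redI a y) T := by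
  -- The base point is made a variable so that the equation `pr m = y` can be substituted in the
  -- dependent types.
  have key : ∀ m y, pr m = y → ∃ T, IsHKTAt hr.redI hr.redMetric (hr.cov D m) y T ∧
      ∀ a, NijenhuisCondition (hr.redI a y) T := by
    rintro m y rfl
    refine ⟨_, hr.isHKTAt_cov hD m, fun a v w => ?_⟩
    have h := congrArg (hr.Λ m) (hD.nijenhuisCondition a (i m) (hr.L m v) (hr.L m w))
    simp only [map_sub, map_zero, hr.Λ_I hD.hyperHermitian] at h
    simp only [hr.L_redI]
    exact h
  exact key _ _ (hr.proj_point y)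

/-- The chosen point of the fibre and `m` both give HKT data at `pr m` for the same complex
structures and metric. Pointwise uniqueness identifies the two, with no appeal to equivariance of
the connection. -/
theorem redCov_eq (hD : IsHKTConnection 𝓘c g D) (m : P) {w : (y : N) → TangentSpace (𝓡 q) y}
    (hw : DiffField w (pr m)) : hr.redCov D w (pr m) = hr.cov D m w (pr m) := by
  obtain ⟨T, hT, -⟩ := hr.isHKTAt_cov_point hD (pr m)
  exact hT.unique (hr.isHKTAt_cov hD m) (hr.redI_sq 0 _) (hr.redI_inner hD.hyperHermitian 0 _)
    (fun V hV => hr.diffField_redI 0 hV) hw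

theorem exists_isHKTAt_redCov (hD : IsHKTConnection 𝓘c g D) (y : N) :
    ∃ T, IsHKTAt hr.redI hr.redMetric (hr.redCov D) y T ∧
      ∀ a, NijenhuisCondition (hr.redI a y) T := by
  obtain ⟨T, hT, h⟩ := hr.isHKTAt_cov_point hD y
  exact ⟨T, IsHKTAt.congr_cov hT fun _ => rfl, h⟩

/-- The hypercomplex structure induced on the quotient. -/
def redHypercomplex (hD : IsHKTConnection 𝓘c g D) : HypercomplexStructure q N where
  I := hr.redI
  smooth := hr.redI_contMDiff
  sq := hr.redI_sq
  mul_eq y v := by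
    obtain ⟨m, rfl⟩ := hr.surjective_proj y
    apply hr.L_injective m
    rw [hr.L_redI, hr.L_redI, hr.L_redI, 𝓘c.mul_eq]
  anticomm y v := by
    obtain ⟨m, rfl⟩ := hr.surjective_proj y
    apply hr.L_injective m
    rw [hr.L_redI, hr.L_redI, map_neg, hr.L_redI, 𝓘c.anticomm]
  integrable a X Y y hX hY := by
    obtain ⟨T, hT, h⟩ := hr.exists_isHKTAt_redCov hD y
    rw [hT.nijenhuis a (hr.redI_sq a y) (fun V hV => hr.diffField_redI a hV) hX hY, h a, neg_zero]

variable (D) in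
/-- The connection induced on the quotient. -/
def redConnection (hD : IsHKTConnection 𝓘c g D) : Connection q N where
  toFun := hr.redCov D
  isCovariantDerivativeOnUniv := {
    add := fun {_ _ y} hw hw' _ => by
      obtain ⟨T, hT, -⟩ := hr.exists_isHKTAt_redCov hD y
      exact hT.isCov.add hw hw'
    leibniz := fun {_ _ y} hw hw' _ => by
      obtain ⟨T, hT, -⟩ := hr.exists_isHKTAt_redCov hD y
      exact hT.isCov.leibniz hw hw' }

/-- Testing against a field Z with the induced metric suffices. As Λ is adjoint to the lift, the
product is that of `∇_{LV} W` with `LZ` on M, restricted along a section; smoothness of Λ is not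
needed. -/
theorem redConnection_smooth [T2Space M] (hD : IsHKTConnection 𝓘c g D) :
    CovariantDerivative.ContMDiffCovariantDerivative (hr.redConnection D hD) ∞ where
  contMDiff := {
    contMDiff := by
      intro w hw y _
      obtain ⟨m, rfl⟩ := hr.surjective_proj y
      refine ContMDiffAt.contMDiffWithinAt ?_
      refine contMDiffAt_hom_section (V := fun y : N => TangentSpace (𝓡 q) y) fun v => ?_
      set V : (y : N) → TangentSpace (𝓡 q) y := FiberBundle.extend (Eu q) v
      refine smoothField_of_inner hr.redMetric fun z => ?_
      set Z : (y : N) → TangentSpace (𝓡 q) y := FiberBundle.extend (Eu q) z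
      have hws : ∀ y, SmoothField w y := fun y => hw.contMDiffAt univ_mem
      have hV := hr.smoothField_ext m (smoothField_extend_eventually v)
      have hZ := hr.smoothField_ext m (smoothField_extend_eventually z)
      have hW := hr.smoothField_ext m (Filter.Eventually.of_forall hws)
      have h1 := contMDiffAt_covariantDerivative_apply hD.smooth hW hV.self_of_nhds
      have h2 := hr.contMDiffAt_comp_σ m (contMDiffAt_inner g h1 hZ.self_of_nhds)
      refine h2.congr_of_eventuallyEq ?_
      filter_upwards [(hr.tendsto_σ m).eventually (hr.ext_eq m).eventually_nhds, hr.proj_σ m,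
        (hr.tendsto_σ m).eventually (hr.smooth_incl.continuous.continuousAt.eventually hW)]
        with y h3 h4 h5
      have h6 := h3.self_of_nhds
      -- At a nearby `y` the derivative is computed at the moving point `σ y`, where the extension
      -- built at `m` still extends the lift.
      have h7 := hr.redCov_eq hD (hr.σ m y) (w := w) ((hws _).mdifferentiableAt (by decide))
      have h8 := hr.cov_eq hD (hr.σ m y) (w := w) (W := hr.ext m w)
        ((hws _).mdifferentiableAt (by decide)) (h5.mdifferentiableAt (by decide))
        (h3.mono fun m' h => h w) (V (pr (hr.σ m y)))
      rw [← h7, ← h6] at h8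
      have h9 := hr.redMetric_inner (hr.σ m y)
        (hr.redCov D w (pr (hr.σ m y)) (V (pr (hr.σ m y)))) (Z (pr (hr.σ m y)))
      rw [h8, hr.inner_L_Λ, ← h8, ← h6] at h9
      rw [← h9, h4]
      rfl }

theorem isHKTConnection [T2Space M] (hD : IsHKTConnection 𝓘c g D) :
    IsHKTConnection (hr.redHypercomplex hD) hr.redMetric (hr.redConnection D hD) where
  hyperHermitian := hr.redI_inner hD.hyperHermitian
  smooth := hr.redConnection_smooth hD
  metric Y Z y v hY hZ := by
    obtain ⟨T, hT, -⟩ := hr.exists_isHKTAt_redCov hD y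
    exact hT.metric Y Z v hY hZ
  complex a Y y v hY := by
    obtain ⟨T, hT, -⟩ := hr.exists_isHKTAt_redCov hD y
    exact hT.complex a Y v hY
  torsion_skew y u v w := by
    obtain ⟨T, hT, -⟩ := hr.exists_isHKTAt_redCov hD y
    have key : ∀ v w, (hr.redConnection D hD).torsion y v w = T v w := by
      intro v w
      have h1 := hT.torsion _ _ (diffField_extend v) (diffField_extend w)
      have h2 := (hr.redConnection D hD).torsion_apply (diffField_extend v) (diffField_extend w)
      have h3 := h2.trans h1
      simpa using h3
    rw [key, key, key]
    exact hT.skew u v w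

theorem isInduced [T2Space M] (hD : IsHKTConnection 𝓘c g D) :
    IsInduced (p := p) i pr U 𝓘c g D (hr.redHypercomplex hD) hr.redMetric
      (hr.redConnection D hD) where
  lift m v := ⟨hr.L m v, hr.isLift_L m v, fun t ht => (hr.isLift_iff m t v).1 ht⟩
  hypercomplex m v t ht a := by
    rw [hr.isLift_iff] at ht ⊢
    rw [ht]
    exact (hr.L_redI m a v).symm
  metric m v w t s ht hs := by
    rw [hr.isLift_iff] at ht hs
    rw [ht, hs, hr.redMetric_inner]
  connection m w W v t s hw hW h ht hs := by
    rw [hr.isLift_iff] at ht hs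
    have hwd : DiffField w (pr m) := hw.mdifferentiableAt (by decide)
    have h1 := hr.cov_eq hD m hwd (hW.mdifferentiableAt (by decide))
      (h.mono fun m' h' => (hr.isLift_iff _ _ _).1 h') v
    rw [← hr.redCov_eq hD m hwd] at h1
    have h2 : s = hr.L m (hr.Λ m (D W (i m) (hr.L m v))) := hs.trans (congrArg _ h1)
    refine ⟨h2 ▸ hr.L_mem m _, fun u hu => ?_⟩
    obtain ⟨u', rfl⟩ := hr.exists_isLift m hu
    have h3 := hr.inner_L_Λ m (D W (i m) (hr.L m v)) u'
    conv_lhs => enter [1]; rw [map_sub]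
    rw [h2, ht]
    exact sub_eq_zero.2 h3.symm

end Cov

end IsReduction

/-! ### Submanifolds with retractions and quotients with sections -/

section LinearAlgebra

theorem ker_le_range_of_finrank {E F K : Type*} [NormedAddCommGroup E] [NormedSpace ℝ E]
    [FiniteDimensional ℝ E] [NormedAddCommGroup F] [NormedSpace ℝ F] [FiniteDimensional ℝ F]
    [NormedAddCommGroup K] [NormedSpace ℝ K] [FiniteDimensional ℝ K]
    (A : E →L[ℝ] F) (B : F →L[ℝ] K) (hA : Function.Injective A) (hB : Function.Surjective B)
    (h0 : ∀ v, B (A v) = 0)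
    (h : Module.finrank ℝ E + Module.finrank ℝ K = Module.finrank ℝ F) (t : F) (ht : B t = 0) :
    ∃ v, A v = t := by
  have h1 : LinearMap.range (A : E →ₗ[ℝ] F) = LinearMap.ker (B : F →ₗ[ℝ] K) := by
    apply Submodule.eq_of_le_of_finrank_eq
    · rintro _ ⟨v, rfl⟩
      exact h0 v
    · have h2 := LinearMap.finrank_range_add_finrank_ker (B : F →ₗ[ℝ] K)
      rw [LinearMap.range_eq_top.2 hB, finrank_top] at h2
      rw [LinearMap.finrank_range_of_inj hA]
      omega
  have h3 : t ∈ LinearMap.range (A : E →ₗ[ℝ] F) := h1 ▸ ht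
  exact h3

end LinearAlgebra

section QuotientManifold

variable {n p q : ℕ} {M P N : Type*}
  [TopologicalSpace M] [ChartedSpace (Eu n) M]
  [TopologicalSpace P] [ChartedSpace (Eu p) P]
  [TopologicalSpace N] [ChartedSpace (Eu q) N]

/-- `i` is the inclusion of a submanifold that is locally a smooth retract, and `pr` is a smooth
map with local sections. -/
structure IsQuotientManifold (i : P → M) (pr : P → N) : Prop where
  smooth_incl : ContMDiff (𝓡 p) (𝓡 n) ∞ i
  smooth_proj : ContMDiff (𝓡 p) (𝓡 q) ∞ pr
  exists_retraction : ∀ m, ∃ r : M → P, (∀ᶠ x in 𝓝 (i m), ContMDiffAt (𝓡 n) (𝓡 p) ∞ r x) ∧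
    ∀ᶠ m' in 𝓝 m, r (i m') = m'
  exists_section : ∀ m, ∃ σ : N → P, σ (pr m) = m ∧
    ∀ᶠ y in 𝓝 (pr m), ContMDiffAt (𝓡 q) (𝓡 p) ∞ σ y ∧ pr (σ y) = y

variable {i : P → M} {pr : P → N}

theorem IsQuotientManifold.exists_extension
    (hQ : IsQuotientManifold (p := p) (q := q) (n := n) i pr) (m : P) : ∃ R : M → N,
    (∀ᶠ x in 𝓝 (i m), ContMDiffAt (𝓡 n) (𝓡 q) ∞ R x) ∧ ∀ᶠ m' in 𝓝 m, R (i m') = pr m' := by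
  obtain ⟨r, hr, hr'⟩ := hQ.exists_retraction m
  refine ⟨pr ∘ r, hr.mono fun x hx => hQ.smooth_proj.contMDiffAt.comp x hx,
    hr'.mono fun m' h => congrArg pr h⟩

theorem IsQuotientManifold.mfderiv_incl_injective
    (hQ : IsQuotientManifold (p := p) (q := q) (n := n) i pr) (m : P) :
    Function.Injective (mfderiv (𝓡 p) (𝓡 n) i m) := by
  obtain ⟨r, hr, hr'⟩ := hQ.exists_retraction m
  rw [injective_iff_map_eq_zero]
  intro τ hτ
  have h1 := mfderiv_retraction (pr := id) (hQ.smooth_incl.mdifferentiable (by decide) m)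
    (hr.self_of_nhds.mdifferentiableAt (by decide)) hr' τ
  rw [hτ, mfderiv_id] at h1
  exact h1.symm.trans (map_zero _)

theorem IsQuotientManifold.mfderiv_proj_surjective
    (hQ : IsQuotientManifold (p := p) (q := q) (n := n) i pr) (m : P) (v : Eu q) :
    ∃ τ : TangentSpace (𝓡 p) m, (mfderiv (𝓡 p) (𝓡 q) pr m τ : Eu q) = v := by
  obtain ⟨σ, hσ, hσ'⟩ := hQ.exists_section m
  have hσs := hσ'.self_of_nhds.1.mdifferentiableAt (by decide)
  -- Generalizing the point allows `σ (pr m) = m` to be substituted although tangent spaces depend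
  -- on it.
  have key : ∀ m', σ (pr m) = m' →
      (mfderiv (𝓡 p) (𝓡 q) pr m' (mfderiv (𝓡 q) (𝓡 p) σ (pr m) v : Eu p) : Eu q) = v := by
    rintro _ rfl
    have h1 := mfderiv_retraction (pr := id) (i := σ) (R := pr) hσs
      (hQ.smooth_proj.mdifferentiable (by decide) _) (hσ'.mono fun y h => h.2) v
    rw [mfderiv_id] at h1
    exact h1
  exact ⟨_, key m hσ⟩

end QuotientManifold

/-! ### Linear algebra of the moment map -/

theorem HypercomplexStructure.I_I {n : ℕ} {M : Type*} [TopologicalSpace M]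
    [ChartedSpace (Eu n) M] [IsManifold (𝓡 n) ∞ M] (𝓘c : HypercomplexStructure n M) (a b : Fin 3) (m : M) (t : TangentSpace (𝓡 n) m) (hab : a ≠ b) :
    ∃ c, 𝓘c.I a m (𝓘c.I b m t) = 𝓘c.I c m t ∨ 𝓘c.I a m (𝓘c.I b m t) = - 𝓘c.I c m t := by
  have h02 : 𝓘c.I 0 m (𝓘c.I 2 m t) = - 𝓘c.I 1 m t := by rw [← 𝓘c.mul_eq, 𝓘c.sq]
  have h21 : 𝓘c.I 2 m (𝓘c.I 1 m t) = - 𝓘c.I 0 m t := by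
    rw [← 𝓘c.mul_eq, 𝓘c.sq, map_neg]
  have h12 : 𝓘c.I 1 m (𝓘c.I 2 m t) = 𝓘c.I 0 m t := by
    rw [← neg_neg (𝓘c.I 2 m t), ← 𝓘c.anticomm, map_neg, 𝓘c.sq, neg_neg]
  have h20 : 𝓘c.I 2 m (𝓘c.I 0 m t) = 𝓘c.I 1 m t := by
    rw [← neg_neg (𝓘c.I 2 m _), ← 𝓘c.anticomm, 𝓘c.sq, map_neg, neg_neg]
  have h01 := 𝓘c.mul_eq m t
  have h10 := 𝓘c.anticomm m t
  fin_cases a <;> fin_cases b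
  · exact absurd rfl hab
  · exact ⟨2, Or.inl h01⟩
  · exact ⟨1, Or.inr h02⟩
  · exact ⟨2, Or.inr h10⟩
  · exact absurd rfl hab
  · exact ⟨0, Or.inl h12⟩
  · exact ⟨1, Or.inl h20⟩
  · exact ⟨0, Or.inr h21⟩
  · exact absurd rfl hab

section MomentMap

variable {n d : ℕ} {M : Type*} [TopologicalSpace M]
    [ChartedSpace (Eu n) M] [IsManifold (𝓡 n) ∞ M]
    {G : Type*} [TopologicalSpace G]
    [ChartedSpace (Eu d) G] [Group G] [LieGroup (𝓡 d) ∞ G]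
    [MulAction G M] [ContMDiffSMul (𝓡 d) (𝓡 n) ∞ G M]

theorem contMDiff_orbit (m : M) : ContMDiff (𝓡 d) (𝓡 n) ∞ (fun γ : G => γ • m) :=
  (contMDiff_smul (I := 𝓡 d) (I' := 𝓡 n) (n := ∞) (G := G) (M := M)).comp
    (contMDiff_id.prodMk contMDiff_const)

theorem mfderiv_fundVec {E' H' N : Type*} [NormedAddCommGroup E'] [NormedSpace ℝ E']
    [TopologicalSpace H'] {J : ModelWithCorners ℝ E' H'} [TopologicalSpace N] [ChartedSpace H' N]
    {k : M → N} {m : M} (hk : MDifferentiableAt (𝓡 n) J k m) (X : Eu d) :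
    (mfderiv (𝓡 n) J k m (fundVec G X m) : E') = mfderiv (𝓡 d) J (fun γ : G => k (γ • m)) 1 X := by
  have key : ∀ x, (1 : G) • m = x → MDifferentiableAt (𝓡 n) J k x →
      (mfderiv (𝓡 n) J k x (mfderiv (𝓡 d) (𝓡 n) (fun γ : G => γ • m) 1 X : Eu n) : E')
        = mfderiv (𝓡 d) J (fun γ : G => k (γ • m)) 1 X := by
    rintro _ rfl hk
    exact (DFunLike.congr_fun (mfderiv_comp (1 : G) hk
      ((contMDiff_orbit (G := G) m).mdifferentiable (by decide) 1)) X).symm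
  exact key m (one_smul G m) hk

variable {𝓘c : HypercomplexStructure n M} {ν : Fin 3 → M → Eu d}

theorem IsMomentMap.dval_I (hν : IsMomentMap G 𝓘c ν)
    (a : Fin 3) (m : M) (t : TangentSpace (𝓡 n) m) :
    dval (ν a) m (𝓘c.I a m t) = - twisted 𝓘c ν 0 m t := by
  rw [hν.cauchyRiemann 0 a]
  simp [twisted]

theorem IsMomentMap.twisted_I (hν : IsMomentMap G 𝓘c ν)
    (a : Fin 3) (m : M) (t : TangentSpace (𝓡 n) m) :
    twisted 𝓘c ν 0 m (𝓘c.I a m t) = dval (ν a) m t := by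
  rw [hν.cauchyRiemann 0 a]
  simp [twisted, 𝓘c.sq]

/-- Since `dν_a = ω ∘ I_a`, the composite `dν_a ∘ I_b` is `ω ∘ I_a I_b = ± ω ∘ I_c = ± dν_c`. -/
theorem IsMomentMap.dval_I_of_ne (hν : IsMomentMap G 𝓘c ν)
    {a b : Fin 3} (hab : a ≠ b) {m : M} {t : TangentSpace (𝓡 n) m}
    (ht : ∀ c, dval (ν c) m t = 0) : dval (ν a) m (𝓘c.I b m t) = 0 := by
  obtain ⟨c, h | h⟩ := 𝓘c.I_I a b m t hab
  · rw [← hν.twisted_I, h, hν.twisted_I, ht]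
  · rw [← hν.twisted_I, h, map_neg, hν.twisted_I, ht, neg_zero]

theorem IsMomentMap.mem_distU (hν : IsMomentMap G 𝓘c ν)
    {m : M} {t : TangentSpace (𝓡 n) m} :
    t ∈ distU 𝓘c ν m ↔ (∀ a, dval (ν a) m t = 0) ∧ twisted 𝓘c ν 0 m t = 0 :=
  and_congr_right fun _ => ⟨fun h => h 0, fun h a => by rw [← hν.cauchyRiemann 0 a, h]⟩

theorem IsMomentMap.I_mem_distU (hν : IsMomentMap G 𝓘c ν)
    {m : M} (a : Fin 3) {t : TangentSpace (𝓡 n) m}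
    (ht : t ∈ distU 𝓘c ν m) : 𝓘c.I a m t ∈ distU 𝓘c ν m := by
  rw [hν.mem_distU] at ht ⊢
  refine ⟨fun b => ?_, by rw [hν.twisted_I, ht.1]⟩
  by_cases h : b = a
  · rw [h, hν.dval_I, ht.2, neg_zero]
  · exact hν.dval_I_of_ne h ht.1

theorem IsMomentMap.twisted_fundVec_surjective (hν : IsMomentMap G 𝓘c ν)
    (m : M) (Y : Eu d) :
    ∃ X : Eu d, twisted 𝓘c ν 0 m (fundVec G X m) = Y := by
  let A : Eu d →ₗ[ℝ] Eu d := ((twisted 𝓘c ν 0 m : Eu n →L[ℝ] Eu d).comp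
    (mfderiv (𝓡 d) (𝓡 n) (fun γ : G => γ • m) 1 : Eu d →L[ℝ] Eu n) : Eu d →L[ℝ] Eu d)
  have hA : Function.Injective A := by
    rw [← LinearMap.ker_eq_bot, LinearMap.ker_eq_bot']
    intro X hX
    by_contra hne
    exact hν.transversal 0 m X hne hX
  exact LinearMap.surjective_of_injective hA Y

variable {ζ : Fin 3 → Eu d}

theorem IsMomentMap.dval_fundVec (hν : IsMomentMap G 𝓘c ν)
    (hinv : ∀ (γ : G), ∀ m ∈ levelSet ν ζ, γ • m ∈ levelSet ν ζ)
    {m : M} (hm : m ∈ levelSet ν ζ) (a : Fin 3) (X : Eu d) :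
    dval (n := n) (ν a) m (fundVec G X m) = 0 := by
  have h1 := mfderiv_fundVec (G := G) (m := m) (k := ν a) ((hν.smooth a).mdifferentiable (by decide) m) X
  refine h1.trans ?_
  have h2 : (fun γ : G => ν a (γ • m)) = fun _ => ζ a := funext fun γ => hinv γ m hm a
  rw [h2, mfderiv_const]
  rfl

/-- On the level set, `(I₁dν₁, dν)` is onto. -/
theorem IsMomentMap.exists_vector (hν : IsMomentMap G 𝓘c ν)
    (hinv : ∀ (γ : G), ∀ m ∈ levelSet ν ζ, γ • m ∈ levelSet ν ζ)
    {m : M} (hm : m ∈ levelSet ν ζ) (b : Fin 3 → Eu d) :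
    ∃ t : TangentSpace (𝓡 n) m, twisted 𝓘c ν 0 m t = 0 ∧ ∀ a, dval (ν a) m t = b a := by
  choose X hX using fun a => hν.twisted_fundVec_surjective (G := G) m (- b a)
  have hV : ∀ a c, dval (ν c) m (fundVec G (X a) m) = 0 := fun a c =>
    hν.dval_fundVec hinv hm c (X a)
  -- With `ω(X_a) = -b_a`, the vector `I_a X_a` has `dν_a`-value `b_a`. Its other values are `±
  -- dν_c(X_a)`, which vanish because Killing fields are tangent to the level set.
  refine ⟨∑ a, 𝓘c.I a m (fundVec G (X a) m), ?_, fun a => ?_⟩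
  · rw [map_sum]
    exact Finset.sum_eq_zero fun a _ => by rw [hν.twisted_I, hV]
  · rw [map_sum, Finset.sum_eq_single a]
    · rw [hν.dval_I, hX, neg_neg]
    · intro c _ hc
      exact hν.dval_I_of_ne hc.symm (hV c)
    · simp

end MomentMap

/-! ### The moment map reduction satisfies the abstract conditions -/

section ConcreteReduction

variable {n d p q : ℕ} {M : Type*} [TopologicalSpace M]
    [ChartedSpace (Eu n) M] [IsManifold (𝓡 n) ∞ M]
    {G : Type*} [TopologicalSpace G]
    [ChartedSpace (Eu d) G] [Group G] [LieGroup (𝓡 d) ∞ G]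
    [MulAction G M] [ContMDiffSMul (𝓡 d) (𝓡 n) ∞ G M]
    {𝓘c : HypercomplexStructure n M} {g : Metric n M}
    {ν : Fin 3 → M → Eu d} {ζ : Fin 3 → Eu d}
    {hinv : ∀ (γ : G), ∀ m ∈ levelSet ν ζ, γ • m ∈ levelSet ν ζ}
    [ChartedSpace (Eu p) (LevelSpace G ν ζ hinv)]
    [IsManifold (𝓡 p) ∞ (LevelSpace G ν ζ hinv)]
    [ChartedSpace (Eu q) (ReducedSpace G ν ζ hinv)]
    [IsManifold (𝓡 q) ∞ (ReducedSpace G ν ζ hinv)]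

/-- The forms `I₁dν₁`, `dν` and the differential of `R : M → N` in the chart of `N` at `y₀`. -/
def reductionForm (𝓘c : HypercomplexStructure n M) (ν : Fin 3 → M → Eu d) {N : Type*}
    [TopologicalSpace N] [ChartedSpace (Eu q) N] (R : M → N) (y₀ : N) (x : M) :
    TangentSpace (𝓡 n) x →L[ℝ] (Eu d × (Fin 3 → Eu d) × Eu q) :=
  (twisted 𝓘c ν 0 x).prod ((ContinuousLinearMap.pi fun a => dval (ν a) x).prod
    (mvfderiv (𝓡 n) (extChartAt (𝓡 q) y₀ ∘ R) x))

theorem reductionForm_smooth (hν : IsMomentMap G 𝓘c ν) {N : Type*}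
    [TopologicalSpace N] [ChartedSpace (Eu q) N] [IsManifold (𝓡 q) ∞ N] {R : M → N} {y₀ : N} {x₀ : M}
    (hR : ContMDiffAt (𝓡 n) (𝓡 q) ∞ R x₀) (hy₀ : R x₀ ∈ (extChartAt (𝓡 q) y₀).source)
    {V : (x : M) → TangentSpace (𝓡 n) x} (hV : SmoothField V x₀) :
    ContMDiffAt (𝓡 n) 𝓘(ℝ, Eu d × (Fin 3 → Eu d) × Eu q) ∞
      (fun x => reductionForm (q := q) 𝓘c ν R y₀ x (V x)) x₀ := by
  have h1 : ContMDiffAt (𝓡 n) 𝓘(ℝ, Eu d) ∞ (fun x => twisted 𝓘c ν 0 x (V x)) x₀ := by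
    have := contMDiffAt_mfderiv_apply ((hν.smooth 0).contMDiffAt (x := x₀)) (𝓘c.smoothField 0 hV)
    exact this.neg
  have h2 : ContMDiffAt (𝓡 n) 𝓘(ℝ, Fin 3 → Eu d) ∞ (fun x a => dval (ν a) x (V x)) x₀ :=
    contMDiffAt_pi_space.2 fun a => contMDiffAt_mfderiv_apply (hν.smooth a).contMDiffAt hV
  have hc : ContMDiffAt (𝓡 n) 𝓘(ℝ, Eu q) ∞ (extChartAt (𝓡 q) y₀ ∘ R) x₀ :=
    (contMDiffAt_extChartAt' (by simpa using hy₀)).comp x₀ hR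
  exact h1.prodMk_space (h2.prodMk_space (contMDiffAt_mfderiv_apply hc hV))

theorem extChartAt_smooth_eventually {N : Type*}
    [TopologicalSpace N] [ChartedSpace (Eu q) N] [IsManifold (𝓡 q) ∞ N] (y₀ : N) :
    ∀ᶠ y in 𝓝 y₀, y ∈ (extChartAt (𝓡 q) y₀).source ∧
      ContMDiffAt (𝓡 q) 𝓘(ℝ, Eu q) ∞ (extChartAt (𝓡 q) y₀) y ∧
      (mfderiv (𝓡 q) 𝓘(ℝ, Eu q) (extChartAt (𝓡 q) y₀) y).IsInvertible := by
  have : IsManifold (𝓡 q) 1 N := IsManifold.of_le (n := ∞) (by decide)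
  filter_upwards [extChartAt_source_mem_nhds (I := 𝓡 q) y₀] with y hy
  exact ⟨hy, contMDiffAt_extChartAt' (by simpa using hy), isInvertible_mfderiv_extChartAt hy⟩

theorem proj_smul (γ : G) (m : LevelSpace G ν ζ hinv) :
    proj G ν ζ hinv (γ • m) = proj G ν ζ hinv m :=
  Quotient.sound (MulAction.orbitRel_apply.2 (MulAction.mem_orbit m γ))

theorem exists_smul_of_proj_eq {m m' : LevelSpace G ν ζ hinv}
    (h : proj G ν ζ hinv m = proj G ν ζ hinv m') : ∃ γ : G, γ • m = m' :=
  MulAction.orbitRel_apply.1 (Quotient.exact h.symm)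

theorem dval_incl (hν : IsMomentMap G 𝓘c ν)
    (hQ : IsQuotientManifold (p := p) (q := q) (n := n) (incl G ν ζ hinv) (proj G ν ζ hinv))
    (m : LevelSpace G ν ζ hinv) (a : Fin 3) (τ : TangentSpace (𝓡 p) m) :
    dval (n := n) (ν a) (incl G ν ζ hinv m) (mfderiv (𝓡 p) (𝓡 n) (incl G ν ζ hinv) m τ) = 0 := by
  have h1 := mvfderiv_comp_mfderiv (I := 𝓡 p) (k := ν a)
    ((hν.smooth a).mdifferentiable (by decide) _)
    (hQ.smooth_incl.mdifferentiable (by decide) m) τ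
  refine h1.symm.trans ?_
  have h2 : ν a ∘ incl G ν ζ hinv = fun _ => ζ a := funext fun m => m.2 a
  rw [h2]
  unfold mvfderiv
  rw [mfderiv_const]
  rfl

/-- The tangent space of P lies in `ker dν`; since `dν` is onto, both have dimension `n - 3d`. -/
theorem exists_tangent (hν : IsMomentMap G 𝓘c ν)
    (hQ : IsQuotientManifold (p := p) (q := q) (n := n) (incl G ν ζ hinv) (proj G ν ζ hinv))
    (hp : p + 3 * d = n) (m : LevelSpace G ν ζ hinv)
    {t : TangentSpace (𝓡 n) (incl G ν ζ hinv m)}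
    (ht : ∀ a, dval (n := n) (ν a) (incl G ν ζ hinv m) t = 0) :
    ∃ τ : TangentSpace (𝓡 p) m, mfderiv (𝓡 p) (𝓡 n) (incl G ν ζ hinv) m τ = t := by
  refine ker_le_range_of_finrank (E := Eu p) (F := Eu n) (K := Fin 3 → Eu d)
    (mfderiv (𝓡 p) (𝓡 n) (incl G ν ζ hinv) m)
    (ContinuousLinearMap.pi fun a => dval (n := n) (ν a) (incl G ν ζ hinv m))
    (hQ.mfderiv_incl_injective m) (fun b => ?_) (fun τ => ?_) ?_ t (funext ht)
  · obtain ⟨t, -, ht⟩ := hν.exists_vector hinv m.2 b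
    exact ⟨t, funext ht⟩
  · exact funext fun a => dval_incl hν hQ m a τ
  · simp [← hp, Module.finrank_pi_fintype]

/-- Near `m` the orbit stays where R agrees with the projection, which is constant on it. -/
theorem mfderiv_extension_fundVec {R : M → ReducedSpace G ν ζ hinv} {m : LevelSpace G ν ζ hinv}
    (hR : MDifferentiableAt (𝓡 n) (𝓡 q) R (incl G ν ζ hinv m))
    (hRm : ∀ᶠ m' in 𝓝 m, R (incl G ν ζ hinv m') = proj G ν ζ hinv m') (X : Eu d) :
    (mfderiv (𝓡 n) (𝓡 q) R (incl G ν ζ hinv m) (fundVec G X (incl G ν ζ hinv m)) : Eu q) = 0 := by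
  refine (mfderiv_fundVec (G := G) hR X).trans ?_
  have hc : Continuous fun γ : G => γ • m := by
    refine Continuous.subtype_mk ((contMDiff_orbit (G := G) (n := n) (d := d)
      (incl G ν ζ hinv m)).continuous) _
  have h1 : (fun γ : G => R (γ • incl G ν ζ hinv m)) =ᶠ[𝓝 1] fun _ => proj G ν ζ hinv m := by
    have h2 : ∀ᶠ m' in 𝓝 ((1 : G) • m), R (incl G ν ζ hinv m') = proj G ν ζ hinv m' := by
      rwa [one_smul]
    filter_upwards [hc.continuousAt.eventually h2] with γ hγ
    exact hγ.trans (proj_smul γ m)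
  have h3 := h1.mfderiv_eq (I := 𝓡 d) (I' := 𝓡 q)
  refine (DFunLike.congr_fun h3 X).trans ?_
  rw [mfderiv_const]
  rfl

/-- Source and target both have dimension `q + 4d`, so surjectivity suffices, and the form is block
triangular. First `t` fixes the `dν`-part, then `s` tangent to P corrects the `dR`-part, and a
Killing vector, invisible to both, corrects the ω-part. -/
theorem reductionForm_isInvertible (hν : IsMomentMap G 𝓘c ν)
    (hQ : IsQuotientManifold (p := p) (q := q) (n := n) (incl G ν ζ hinv) (proj G ν ζ hinv))
    (hp : p + 3 * d = n) (hq : q + d = p) {R : M → ReducedSpace G ν ζ hinv}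
    {m : LevelSpace G ν ζ hinv} {y₀ : ReducedSpace G ν ζ hinv}
    (hR : MDifferentiableAt (𝓡 n) (𝓡 q) R (incl G ν ζ hinv m))
    (hRm : ∀ᶠ m' in 𝓝 m, R (incl G ν ζ hinv m') = proj G ν ζ hinv m')
    (hc : MDifferentiableAt (𝓡 q) 𝓘(ℝ, Eu q) (extChartAt (𝓡 q) y₀) (R (incl G ν ζ hinv m)))
    (hci : (mfderiv (𝓡 q) 𝓘(ℝ, Eu q) (extChartAt (𝓡 q) y₀) (R (incl G ν ζ hinv m))).IsInvertible) :
    (reductionForm (q := q) 𝓘c ν R y₀ (incl G ν ζ hinv m)).IsInvertible := by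
  set x := incl G ν ζ hinv m with hx
  have hdim : Module.finrank ℝ (Eu n) = Module.finrank ℝ (Eu d × (Fin 3 → Eu d) × Eu q) := by
    simp [← hp, ← hq, Module.finrank_pi_fintype]
    ring
  have hsurj : Function.Surjective (reductionForm (q := q) 𝓘c ν R y₀ x) := by
    rintro ⟨a, b, c⟩
    obtain ⟨t, ht, htb⟩ := hν.exists_vector (m := x) hinv m.2 b
    obtain ⟨v, hv⟩ := hci.surjective (c - mvfderiv (𝓡 n) (extChartAt (𝓡 q) y₀ ∘ R) x t)
    obtain ⟨τ, hτ⟩ := hQ.mfderiv_proj_surjective m v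
    set s := mfderiv (𝓡 p) (𝓡 n) (incl G ν ζ hinv) m τ with hs
    obtain ⟨X, hX⟩ := hν.twisted_fundVec_surjective (G := G) x (a - twisted 𝓘c ν 0 x s)
    have hRs : (mfderiv (𝓡 n) (𝓡 q) R x s : Eu q) = v :=
      (mfderiv_retraction (hQ.smooth_incl.mdifferentiable (by decide) m) hR hRm τ).trans hτ
    have hcs : mvfderiv (𝓡 n) (extChartAt (𝓡 q) y₀ ∘ R) x s
        = c - mvfderiv (𝓡 n) (extChartAt (𝓡 q) y₀ ∘ R) x t :=
      (mvfderiv_comp_mfderiv hc hR s).trans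
        ((congrArg (mvfderiv (𝓡 q) (extChartAt (𝓡 q) y₀) (R x)) hRs).trans hv)
    have hcX : mvfderiv (𝓡 n) (extChartAt (𝓡 q) y₀ ∘ R) x (fundVec G X x) = 0 :=
      (mvfderiv_comp_mfderiv hc hR _).trans
        ((congrArg (mvfderiv (𝓡 q) (extChartAt (𝓡 q) y₀) (R x))
          (mfderiv_extension_fundVec hR hRm X)).trans (map_zero _))
    refine ⟨t + s + fundVec G X x, ?_⟩
    refine Prod.ext ?_ (Prod.ext (funext fun i => ?_) ?_)
    · change twisted 𝓘c ν 0 x _ = a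
      rw [map_add, map_add, ht, hX]
      abel
    · change dval (ν i) x _ = b i
      rw [map_add, map_add, htb, hν.dval_fundVec (m := x) hinv m.2, hs, dval_incl hν hQ, add_zero, add_zero]
    · change mvfderiv (𝓡 n) (extChartAt (𝓡 q) y₀ ∘ R) x _ = c
      rw [map_add, map_add, hcs, hcX]
      abel
  have hinj : Function.Injective (reductionForm (q := q) 𝓘c ν R y₀ x) :=
    (LinearMap.injective_iff_surjective_of_finrank_eq_finrank (V := Eu n)
      (f := (reductionForm (q := q) 𝓘c ν R y₀ x : Eu n →L[ℝ] _).toLinearMap) hdim).2 hsurj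
  exact isInvertible_of_injective (E := Eu n) _ hinj hdim

theorem isLift_iff_mfderiv (hν : IsMomentMap G 𝓘c ν)
    (hQ : IsQuotientManifold (p := p) (q := q) (n := n) (incl G ν ζ hinv) (proj G ν ζ hinv))
    (hp : p + 3 * d = n) {R : M → ReducedSpace G ν ζ hinv}
    {m : LevelSpace G ν ζ hinv}
    (hR : MDifferentiableAt (𝓡 n) (𝓡 q) R (incl G ν ζ hinv m))
    (hRm : ∀ᶠ m' in 𝓝 m, R (incl G ν ζ hinv m') = proj G ν ζ hinv m')
    (t : TangentSpace (𝓡 n) (incl G ν ζ hinv m)) (v : TangentSpace (𝓡 q) (proj G ν ζ hinv m)) :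
    IsLift (p := p) (incl G ν ζ hinv) (proj G ν ζ hinv) (distU 𝓘c ν) m t v ↔
      t ∈ distU 𝓘c ν (incl G ν ζ hinv m) ∧
        (mfderiv (𝓡 n) (𝓡 q) R (incl G ν ζ hinv m) t : Eu q) = v := by
  refine and_congr_right fun ht => ⟨?_, fun h => ?_⟩
  · rintro ⟨τ, rfl, rfl⟩
    exact mfderiv_retraction (hQ.smooth_incl.mdifferentiable (by decide) m) hR hRm τ
  · obtain ⟨τ, rfl⟩ := exists_tangent hν hQ hp m ht.1
    exact ⟨τ, rfl, (mfderiv_retraction (hQ.smooth_incl.mdifferentiable (by decide) m)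
      hR hRm τ).symm.trans h⟩

theorem reductionForm_eq_iff (hν : IsMomentMap G 𝓘c ν) {N : Type*}
    [TopologicalSpace N] [ChartedSpace (Eu q) N] {R : M → N} {y₀ : N} {x : M}
    (hR : MDifferentiableAt (𝓡 n) (𝓡 q) R x)
    (hc : MDifferentiableAt (𝓡 q) 𝓘(ℝ, Eu q) (extChartAt (𝓡 q) y₀) (R x))
    (hci : (mfderiv (𝓡 q) 𝓘(ℝ, Eu q) (extChartAt (𝓡 q) y₀) (R x)).IsInvertible)
    (t : TangentSpace (𝓡 n) x) (v : TangentSpace (𝓡 q) (R x)) :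
    reductionForm (q := q) 𝓘c ν R y₀ x t = (0, 0, mvfderiv (𝓡 q) (extChartAt (𝓡 q) y₀) (R x) v) ↔
      t ∈ distU 𝓘c ν x ∧ mfderiv (𝓡 n) (𝓡 q) R x t = v := by
  rw [hν.mem_distU]
  have h1 := mvfderiv_comp_mfderiv hc hR t
  constructor
  · intro h
    have e1 : twisted 𝓘c ν 0 x t = 0 := congrArg Prod.fst h
    have e2 : (fun a => dval (ν a) x t) = 0 := congrArg (fun z => z.2.1) h
    have e3 : mvfderiv (𝓡 n) (extChartAt (𝓡 q) y₀ ∘ R) x t = _ := congrArg (fun z => z.2.2) h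
    exact ⟨⟨fun a => congrFun e2 a, e1⟩, hci.injective (h1.symm.trans e3)⟩
  · rintro ⟨⟨e1, e2⟩, rfl⟩
    exact Prod.ext e2 (Prod.ext (funext e1) h1)

theorem section_congr {N : Type*} [TopologicalSpace N] [ChartedSpace (Eu q) N]
    (w : (y : N) → TangentSpace (𝓡 q) y) {y y' : N} (h : y = y') : (w y : Eu q) = w y' := by
  subst h; rfl

/-- The smooth inverse of the reduction form along the level set. -/
theorem exists_extension_lift (hν : IsMomentMap G 𝓘c ν)
    (hQ : IsQuotientManifold (p := p) (q := q) (n := n) (incl G ν ζ hinv) (proj G ν ζ hinv))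
    (hp : p + 3 * d = n) (hq : q + d = p) (m : LevelSpace G ν ζ hinv) :
    ∃ (R : M → ReducedSpace G ν ζ hinv)
      (W : ((y : ReducedSpace G ν ζ hinv) → TangentSpace (𝓡 q) y) →
        (x : M) → TangentSpace (𝓡 n) x),
    (∀ᶠ x in 𝓝 (incl G ν ζ hinv m), ContMDiffAt (𝓡 n) (𝓡 q) ∞ R x) ∧
    (∀ᶠ m' in 𝓝 m, R (incl G ν ζ hinv m') = proj G ν ζ hinv m') ∧
    (∀ᶠ x in 𝓝 (incl G ν ζ hinv m), ∀ w, W w x ∈ distU 𝓘c ν x ∧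
      mfderiv (𝓡 n) (𝓡 q) R x (W w x) = w (R x)) ∧
    (∀ w, DiffField w (proj G ν ζ hinv m) → DiffField (W w) (incl G ν ζ hinv m)) ∧
    (∀ w, (∀ᶠ y in 𝓝 (proj G ν ζ hinv m), SmoothField w y) →
      ∀ᶠ x in 𝓝 (incl G ν ζ hinv m), SmoothField (W w) x) := by
  obtain ⟨R, hR, hRm⟩ := hQ.exists_extension m
  set y₀ := proj G ν ζ hinv m with hy₀
  set x₀ := incl G ν ζ hinv m with hx₀
  have hRx₀ : R x₀ = y₀ := hRm.self_of_nhds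
  have hRt : Tendsto R (𝓝 x₀) (𝓝 y₀) := hRx₀ ▸ hR.self_of_nhds.continuousAt.tendsto
  have hc := hRt.eventually (extChartAt_smooth_eventually (q := q) y₀)
  have hB : ∀ᶠ x in 𝓝 x₀, ∀ V, SmoothField V x →
      ContMDiffAt (𝓡 n) 𝓘(ℝ, Eu d × (Fin 3 → Eu d) × Eu q) ∞
      (fun x => reductionForm (q := q) 𝓘c ν R y₀ x (V x)) x := by
    filter_upwards [hR, hc] with x h1 h2 V hV
    exact reductionForm_smooth hν h1 h2.1 hV
  have hinv₀ : (reductionForm (q := q) 𝓘c ν R y₀ x₀).IsInvertible :=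
    reductionForm_isInvertible hν hQ hp hq (hR.self_of_nhds.mdifferentiableAt (by decide)) hRm
      (hc.self_of_nhds.2.1.mdifferentiableAt (by decide)) hc.self_of_nhds.2.2
  have hI := eventually_inverse (fun v => hB.self_of_nhds _ (smoothField_extend v)) hinv₀
  -- Prescribing zero ω and `dν` and the value `w (R x)` of `dR` puts the field in U and makes it
  -- R-related to `w` on an open set of M. Holding off P as well is what makes its brackets
  -- computable.
  refine ⟨R, fun w x => (reductionForm (q := q) 𝓘c ν R y₀ x).inverse
    (0, 0, mvfderiv (𝓡 q) (extChartAt (𝓡 q) y₀) (R x) (w (R x))), hR, hRm, ?_, ?_, ?_⟩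
  · filter_upwards [hR, hc, hI.1] with x h1 h2 h3 w
    exact (reductionForm_eq_iff hν (h1.mdifferentiableAt (by decide))
      (h2.2.1.mdifferentiableAt (by decide)) h2.2.2 _ _).1 (h3.self_apply_inverse _)
  · intro w hw
    refine hI.2.2 _ ?_
    have h1 : MDifferentiableAt (𝓡 q) 𝓘(ℝ, Eu q)
        (fun y => mvfderiv (𝓡 q) (extChartAt (𝓡 q) y₀) y (w y)) (R x₀) :=
      mdifferentiableAt_mfderiv_apply hc.self_of_nhds.2.1 (hRx₀.symm ▸ hw)
    exact mdifferentiableAt_const.prodMk_space (mdifferentiableAt_const.prodMk_space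
      (h1.comp x₀ (hR.self_of_nhds.mdifferentiableAt (by decide))))
  · intro w hw
    filter_upwards [hR, hc, hI.1, hB, hRt.eventually hw] with x h1 h2 h3 h4 h5
    refine (eventually_inverse (fun v => h4 _ (smoothField_extend v)) h3).2.1 _ ?_
    have h6 : ContMDiffAt (𝓡 q) 𝓘(ℝ, Eu q) ∞
        (fun y => mvfderiv (𝓡 q) (extChartAt (𝓡 q) y₀) y (w y)) (R x) :=
      contMDiffAt_mfderiv_apply h2.2.1 h5
    exact contMDiffAt_const.prodMk_space (contMDiffAt_const.prodMk_space (h6.comp x h1))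

theorem dval_smul (hν : IsMomentMap G 𝓘c ν) (γ : G) (x : M) (a : Fin 3) (t : TangentSpace (𝓡 n) x) :
    dval (ν a) (γ • x) (mfderiv (𝓡 n) (𝓡 n) (fun x : M => γ • x) x t) = Ad γ (dval (ν a) x t) := by
  have hγ : MDifferentiableAt (𝓡 n) (𝓡 n) (fun x : M => γ • x) x :=
    ((ContMDiffSMul.contMDiff_const_smul (I := 𝓡 d) (I' := 𝓡 n) (n := ∞) (M := M)
      γ).mdifferentiable (by decide)) x
  have hνd := (hν.smooth a).mdifferentiable (by decide)
  have h1 := mvfderiv_comp_mfderiv (k := ν a) (f := fun x : M => γ • x) (hνd (γ • x)) hγ t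
  have h2 : ν a ∘ (fun x : M => γ • x) = fun x => Ad γ (ν a x) := funext fun x => hν.equivariant a γ x
  rw [h2] at h1
  refine h1.symm.trans ?_
  have h3 := mvfderiv_comp_mfderiv (k := fun z : Eu d => Ad γ z) (f := ν a) (x := x)
    (Ad γ).mdifferentiableAt (hνd x) t
  refine h3.trans ?_
  exact DFunLike.congr_fun (ContinuousLinearMap.mfderiv_eq (Ad γ)) _

theorem isReduction (hν : IsMomentMap G 𝓘c ν) (hG : ActsByHypercomplexIsometries G 𝓘c g)
    (horth : ∀ m ∈ levelSet ν ζ, ∀ u ∈ distU 𝓘c ν m, ∀ X : Eu d,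
      g.inner m u (fundVec G X m) = 0)
    (hQ : IsQuotientManifold (p := p) (q := q) (n := n) (incl G ν ζ hinv) (proj G ν ζ hinv))
    (hp : Nonempty (LevelSpace G ν ζ hinv) → p + 3 * d = n)
    (hq : Nonempty (LevelSpace G ν ζ hinv) → q + d = p) :
    IsReduction (p := p) (q := q) (incl G ν ζ hinv) (proj G ν ζ hinv) (distU 𝓘c ν) 𝓘c g where
  smooth_incl := hQ.smooth_incl
  smooth_proj := hQ.smooth_proj
  surjective_proj := Quotient.mk_surjective
  invariant m a t ht := hν.I_mem_distU a ht
  exists_lift m := by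
    obtain ⟨R, hR, hRm⟩ := hQ.exists_extension m
    have hRd := hR.self_of_nhds.mdifferentiableAt (by decide)
    obtain ⟨-, hc, hci⟩ := (extChartAt_smooth_eventually (q := q)
      (R (incl G ν ζ hinv m))).self_of_nhds
    have hcd := hc.mdifferentiableAt (by decide)
    have hB := reductionForm_isInvertible (𝓘c := 𝓘c) hν hQ (hp ⟨m⟩) (hq ⟨m⟩) hRd hRm hcd hci
    let A : Eu q →L[ℝ] Eu d × (Fin 3 → Eu d) × Eu q :=
      (0 : Eu q →L[ℝ] Eu d).prod ((0 : Eu q →L[ℝ] Fin 3 → Eu d).prod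
        (mvfderiv (𝓡 q) (extChartAt (𝓡 q) (R (incl G ν ζ hinv m))) (R (incl G ν ζ hinv m))))
    refine ⟨(reductionForm (q := q) 𝓘c ν R (R (incl G ν ζ hinv m)) (incl G ν ζ hinv m)).inverse.comp A, fun t v => ?_⟩
    rw [isLift_iff_mfderiv hν hQ (hp ⟨m⟩) hRd hRm]
    refine (reductionForm_eq_iff hν hRd hcd hci t v).symm.trans ?_
    constructor
    · intro h
      have h1 := congrArg (reductionForm (q := q) 𝓘c ν R (R (incl G ν ζ hinv m)) (incl G ν ζ hinv m)).inverse h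
      rw [hB.inverse_apply_self] at h1
      exact h1
    · rintro rfl
      exact hB.self_apply_inverse _
  tangent m t ht := exists_tangent hν hQ (hp ⟨m⟩) m ht.1
  orth m τ u hu hτ := by
    obtain ⟨R, hR, hRm⟩ := hQ.exists_extension m
    have hRd := hR.self_of_nhds.mdifferentiableAt (by decide)
    obtain ⟨-, hc, hci⟩ := (extChartAt_smooth_eventually (q := q)
      (R (incl G ν ζ hinv m))).self_of_nhds
    have hcd := hc.mdifferentiableAt (by decide)
    have hB := reductionForm_isInvertible (𝓘c := 𝓘c) hν hQ (hp ⟨m⟩) (hq ⟨m⟩) hRd hRm hcd hci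
    set t := mfderiv (𝓡 p) (𝓡 n) (incl G ν ζ hinv) m τ with ht
    obtain ⟨X, hX⟩ := hν.twisted_fundVec_surjective (G := G) (incl G ν ζ hinv m)
      (twisted 𝓘c ν 0 _ t)
    have h1 : (mfderiv (𝓡 n) (𝓡 q) R (incl G ν ζ hinv m) t : Eu q) = 0 :=
      (mfderiv_retraction (hQ.smooth_incl.mdifferentiable (by decide) m) hRd hRm τ).trans hτ
    have h2 : t - fundVec G X (incl G ν ζ hinv m) ∈ distU 𝓘c ν (incl G ν ζ hinv m) ∧
        mfderiv (𝓡 n) (𝓡 q) R (incl G ν ζ hinv m) (t - fundVec G X (incl G ν ζ hinv m)) = 0 := by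
      refine ⟨hν.mem_distU.2 ⟨fun a => ?_, ?_⟩, ?_⟩
      · rw [map_sub, ht, dval_incl hν hQ, hν.dval_fundVec (m := incl G ν ζ hinv m) hinv m.2,
          sub_self]
      · rw [map_sub, hX, sub_self]
      · rw [map_sub]
        exact sub_eq_zero.2 (h1.trans (mfderiv_extension_fundVec hRd hRm X).symm)
    have h3 := (reductionForm_eq_iff hν hRd hcd hci _ 0).2 h2
    rw [map_zero] at h3
    -- Vertical vectors are Killing vectors: subtracting the Killing vector with the same ω-value
    -- leaves a vector killed by the whole invertible form.
    have h4 : t = fundVec G X (incl G ν ζ hinv m) :=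
      sub_eq_zero.1 (hB.injective (h3.trans (map_zero _).symm))
    rw [h4, g.symm]
    exact horth _ m.2 u hu X
  fibre m m' h := by
    obtain ⟨γ, rfl⟩ := exists_smul_of_proj_eq h
    refine ⟨mfderiv (𝓡 n) (𝓡 n) (fun x : M => γ • x) (incl G ν ζ hinv m),
      fun a t => hG.hypercomplex γ a _ t, fun t t' => hG.isometry γ _ t t', fun t v => ?_⟩
    rintro ⟨hu, τ, rfl, hv⟩
    obtain ⟨R, hR, hRm⟩ := hQ.exists_extension (γ • m)
    have hRd := hR.self_of_nhds.mdifferentiableAt (by decide)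
    have hid := hQ.smooth_incl.mdifferentiable (by decide) m
    have hγ : ContMDiff (𝓡 n) (𝓡 n) ∞ (fun x : M => γ • x) :=
      ContMDiffSMul.contMDiff_const_smul (I := 𝓡 d) (I' := 𝓡 n) (n := ∞) (M := M) γ
    have hγd := hγ.mdifferentiable (by decide) (incl G ν ζ hinv m)
    set t := mfderiv (𝓡 p) (𝓡 n) (incl G ν ζ hinv) m τ with ht
    rw [hν.mem_distU] at hu
    refine (isLift_iff_mfderiv hν hQ (hp ⟨m⟩) hRd hRm _ v).2 ⟨hν.mem_distU.2 ⟨fun a => ?_, ?_⟩, ?_⟩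
    · refine (dval_smul hν γ _ a t).trans ?_
      rw [hu.1, map_zero]
    -- Equivariance of ω follows from that of `dν₁` because `ω = -dν₁ ∘ I₁` and the group commutes
    -- with `I₁`.
    · have h1 := dval_smul hν γ (incl G ν ζ hinv m) 0 (𝓘c.I 0 _ t)
      rw [hν.dval_I, hu.2, neg_zero, map_zero, hG.hypercomplex, hν.dval_I] at h1
      exact neg_eq_zero.1 h1
    · have hcont : Continuous fun m : LevelSpace G ν ζ hinv => γ • m :=
        Continuous.subtype_mk (hγ.continuous.comp continuous_subtype_val) _
      have h2 : ∀ᶠ m' in 𝓝 m, R (γ • incl G ν ζ hinv m') = proj G ν ζ hinv m' := by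
        filter_upwards [hcont.continuousAt.eventually hRm] with m' hm'
        exact hm'.trans (proj_smul γ m')
      have h3 := mfderiv_retraction (i := (fun x : M => γ • x) ∘ incl G ν ζ hinv) (R := R)
        (hγd.comp m hid) hRd h2 τ
      have h4 := DFunLike.congr_fun (mfderiv_comp m hγd hid) τ
      refine Eq.trans ?_ (h3.trans hv)
      exact congrArg (mfderiv (𝓡 n) (𝓡 q) R (γ • incl G ν ζ hinv m)) h4.symm
  exists_section := hQ.exists_section
  exists_extension m := by
    obtain ⟨R, W, h1, h2, h3, h4, h5⟩ := exists_extension_lift hν hQ (hp ⟨m⟩) (hq ⟨m⟩) m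
    refine ⟨R, W, h1, h2, ?_, h4, h5, fun v w hv hw => ?_⟩
    · filter_upwards [h2.eventually_nhds, hQ.smooth_incl.continuous.continuousAt.eventually h1,
        hQ.smooth_incl.continuous.continuousAt.eventually h3] with m' e1 e2 e3 w
      rw [isLift_iff_mfderiv hν hQ (hp ⟨m⟩) (e2.mdifferentiableAt (by decide)) e1]
      exact ⟨(e3 w).1, (e3 w).2.trans (section_congr w e1.self_of_nhds)⟩
    · have hRx₀ : R (incl G ν ζ hinv m) = proj G ν ζ hinv m := h2.self_of_nhds
      have hRd := h1.self_of_nhds.mdifferentiableAt (by decide)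
      -- Both lifts annihilate `ν_a` on a neighbourhood in M, hence so does their commutator: the
      -- bracket is tangent to P, though it need not lie in U.
      have h6 : ∀ a, dval (n := n) (ν a) (incl G ν ζ hinv m)
          (VectorField.mlieBracket (𝓡 n) (W v) (W w) (incl G ν ζ hinv m)) = 0 := by
        intro a
        have h7 : ∀ w, (fun x => mvfderiv (𝓡 n) (ν a) x (W w x)) =ᶠ[𝓝 (incl G ν ζ hinv m)]
            fun _ => 0 := fun w => h3.mono fun x hx => (hx w).1.1 a
        have h8 : ∀ w t, mvfderiv (𝓡 n) (fun x => mvfderiv (𝓡 n) (ν a) x (W w x))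
            (incl G ν ζ hinv m) t = 0 := fun w t =>
          (DFunLike.congr_fun (h7 w).mfderiv_eq t).trans (by rw [mfderiv_const]; rfl)
        refine (mfderiv_mlieBracket (hν.smooth a).contMDiffAt (h4 v hv) (h4 w hw)).trans ?_
        rw [h8, h8, sub_zero]
      obtain ⟨τ, hτ⟩ := exists_tangent hν hQ (hp ⟨m⟩) m h6
      refine ⟨τ, hτ, ?_⟩
      have h9 := mfderiv_mlieBracket_of_related h1.self_of_nhds (h4 v hv) (h4 w hw)
        (v := v) (w := w) (hRx₀.symm ▸ hv) (hRx₀.symm ▸ hw)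
        (h3.mono fun x hx => (hx v).2) (h3.mono fun x hx => (hx w).2)
      rw [← hτ] at h9
      refine (mfderiv_retraction (hQ.smooth_incl.mdifferentiable (by decide) m)
        hRd h2 τ).symm.trans (h9.trans ?_)
      exact section_congr (VectorField.mlieBracket (𝓡 q) v w) hRx₀

end ConcreteReduction

/-! ### Charts from the inverse function theorem -/

section InverseFunction

/-- The inverse function theorem for smooth maps. -/
theorem exists_localInverse {E F : Type*} [NormedAddCommGroup E] [NormedSpace ℝ E] [CompleteSpace E]
    [NormedAddCommGroup F] [NormedSpace ℝ F] {A : E → F} {z : E} {S : E → Prop}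
    (hA : ∀ᶠ y in 𝓝 z, ContDiffAt ℝ ∞ A y) (hS : ∀ᶠ y in 𝓝 z, S y)
    (hinv : (fderiv ℝ A z).IsInvertible) :
    ∃ f : OpenPartialHomeomorph E F, z ∈ f.source ∧
      (∀ y, f y = A y) ∧ (∀ y ∈ f.source, S y ∧ ContDiffAt ℝ ∞ A y) ∧
      ∀ w ∈ f.target, ContDiffAt ℝ ∞ f.symm w := by
  obtain ⟨e, he⟩ := hinv
  have hAz := hA.self_of_nhds
  have hd : HasFDerivAt A (e : E →L[ℝ] F) z :=
    he ▸ (hAz.differentiableAt (by decide)).hasFDerivAt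
  have hev : ∀ᶠ y in 𝓝 z, (fderiv ℝ A y).IsInvertible := by
    have h1 : ContinuousAt (fderiv ℝ A) z := (hAz.fderiv_right (m := 0) (by simp)).continuousAt
    exact h1.eventually (he ▸ ContinuousLinearEquiv.nhds e)
  -- Restricting to points with invertible derivative makes the inverse smooth on its whole domain
  -- and not only at the image of `z`.
  obtain ⟨U, hU, hUo, hzU⟩ := eventually_nhds_iff.1 (hA.and (hS.and hev))
  set f₀ := hAz.toOpenPartialHomeomorph A hd (by decide)
  refine ⟨f₀.restrOpen U hUo, ⟨hAz.mem_toOpenPartialHomeomorph_source hd _, hzU⟩, fun y => rfl,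
    fun y hy => ⟨(hU y hy.2).2.1, (hU y hy.2).1⟩, fun w hw => ?_⟩
  have hw' := (f₀.restrOpen U hUo).map_target hw
  obtain ⟨h1, h2, e', he'⟩ := hU _ hw'.2
  exact OpenPartialHomeomorph.contDiffAt_symm _ hw
    (f₀' := e') (he' ▸ (h1.differentiableAt (by decide)).hasFDerivAt) h1

variable {n : ℕ} {M : Type*} [TopologicalSpace M] [ChartedSpace (Eu n) M] [IsManifold (𝓡 n) ∞ M]

/-- A smooth map to the model space with invertible derivative is a chart. -/
theorem exists_chart {Φ : M → Eu n} {x₀ : M} {S : M → Prop}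
    (hΦ : ∀ᶠ x in 𝓝 x₀, ContMDiffAt (𝓡 n) 𝓘(ℝ, Eu n) ∞ Φ x) (hS : ∀ᶠ x in 𝓝 x₀, S x)
    (hinv : (mfderiv (𝓡 n) 𝓘(ℝ, Eu n) Φ x₀).IsInvertible) :
    ∃ e ∈ IsManifold.maximalAtlas (𝓡 n) ∞ M, x₀ ∈ e.source ∧ ∀ x ∈ e.source, e x = Φ x ∧ S x := by
  set φ := chartAt (Eu n) x₀ with hφ
  have hx₀ : x₀ ∈ φ.source := mem_chart_source _ _
  have hφs : ContMDiffOn (𝓡 n) (𝓡 n) ∞ φ φ.source := contMDiffOn_chart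
  have hφs' : ContMDiffOn (𝓡 n) (𝓡 n) ∞ φ.symm φ.target := contMDiffOn_chart_symm
  have htend : Tendsto φ.symm (𝓝 (φ x₀)) (𝓝 x₀) := φ.tendsto_symm hx₀
  have hA : ∀ᶠ y in 𝓝 (φ x₀), ContDiffAt ℝ ∞ (Φ ∘ φ.symm) y := by
    filter_upwards [htend.eventually hΦ, φ.open_target.mem_nhds (φ.map_source hx₀)] with y h1 h2
    exact (h1.comp y (hφs'.contMDiffAt (φ.open_target.mem_nhds h2))).contDiffAt
  have hT : ∀ᶠ y in 𝓝 (φ x₀), y ∈ φ.target ∧ S (φ.symm y) ∧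
      ContMDiffAt (𝓡 n) 𝓘(ℝ, Eu n) ∞ Φ (φ.symm y) := by
    filter_upwards [htend.eventually hΦ, φ.open_target.mem_nhds (φ.map_source hx₀),
      htend.eventually hS] with y h1 h2 h3
    exact ⟨h2, h3, h1⟩
  have hd : mfderiv (𝓡 n) 𝓘(ℝ, Eu n) Φ x₀ = fderiv ℝ (Φ ∘ φ.symm) (φ x₀) := by
    rw [(hΦ.self_of_nhds.mdifferentiableAt (by decide)).mfderiv, (𝓡 n).range_eq_univ,
      fderivWithin_univ]
    rfl
  obtain ⟨f, hf1, hf2, hf3, hf4⟩ := exists_localInverse hA hT (hd ▸ hinv)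
  refine ⟨φ.trans f, ?_, ⟨hx₀, hf1⟩, fun x hx => ?_⟩
  · apply OpenPartialHomeomorph.mem_maximalAtlas_of_contMDiffOn
    · intro x hx
      have h1 := (hf3 _ hx.2).2.contMDiffAt.comp x
        (hφs.contMDiffAt (φ.open_source.mem_nhds hx.1))
      refine (h1.congr_of_eventuallyEq (Filter.Eventually.of_forall fun y => ?_)).contMDiffWithinAt
      exact hf2 _
    · intro w hw
      rw [OpenPartialHomeomorph.trans_target] at hw
      have h1 := hφs'.contMDiffAt (φ.open_target.mem_nhds hw.2)
      exact (h1.comp w (hf4 w hw.1).contMDiffAt).contMDiffWithinAt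
  · obtain ⟨-, h2, -⟩ := (hf3 _ hx.2).1
    have h3 : φ.symm (φ x) = x := φ.left_inv hx.1
    refine ⟨?_, h3 ▸ h2⟩
    exact (hf2 _).trans (congrArg Φ h3)

/-- A submersion to a vector space is a projection in a suitable chart. -/
theorem exists_submersion_chart {k : ℕ} {F : Type*} [NormedAddCommGroup F] [NormedSpace ℝ F]
    [FiniteDimensional ℝ F] (hk : k + Module.finrank ℝ F = n) {f : M → F} {x₀ : M} {S : M → Prop}
    (hf : ∀ᶠ x in 𝓝 x₀, ContMDiffAt (𝓡 n) 𝓘(ℝ, F) ∞ f x) (hS : ∀ᶠ x in 𝓝 x₀, S x)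
    (hsurj : Function.Surjective (mvfderiv (𝓡 n) f x₀)) :
    ∃ e ∈ IsManifold.maximalAtlas (𝓡 n) ∞ M, ∃ L : (Eu k × F) ≃L[ℝ] Eu n, x₀ ∈ e.source ∧
      ∀ x ∈ e.source, (L.symm (e x)).2 = f x ∧ S x := by
  let D : Eu n →L[ℝ] F := mvfderiv (𝓡 n) f x₀
  have hker : Module.finrank ℝ (LinearMap.ker D.toLinearMap) = Module.finrank ℝ (Eu k) := by
    have h1 := LinearMap.finrank_range_add_finrank_ker D.toLinearMap
    have h2 : LinearMap.range D.toLinearMap = ⊤ := LinearMap.range_eq_top.2 hsurj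
    rw [h2, finrank_top, finrank_euclideanSpace_fin] at h1
    rw [finrank_euclideanSpace_fin]
    omega
  -- `K₀` projects onto the kernel of the differential. Completing `f` by this projection of the
  -- chart coordinates gives a map whose derivative is injective.
  obtain ⟨K₀, hK₀⟩ := LinearMap.exists_leftInverse_of_injective
    (LinearMap.ker D.toLinearMap).subtype (Submodule.ker_subtype _)
  let eK := LinearEquiv.ofFinrankEq _ _ hker
  let K : Eu n →L[ℝ] Eu k := LinearMap.toContinuousLinearMap (eK.toLinearMap ∘ₗ K₀)
  have hdim : Module.finrank ℝ (Eu k × F) = Module.finrank ℝ (Eu n) := by simp [hk]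
  let L : (Eu k × F) ≃L[ℝ] Eu n := ContinuousLinearEquiv.ofFinrankEq hdim
  set φ := extChartAt (𝓡 n) x₀ with hφ
  have hφs : ∀ᶠ x in 𝓝 x₀, ContMDiffAt (𝓡 n) 𝓘(ℝ, Eu n) ∞ φ x :=
    (extChartAt_smooth_eventually (q := n) x₀).mono fun x hx => hx.2.1
  let L₁ : Eu n →L[ℝ] Eu n := (L : (Eu k × F) →L[ℝ] Eu n).comp
    ((ContinuousLinearMap.inl ℝ (Eu k) F).comp K)
  let L₂ : F →L[ℝ] Eu n := (L : (Eu k × F) →L[ℝ] Eu n).comp (ContinuousLinearMap.inr ℝ (Eu k) F)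
  let Φ : M → Eu n := fun x => L₁ (φ x) + L₂ (f x)
  have hadd : ∀ y z, L₁ y + L₂ z = L (K y, z) := fun y z => by simp [L₁, L₂, ← map_add]
  have hΦ : ∀ᶠ x in 𝓝 x₀, ContMDiffAt (𝓡 n) 𝓘(ℝ, Eu n) ∞ Φ x := by
    filter_upwards [hφs, hf] with x h1 h2
    exact (L₁.contMDiff.contMDiffAt.comp x h1).add (L₂.contMDiff.contMDiffAt.comp x h2)
  have hD : HasMFDerivAt (𝓡 n) 𝓘(ℝ, Eu n) Φ x₀ (L₁ + L₂.comp D : Eu n →L[ℝ] Eu n) := by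
    have h1 := (hφs.self_of_nhds.mdifferentiableAt (by decide)).hasMFDerivAt
    rw [mfderiv_extChartAt_self] at h1
    have h2 := (hf.self_of_nhds.mdifferentiableAt (by decide)).hasMFDerivAt
    exact (L₁.hasMFDerivAt.comp x₀ h1).add (L₂.hasMFDerivAt.comp x₀ h2)
  have hinv : (mfderiv (𝓡 n) 𝓘(ℝ, Eu n) Φ x₀).IsInvertible := by
    rw [hD.mfderiv]
    refine isInvertible_of_injective (E := Eu n) (F := Eu n) (L₁ + L₂.comp D)
      ((injective_iff_map_eq_zero _).2 fun t ht => ?_) rfl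
    replace ht : L (K t, D t) = 0 := (hadd t (D t)).symm.trans ht
    have h1 : (K t, D t) = 0 := L.injective (ht.trans (map_zero L).symm)
    have h2 : D t = 0 := congrArg Prod.snd h1
    have h3 : K₀ t = 0 := eK.injective ((congrArg Prod.fst h1).trans (map_zero eK).symm)
    have h4 := LinearMap.congr_fun hK₀ ⟨t, h2⟩
    exact congrArg Subtype.val (h4.symm.trans h3)
  obtain ⟨e, he, h1, h2⟩ := exists_chart hΦ hS hinv
  refine ⟨e, he, L, h1, fun x hx => ⟨?_, (h2 x hx).2⟩⟩
  rw [(h2 x hx).1]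
  simp [Φ, hadd]

end InverseFunction

/-! ### Manifold structures defined by slices -/

section Slices

variable {n : ℕ} (k : ℕ) {M P X : Type*}
  [TopologicalSpace M] [ChartedSpace (Eu n) M]
  [TopologicalSpace P] [TopologicalSpace X]

/-- A smooth parametrized piece `s` of a subspace `i : P → M` that is a local section for
`pr : P → X`, together with a smooth map `ρ` that inverts it up to the fibres of `pr`. -/
structure Slice (i : P → M) (pr : P → X) where
  B : Set (Eu k)
  isOpen_B : IsOpen B
  s : Eu k → P
  W : Set M
  isOpen_W : IsOpen W
  ρ : M → Eu k
  smooth_s : ∀ b ∈ B, ContMDiffAt (𝓡 k) (𝓡 n) ∞ (fun b => i (s b)) b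
  smooth_ρ : ∀ x ∈ W, ContMDiffAt (𝓡 n) (𝓡 k) ∞ ρ x
  mem_W : ∀ b ∈ B, i (s b) ∈ W
  ρ_s : ∀ b ∈ B, ρ (i (s b)) = b
  mem_B : ∀ x, i x ∈ W → ρ (i x) ∈ B
  pr_s : ∀ x, i x ∈ W → pr (s (ρ (i x))) = pr x
  inj : InjOn (fun b => pr (s b)) B

/-- The space `X` is an open quotient of the subspace `i : P → M`, with fibres that are
connected by diffeomorphisms, and it is covered by slices. -/
structure IsSliced (i : P → M) (pr : P → X) : Prop where
  embedding : IsEmbedding i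
  quot : IsOpenQuotientMap pr
  symmetry : ∀ x x', pr x = pr x' → ∃ (τ : M → M) (τ' : P → P),
    ContMDiff (𝓡 n) (𝓡 n) ∞ τ ∧ (∀ y, i (τ' y) = τ (i y)) ∧ (∀ y, pr (τ' y) = pr y) ∧
      τ (i x) = i x'
  exists_slice : ∀ x, ∃ c : Slice (n := n) k i pr, i x ∈ c.W ∧ c.s (c.ρ (i x)) = x

variable {k} {i : P → M} {pr : P → X}

/-- The inverse of the parametrization of `X` by a slice. -/
def Slice.coord (c : Slice (n := n) k i pr) : X → Eu k :=
  Function.invFunOn (fun b => pr (c.s b)) c.B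

theorem Slice.coord_pr_s (c : Slice (n := n) k i pr) {b : Eu k} (hb : b ∈ c.B) :
    c.coord (pr (c.s b)) = b :=
  c.inj.leftInvOn_invFunOn hb

theorem Slice.coord_pr (c : Slice (n := n) k i pr) {x : P} (hx : i x ∈ c.W) :
    c.coord (pr x) = c.ρ (i x) := by
  rw [← c.pr_s x hx, c.coord_pr_s (c.mem_B x hx)]

theorem Slice.continuousAt_s (c : Slice (n := n) k i pr) (hi : IsEmbedding i) {b : Eu k}
    (hb : b ∈ c.B) : ContinuousAt c.s b :=
  hi.isInducing.continuousAt_iff.2 (c.smooth_s b hb).continuousAt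

/-- The chart of `X` given by a slice. -/
def Slice.chart (c : Slice (n := n) k i pr) (h : IsSliced (n := n) k i pr) :
    OpenPartialHomeomorph X (Eu k) where
  toFun := c.coord
  invFun b := pr (c.s b)
  source := pr '' (i ⁻¹' c.W)
  target := c.B
  map_source' := by
    rintro _ ⟨x, hx, rfl⟩
    rw [c.coord_pr hx]
    exact c.mem_B x hx
  map_target' b hb := ⟨c.s b, c.mem_W b hb, rfl⟩
  left_inv' := by
    rintro _ ⟨x, hx, rfl⟩
    rw [c.coord_pr hx, c.pr_s x hx]
  right_inv' b hb := c.coord_pr_s hb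
  open_source := h.quot.isOpenMap _ (c.isOpen_W.preimage h.embedding.continuous)
  open_target := c.isOpen_B
  continuousOn_toFun := by
    rintro _ ⟨x, hx, rfl⟩
    refine ContinuousAt.continuousWithinAt ?_
    -- For an open quotient map the neighbourhoods of `pr x` are the images of those of `x`, so
    -- continuity is checked on P, where the coordinate is `ρ ∘ i`.
    rw [ContinuousAt, ← h.quot.map_nhds_eq, tendsto_map'_iff, c.coord_pr hx]
    have h1 : ContinuousAt (fun x => c.ρ (i x)) x :=
      (c.smooth_ρ _ hx).continuousAt.comp h.embedding.continuous.continuousAt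
    refine h1.congr_of_eventuallyEq ?_ |>.tendsto.trans (by rw [Function.comp, c.coord_pr hx])
    filter_upwards [(c.isOpen_W.preimage h.embedding.continuous).mem_nhds hx] with y hy
    exact c.coord_pr hy
  continuousOn_invFun b hb :=
    (h.quot.continuous.continuousAt.comp (c.continuousAt_s h.embedding hb)).continuousWithinAt

/-- Two slices may meet the same fibre at different points. A symmetry τ moves one point to the
other, and the coordinate change is locally `ρ' ∘ τ ∘ i ∘ s`. -/
theorem Slice.transition_smooth (c c' : Slice (n := n) k i pr) (h : IsSliced (n := n) k i pr)
    {b : Eu k} (hb : b ∈ c.B) (hb' : pr (c.s b) ∈ (c'.chart h).source) :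
    ContMDiffAt (𝓡 k) (𝓡 k) ∞ (fun b => c'.coord (pr (c.s b))) b := by
  obtain ⟨x', hx', hxx'⟩ := hb'
  obtain ⟨τ, τ', hτ, hi, hpr, hx⟩ := h.symmetry _ _ hxx'.symm
  have h1 : ContMDiffAt (𝓡 k) (𝓡 n) ∞ (fun b => τ (i (c.s b))) b :=
    hτ.contMDiffAt.comp b (c.smooth_s b hb)
  have h2 : τ (i (c.s b)) ∈ c'.W := hx ▸ hx'
  refine ((c'.smooth_ρ _ h2).comp b h1).congr_of_eventuallyEq ?_
  filter_upwards [h1.continuousAt.preimage_mem_nhds (c'.isOpen_W.mem_nhds h2)] with b' hb'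
  rw [← hpr, c'.coord_pr (by rw [hi]; exact hb'), hi]
  rfl

/-- The manifold structure given by the slices. -/
@[reducible]
def IsSliced.chartedSpace (h : IsSliced (n := n) k i pr) : ChartedSpace (Eu k) X where
  atlas := {e | ∃ c : Slice (n := n) k i pr, e = c.chart h}
  chartAt y := (h.exists_slice (Function.surjInv h.quot.surjective y)).choose.chart h
  mem_chart_source y :=
    ⟨_, (h.exists_slice (Function.surjInv h.quot.surjective y)).choose_spec.1,
      Function.surjInv_eq _ _⟩
  chart_mem_atlas y := ⟨_, rfl⟩

theorem IsSliced.isManifold (h : IsSliced (n := n) k i pr) :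
    @IsManifold ℝ _ (Eu k) _ _ (Eu k) _ (𝓡 k) ∞ X _ h.chartedSpace := by
  let := h.chartedSpace
  refine isManifold_of_contDiffOn (𝓡 k) ∞ X ?_
  rintro _ _ ⟨c, rfl⟩ ⟨c', rfl⟩
  rintro b ⟨hb, -⟩
  exact (c.transition_smooth c' h hb.1 hb.2).contDiffAt.contDiffWithinAt

theorem IsSliced.chart_mem (h : IsSliced (n := n) k i pr) (c : Slice (n := n) k i pr) :
    letI := h.chartedSpace
    c.chart h ∈ IsManifold.maximalAtlas (𝓡 k) ∞ X := by
  let := h.chartedSpace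
  have := h.isManifold
  exact IsManifold.subset_maximalAtlas ⟨c, rfl⟩

theorem IsSliced.contMDiffAt_coord (h : IsSliced (n := n) k i pr) (c : Slice (n := n) k i pr)
    {y : X} (hy : y ∈ (c.chart h).source) :
    letI := h.chartedSpace
    ContMDiffAt (𝓡 k) (𝓡 k) ∞ c.coord y := by
  let := h.chartedSpace
  exact contMDiffAt_of_mem_maximalAtlas (h.chart_mem c) hy

theorem IsSliced.contMDiffAt_pr_s (h : IsSliced (n := n) k i pr) (c : Slice (n := n) k i pr)
    {b : Eu k} (hb : b ∈ c.B) :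
    letI := h.chartedSpace
    ContMDiffAt (𝓡 k) (𝓡 k) ∞ (fun b => pr (c.s b)) b := by
  let := h.chartedSpace
  exact contMDiffAt_symm_of_mem_maximalAtlas (h.chart_mem c) hb

end Slices

section

variable {n p q : ℕ} {M P N : Type*}
  [TopologicalSpace M] [ChartedSpace (Eu n) M]
  [TopologicalSpace P] [TopologicalSpace N] {i : P → M} {pr : P → N}

/-- A slice for P gives the retraction `s ∘ ρ`; a slice for the quotient gives the section `s ∘
coord`. -/
theorem IsSliced.isQuotientManifold (hP : IsSliced (n := n) p i id)
    (hN : IsSliced (n := n) q i pr) :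
    letI := hP.chartedSpace
    letI := hN.chartedSpace
    IsQuotientManifold (p := p) (q := q) (n := n) i pr := by
  let := hP.chartedSpace
  let := hN.chartedSpace
  have hi : ContMDiff (𝓡 p) (𝓡 n) ∞ i := by
    intro m
    obtain ⟨c, hc, -⟩ := hP.exists_slice m
    have hc' : m ∈ (c.chart hP).source := ⟨m, hc, rfl⟩
    have h1 : c.coord m = c.ρ (i m) := c.coord_pr hc
    refine ((c.smooth_s _ (h1 ▸ c.mem_B m hc)).comp m
      (hP.contMDiffAt_coord c hc')).congr_of_eventuallyEq ?_
    filter_upwards [(c.isOpen_W.preimage hP.embedding.continuous).mem_nhds hc] with x hx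
    have h2 : c.coord x = c.ρ (i x) := c.coord_pr hx
    have h3 : c.s (c.ρ (i x)) = x := c.pr_s x hx
    rw [Function.comp, h2, h3]
  have hr : ∀ m, ∃ r : M → P, (∀ᶠ x in 𝓝 (i m), ContMDiffAt (𝓡 n) (𝓡 p) ∞ r x) ∧
      ∀ᶠ m' in 𝓝 m, r (i m') = m' := by
    intro m
    obtain ⟨c, hc, -⟩ := hP.exists_slice m
    refine ⟨fun x => c.s (c.ρ x), ?_, ?_⟩
    · filter_upwards [c.isOpen_W.mem_nhds hc, (c.smooth_ρ _ hc).continuousAt.preimage_mem_nhds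
        (c.isOpen_B.mem_nhds (c.mem_B m hc))] with x h1 h2
      exact (hP.contMDiffAt_pr_s c h2).comp x (c.smooth_ρ x h1)
    · filter_upwards [(c.isOpen_W.preimage hP.embedding.continuous).mem_nhds hc] with x hx
      exact c.pr_s x hx
  refine ⟨hi, ?_, hr, ?_⟩
  · intro m
    obtain ⟨c, hc, -⟩ := hN.exists_slice m
    refine ((hN.contMDiffAt_pr_s c (c.mem_B m hc)).comp m
      ((c.smooth_ρ _ hc).comp m hi.contMDiffAt)).congr_of_eventuallyEq ?_
    filter_upwards [(c.isOpen_W.preimage hP.embedding.continuous).mem_nhds hc] with x hx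
    exact (c.pr_s x hx).symm
  · intro m
    obtain ⟨c, hc, hcm⟩ := hN.exists_slice m
    obtain ⟨r, hr1, hr2⟩ := hr m
    have hm : pr m ∈ (c.chart hN).source := ⟨m, hc, rfl⟩
    have h0 := c.coord_pr hc
    have hs : ContinuousAt (fun y => c.s (c.coord y)) (pr m) :=
      (c.continuousAt_s hP.embedding (h0 ▸ c.mem_B m hc)).comp (hN.contMDiffAt_coord c hm).continuousAt
    have hsm : c.s (c.coord (pr m)) = m := by rw [h0, hcm]
    refine ⟨fun y => c.s (c.coord y), hsm, ?_⟩
    have h1 := hs.tendsto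
    rw [hsm] at h1
    have h2 := h1.eventually (hr2.eventually_nhds)
    have h3 := h1.eventually (hP.embedding.continuous.continuousAt.eventually hr1)
    filter_upwards [(c.chart hN).open_source.mem_nhds hm, h2, h3] with y hy hy2 hy3
    have hB : c.coord y ∈ c.B := (c.chart hN).map_source hy
    refine ⟨?_, (c.chart hN).left_inv hy⟩
    have h4 := (hN.contMDiffAt_coord c hy)
    -- The section is known to be smooth only as a map to M; composing with the retraction makes it
    -- smooth into P.
    have h5 := hy3.comp y ((c.smooth_s _ hB).comp y h4)
    refine h5.congr_of_eventuallyEq ?_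
    have hsy : ContinuousAt (fun y => c.s (c.coord y)) y :=
      (c.continuousAt_s hP.embedding hB).comp h4.continuousAt
    filter_upwards [hsy.eventually hy2] with z hz
    exact hz.symm

end

/-! ### Slices of regular level sets -/

section LevelSlice

variable {n k : ℕ} {M P : Type*} [TopologicalSpace M] [ChartedSpace (Eu n) M]
  [IsManifold (𝓡 n) ∞ M] [TopologicalSpace P] {i : P → M}

/-- The regular level sets of a smooth map have slices, which are compatible with charts of the
ambient manifold. -/
theorem exists_levelSlice {F : Type*} [NormedAddCommGroup F] [NormedSpace ℝ F]
    [FiniteDimensional ℝ F] (hi : Function.Injective i) {f : M → F}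
    (hf : ContMDiff (𝓡 n) 𝓘(ℝ, F) ∞ f) (hrange : ∀ x, f x = 0 ↔ x ∈ range i)
    (hk : k + Module.finrank ℝ F = n) (m : P)
    (hsurj : Function.Surjective (mvfderiv (𝓡 n) f (i m))) :
    ∃ c : Slice (n := n) k i id, ∃ e ∈ IsManifold.maximalAtlas (𝓡 n) ∞ M,
      ∃ L : (Eu k × F) ≃L[ℝ] Eu n, i m ∈ c.W ∧ c.W = e.source ∧
        ∀ b ∈ c.B, e (i (c.s b)) = L (b, 0) := by
  obtain ⟨e, he, L, hm, heL⟩ := exists_submersion_chart hk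
    (Filter.Eventually.of_forall fun x => hf x) (S := fun _ => True)
    (Filter.Eventually.of_forall fun _ => trivial) hsurj
  have : Nonempty P := ⟨m⟩
  have hB : Continuous fun b : Eu k => L (b, (0 : F)) :=
    L.continuous.comp (continuous_id.prodMk continuous_const)
  -- Vanishing second coordinate means `f = 0`, so the point comes from P; the arbitrary value of
  -- `invFun` is never met over the chart target.
  have hs : ∀ b : Eu k, L (b, (0 : F)) ∈ e.target →
      i (Function.invFun i (e.symm (L (b, 0)))) = e.symm (L (b, 0)) := by
    intro b hb
    refine Function.invFun_eq ((hrange _).1 ?_)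
    rw [← (heL _ (e.map_target hb)).1, e.right_inv hb]
    simp
  have h0 : ∀ x, i x ∈ e.source → L ((L.symm (e (i x))).1, (0 : F)) = e (i x) := by
    intro x hx
    have h1 : (L.symm (e (i x))).2 = 0 := (heL _ hx).1.trans ((hrange _).2 ⟨x, rfl⟩)
    rw [← h1]
    simp
  have hρ : ∀ b : Eu k, L (b, (0 : F)) ∈ e.target →
      (L.symm (e (i (Function.invFun i (e.symm (L (b, 0))))))).1 = b := by
    intro b hb
    rw [hs b hb, e.right_inv hb]
    simp
  refine ⟨{
    B := {b | L (b, 0) ∈ e.target}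
    isOpen_B := e.open_target.preimage hB
    s := fun b => Function.invFun i (e.symm (L (b, 0)))
    W := e.source
    isOpen_W := e.open_source
    ρ := fun x => (L.symm (e x)).1
    smooth_s := ?_
    smooth_ρ := ?_
    mem_W := ?_
    ρ_s := hρ
    mem_B := ?_
    pr_s := ?_
    inj := ?_ }, e, he, L, hm, rfl, ?_⟩
  · intro b hb
    have h1 : ContMDiffAt (𝓡 k) (𝓡 n) ∞ (fun b : Eu k => L (b, (0 : F))) b :=
      ((L : (Eu k × F) →L[ℝ] Eu n).comp
        (ContinuousLinearMap.inl ℝ (Eu k) F)).contMDiff.contMDiffAt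
    refine ((contMDiffAt_symm_of_mem_maximalAtlas he hb).comp b h1).congr_of_eventuallyEq ?_
    filter_upwards [(e.open_target.preimage hB).mem_nhds hb] with b' hb'
    exact hs b' hb'
  · intro x hx
    exact ((ContinuousLinearMap.fst ℝ (Eu k) F).comp
      (L.symm : Eu n →L[ℝ] (Eu k × F))).contMDiff.contMDiffAt.comp x
      (contMDiffAt_of_mem_maximalAtlas he hx)
  · intro b hb
    rw [hs b hb]
    exact e.map_target hb
  · intro x hx
    change L (_, _) ∈ e.target
    rw [h0 x hx]
    exact e.map_source hx
  · intro x hx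
    change Function.invFun i (e.symm (L (_, 0))) = x
    rw [h0 x hx, e.left_inv hx, Function.leftInverse_invFun hi]
  · intro b hb b' hb' h
    rw [← hρ b hb, ← hρ b' hb']
    exact congrArg (fun x => (L.symm (e (i x))).1) h
  · intro b hb
    change e (i (Function.invFun i (e.symm (L (b, 0))))) = _
    rw [hs b hb, e.right_inv hb]

end LevelSlice

/-! ### Slices for free actions of compact groups -/

section OrbitSlice

theorem exists_complement_map {d q p : ℕ} (hq : q + d = p) (C : Eu d →L[ℝ] Eu p)
    (hC : Function.Injective C) :
    ∃ j : Eu q →L[ℝ] Eu p, ∀ ξ x, C ξ + j x = 0 → ξ = 0 ∧ x = 0 := by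
  obtain ⟨K, hK⟩ := Submodule.exists_isCompl (LinearMap.range C.toLinearMap)
  have h1 := Submodule.finrank_add_eq_of_isCompl hK
  rw [LinearMap.finrank_range_of_inj hC, finrank_euclideanSpace_fin,
    finrank_euclideanSpace_fin] at h1
  have h2 : Module.finrank ℝ (Eu q) = Module.finrank ℝ K := by
    rw [finrank_euclideanSpace_fin]
    omega
  let eK := LinearEquiv.ofFinrankEq (Eu q) K h2
  refine ⟨LinearMap.toContinuousLinearMap (K.subtype ∘ₗ eK.toLinearMap), fun ξ x h => ?_⟩
  have h3 : C ξ ∈ K := by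
    rw [eq_neg_of_add_eq_zero_left h]
    exact K.neg_mem (eK x).2
  have h4 : C ξ = 0 := (Submodule.disjoint_def.1 hK.disjoint) _ ⟨ξ, rfl⟩ h3
  refine ⟨hC (h4.trans (map_zero C).symm), ?_⟩
  rw [h4, zero_add] at h
  have h5 : eK x = 0 := Subtype.ext h
  exact eK.injective (h5.trans (map_zero eK).symm)

/-- Outside the interior of V no element fixes `f y`. This persists near `(y, y)` for each such
element, and uniformly because these elements form a compact set. -/
theorem eventually_mem_of_smul_eq {G P Y : Type*} [TopologicalSpace G] [CompactSpace G]
    [TopologicalSpace P] [T2Space P] [TopologicalSpace Y] [Group G] [MulAction G P]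
    [ContinuousSMul G P] {f : Y → P} {y : Y} (hf : ContinuousAt f y)
    (hfree : ∀ γ : G, γ • f y = f y → γ = 1) {V : Set G} (hV : V ∈ 𝓝 1) :
    ∀ᶠ z : Y × Y in 𝓝 (y, y), ∀ γ : G, γ • f z.1 = f z.2 → γ ∈ V := by
  have hK : IsCompact (interior V)ᶜ := isOpen_interior.isClosed_compl.isCompact
  have h1 := hK.eventually_forall_of_forall_eventually (x₀ := (y, y))
    (P := fun (z : Y × Y) (γ : G) => γ • f z.1 ≠ f z.2) fun γ hγ => by
      have h2 : γ • f y ≠ f y := fun h =>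
        hγ (by rw [hfree γ h]; exact mem_interior_iff_mem_nhds.2 hV)
      have h3 : ContinuousAt (fun w : (Y × Y) × G => f w.1.1) ((y, y), γ) :=
        ContinuousAt.comp (f := fun w : (Y × Y) × G => w.1.1) hf
          (continuous_fst.comp continuous_fst).continuousAt
      have h4 : ContinuousAt (fun w : (Y × Y) × G => f w.1.2) ((y, y), γ) :=
        ContinuousAt.comp (f := fun w : (Y × Y) × G => w.1.2) hf
          (continuous_snd.comp continuous_fst).continuousAt
      exact (ContinuousAt.ne_iff_eventually_ne (continuous_snd.continuousAt.smul h3) h4).1 h2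
  filter_upwards [h1] with z hz γ hγ
  by_contra h
  exact hz γ (fun h' => h (interior_subset h')) hγ

variable {n d p q : ℕ} {M P X : Type*} [TopologicalSpace M] [ChartedSpace (Eu n) M] [IsManifold (𝓡 n) ∞ M]
  [TopologicalSpace P] [T2Space P] [TopologicalSpace X]
  {G : Type*} [TopologicalSpace G] [CompactSpace G] [ChartedSpace (Eu d) G] [Group G]
  [LieGroup (𝓡 d) ∞ G] [MulAction G M] [ContMDiffSMul (𝓡 d) (𝓡 n) ∞ G M]
  [MulAction G P] [ContinuousSMul G P] {i : P → M} {pr : P → X}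

/-- The map that moves a slice of `P` by the action of the group, in coordinates. -/
def orbitMap (G : Type*) [TopologicalSpace G] [ChartedSpace (Eu d) G] [Group G] [MulAction G M]
    (c : Slice (n := n) p i id) (b₀ : Eu p) (j : Eu q →L[ℝ] Eu p) (z : Eu d × Eu q) : M :=
  (extChartAt (𝓡 d) (1 : G)).symm z.1 • i (c.s (b₀ + j z.2))

theorem contMDiffAt_orbitMap (c : Slice (n := n) p i id) (b₀ : Eu p) (j : Eu q →L[ℝ] Eu p)
    (z : Eu d × Eu q) (hz : z.1 ∈ (extChartAt (𝓡 d) (1 : G)).target) (hz' : b₀ + j z.2 ∈ c.B) :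
    ContMDiffAt 𝓘(ℝ, Eu d × Eu q) (𝓡 n) ∞ (orbitMap G c b₀ j) z := by
  have h1 : ContMDiffAt 𝓘(ℝ, Eu d × Eu q) (𝓡 d) ∞
      (fun z : Eu d × Eu q => (extChartAt (𝓡 d) (1 : G)).symm z.1) z :=
    ((contMDiffOn_extChartAt_symm (1 : G)).contMDiffAt
      ((isOpen_extChartAt_target (I := 𝓡 d) (1 : G)).mem_nhds hz)).comp z
      (ContinuousLinearMap.fst ℝ (Eu d) (Eu q)).contMDiff.contMDiffAt
  have h2 : ContMDiffAt 𝓘(ℝ, Eu d × Eu q) (𝓡 p) ∞ (fun z : Eu d × Eu q => b₀ + j z.2) z :=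
    contMDiffAt_const.add
      (j.comp (ContinuousLinearMap.snd ℝ (Eu d) (Eu q))).contMDiff.contMDiffAt
  have h3 : ContMDiffAt 𝓘(ℝ, Eu d × Eu q) (𝓡 n) ∞ (fun z : Eu d × Eu q => i (c.s (b₀ + j z.2))) z :=
    ContMDiffAt.comp (g := fun b => i (c.s b)) z (c.smooth_s _ hz') h2
  exact h1.smul (I := 𝓡 d) h3

/-- The orbit directions are independent in the coordinates of a slice of `P`. -/
theorem fderiv_orbit_injective (c : Slice (n := n) p i id) (hequiv : ∀ (γ : G) x, i (γ • x) = γ • i x)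
    {m : P} (hm : i m ∈ c.W) (hvec : ∀ ξ : Eu d, fundVec (n := n) G ξ (i m) = 0 → ξ = 0) :
    Function.Injective (fderiv ℝ
      (fun ξ => c.ρ ((extChartAt (𝓡 d) (1 : G)).symm ξ • i m)) (extChartAt (𝓡 d) (1 : G) 1)) := by
  have hW : (1 : G) • i m ∈ c.W := by rwa [one_smul]
  have hk : ContMDiffAt (𝓡 d) (𝓡 p) ∞ (fun γ : G => c.ρ (γ • i m)) 1 :=
    (c.smooth_ρ _ hW).comp (1 : G) (contMDiff_orbit (i m)).contMDiffAt
  have hB : c.ρ ((1 : G) • i m) ∈ c.B := by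
    rw [one_smul]
    exact c.mem_B m hm
  -- The orbit map factors through its slice coordinates, so a direction killed in coordinates gives
  -- a vanishing Killing vector.
  have hev : (fun γ : G => γ • i m) =ᶠ[𝓝 1] fun γ => i (c.s (c.ρ (γ • i m))) := by
    filter_upwards [(contMDiff_orbit (d := d) (G := G) (n := n) (i m)).continuous.continuousAt.preimage_mem_nhds
      (c.isOpen_W.mem_nhds hW)] with γ hγ
    rw [← hequiv]
    have h1 : c.s (c.ρ (i (γ • m))) = γ • m := c.pr_s _ (by rw [hequiv]; exact hγ)
    rw [h1]
  have hkd : mfderiv (𝓡 d) (𝓡 p) (fun γ : G => c.ρ (γ • i m)) 1 = fderiv ℝ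
      (fun ξ => c.ρ ((extChartAt (𝓡 d) (1 : G)).symm ξ • i m))
      (extChartAt (𝓡 d) (1 : G) 1) := by
    rw [(hk.mdifferentiableAt (by decide)).mfderiv, (𝓡 d).range_eq_univ, fderivWithin_univ]
    rfl
  refine (injective_iff_map_eq_zero _).2 fun ξ hξ => hvec ξ ?_
  have h1 : mfderiv (𝓡 d) (𝓡 n) (fun γ : G => γ • i m) 1 ξ
      = mfderiv (𝓡 p) (𝓡 n) (fun b => i (c.s b)) (c.ρ ((1 : G) • i m))
        (mfderiv (𝓡 d) (𝓡 p) (fun γ : G => c.ρ (γ • i m)) 1 ξ) := by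
    refine (DFunLike.congr_fun hev.mfderiv_eq ξ).trans ?_
    exact DFunLike.congr_fun (mfderiv_comp (1 : G)
      ((c.smooth_s _ hB).mdifferentiableAt (by decide)) (hk.mdifferentiableAt (by decide))) ξ
  have h2 : mfderiv (𝓡 d) (𝓡 p) (fun γ : G => c.ρ (γ • i m)) 1 ξ = 0 :=
    (DFunLike.congr_fun hkd ξ).trans hξ
  exact h1.trans ((congrArg _ h2).trans (map_zero _))

/-- Slices for a free action of a compact Lie group on a submanifold. -/
theorem exists_orbitSlice (c : Slice (n := n) p i id) (hi : IsEmbedding i)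
    (hequiv : ∀ (γ : G) x, i (γ • x) = γ • i x) (hfree : ∀ (γ : G) (x : P), γ • x = x → γ = 1)
    (hpr : ∀ (γ : G) x, pr (γ • x) = pr x)
    (hpr' : ∀ x y, pr x = pr y → ∃ γ : G, γ • x = y) (hq : q + d = p)
    {m : P} (hm : i m ∈ c.W) (hvec : ∀ ξ : Eu d, fundVec (n := n) G ξ (i m) = 0 → ξ = 0) :
    ∃ c' : Slice (n := n) q i pr, i m ∈ c'.W ∧ c'.s (c'.ρ (i m)) = m := by
  set φ := extChartAt (𝓡 d) (1 : G) with hφ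
  set b₀ := c.ρ (i m) with hb₀
  have hsm : c.s b₀ = m := c.pr_s m hm
  -- `j` parametrizes a complement to the orbit directions. With it, the map from group and slice
  -- coordinates to coordinates of P has invertible derivative at the centre.
  obtain ⟨j, hj⟩ := exists_complement_map hq _ (fderiv_orbit_injective c hequiv hm hvec)
  set a : Eu d × Eu q → M := orbitMap (d := d) G c b₀ j with ha
  set z₀ : Eu d × Eu q := (φ 1, 0) with hz₀
  have hone : φ.symm (φ 1) = 1 := extChartAt_to_inv (I := 𝓡 d) (1 : G)
  have haz : ∀ x, a (φ 1, x) = i (c.s (b₀ + j x)) := fun x => by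
    change φ.symm (φ 1) • i (c.s (b₀ + j x)) = _
    rw [hone, one_smul]
  have hjc : Continuous fun x => b₀ + j x := continuous_const.add j.continuous
  have hb₀B : b₀ + j 0 ∈ c.B := by
    rw [map_zero, add_zero]
    exact c.mem_B m hm
  have haz₀ : a z₀ = i m := by rw [hz₀, haz, map_zero, add_zero, hsm]
  have hdom : ∀ᶠ z in 𝓝 z₀, z.1 ∈ φ.target ∧ b₀ + j z.2 ∈ c.B := by
    refine (continuous_fst.continuousAt.eventually
      ((isOpen_extChartAt_target (I := 𝓡 d) (1 : G)).mem_nhds (mem_extChartAt_target (I := 𝓡 d) (1 : G)))).and ?_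
    exact (hjc.comp continuous_snd).continuousAt.eventually (c.isOpen_B.mem_nhds hb₀B)
  have has : ∀ᶠ z in 𝓝 z₀, ContMDiffAt 𝓘(ℝ, Eu d × Eu q) (𝓡 n) ∞ a z :=
    hdom.mono fun z hz => contMDiffAt_orbitMap c b₀ j z hz.1 hz.2
  have haW : ∀ᶠ z in 𝓝 z₀, a z ∈ c.W :=
    has.self_of_nhds.continuousAt.eventually (c.isOpen_W.mem_nhds (by rwa [haz₀]))
  have hA : ∀ᶠ z in 𝓝 z₀, ContDiffAt ℝ ∞ (fun z => c.ρ (a z)) z := by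
    filter_upwards [has, haW] with z h1 h2
    exact ((c.smooth_ρ _ h2).comp z h1).contDiffAt
  have hAd : DifferentiableAt ℝ (fun z => c.ρ (a z)) z₀ :=
    hA.self_of_nhds.differentiableAt (by decide)
  have hfst : ∀ ξ, fderiv ℝ (fun z => c.ρ (a z)) z₀ (ξ, 0)
      = fderiv ℝ (fun ξ => c.ρ (φ.symm ξ • i m)) (φ 1) ξ := by
    intro ξ
    have h1 : HasFDerivAt (fun ξ : Eu d => (ξ, (0 : Eu q)))
      (ContinuousLinearMap.inl ℝ (Eu d) (Eu q)) (φ 1) := (hasFDerivAt_prodMk_left _ _)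
    have h2 := (hAd.hasFDerivAt.comp (φ 1) h1).fderiv
    have h3 : (fun z => c.ρ (a z)) ∘ (fun ξ : Eu d => (ξ, (0 : Eu q)))
        = fun ξ => c.ρ (φ.symm ξ • i m) := by
      funext ξ
      change c.ρ (φ.symm ξ • i (c.s (b₀ + j 0))) = _
      rw [map_zero, add_zero, hsm]
    rw [h3] at h2
    exact (DFunLike.congr_fun h2 ξ).symm
  have hsnd : ∀ x, fderiv ℝ (fun z => c.ρ (a z)) z₀ (0, x) = j x := by
    intro x
    have h1 : HasFDerivAt (fun x : Eu q => (φ 1, x))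
      (ContinuousLinearMap.inr ℝ (Eu d) (Eu q)) 0 := (hasFDerivAt_prodMk_right _ _)
    have h2 := hAd.hasFDerivAt.comp (0 : Eu q) h1
    have h3 : (fun z => c.ρ (a z)) ∘ (fun x : Eu q => (φ 1, x)) =ᶠ[𝓝 0] fun x => b₀ + j x := by
      filter_upwards [hjc.continuousAt.eventually (c.isOpen_B.mem_nhds hb₀B)] with x hx
      exact (congrArg c.ρ (haz x)).trans (c.ρ_s _ hx)
    have h4 : HasFDerivAt (fun x => b₀ + j x) j 0 := j.hasFDerivAt.const_add b₀
    exact DFunLike.congr_fun ((h2.congr_of_eventuallyEq h3.symm).unique h4) x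
  have hinv : (fderiv ℝ (fun z => c.ρ (a z)) z₀).IsInvertible := by
    refine isInvertible_of_injective _ ((injective_iff_map_eq_zero _).2 fun z hz => ?_)
      (by simp; omega)
    have h1 : z = (z.1, 0) + (0, z.2) := by simp
    rw [h1, map_add, hfst, hsnd] at hz
    exact Prod.ext (hj _ _ hz).1 (hj _ _ hz).2
  obtain ⟨f, hfz, hfA, hfS, hfs⟩ := exists_localInverse hA (hdom.and haW) hinv
  obtain ⟨u, B₁, hu, hzu, hB₁, hzB₁, huB⟩ := mem_nhds_prod_iff'.1 (f.open_source.mem_nhds hfz)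
  have hsc : ContinuousAt (fun x => c.s (b₀ + j x)) 0 :=
    ContinuousAt.comp (f := fun x => b₀ + j x) (c.continuousAt_s hi hb₀B) hjc.continuousAt
  have hV : φ.source ∩ φ ⁻¹' u ∈ 𝓝 (1 : G) :=
    Filter.inter_mem (extChartAt_source_mem_nhds (I := 𝓡 d) (1 : G))
      ((continuousAt_extChartAt (I := 𝓡 d) (1 : G)).preimage_mem_nhds (hu.mem_nhds hzu))
  -- Local invertibility only separates slice points joined by elements near 1. Freeness and
  -- compactness rule out the remaining elements on a smaller slice.
  have hprop := eventually_mem_of_smul_eq hsc (fun γ => hfree γ _) hV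
  obtain ⟨v, w, hv, hzv, hw, hzw, hvw⟩ := mem_nhds_prod_iff'.1 hprop
  set B : Set (Eu q) := B₁ ∩ (v ∩ w) with hBdef
  have hBo : IsOpen B := hB₁.inter (hv.inter hw)
  have h0B : (0 : Eu q) ∈ B := ⟨hzB₁, hzv, hzw⟩
  have hsrc : ∀ x ∈ B, (φ 1, x) ∈ f.source := fun x hx => huB ⟨hzu, hx.1⟩
  have hval : ∀ x ∈ B, f (φ 1, x) = b₀ + j x := fun x hx => by
    rw [hfA, haz, c.ρ_s _ (hfS _ (hsrc x hx)).1.1.2]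
  have hsymm : ∀ x ∈ B, f.symm (b₀ + j x) = (φ 1, x) := fun x hx => by
    rw [← hval x hx, f.left_inv (hsrc x hx)]
  have hinj : ∀ x ∈ B, ∀ x' ∈ B, pr (c.s (b₀ + j x)) = pr (c.s (b₀ + j x')) → x = x' := by
    intro x hx x' hx' h
    obtain ⟨γ, hγ⟩ := hpr' _ _ h
    have h1 : γ ∈ φ.source ∩ φ ⁻¹' u :=
      hvw (show (x, x') ∈ v ×ˢ w from ⟨hx.2.1, hx'.2.2⟩) γ hγ
    have h2 : f (φ γ, x) = f (φ 1, x') := by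
      rw [hfA, hfA, haz, ← hγ, hequiv]
      change c.ρ (φ.symm (φ γ) • _) = _
      rw [φ.left_inv h1.1]
    have h1' : (φ γ, x) ∈ f.source := huB ⟨h1.2, hx.1⟩
    have h3 := f.injOn h1' (hsrc x' hx') h2
    exact congrArg Prod.snd h3
  refine ⟨{
    B := B
    isOpen_B := hBo
    s := fun x => c.s (b₀ + j x)
    W := {y | y ∈ c.W ∧ c.ρ y ∈ f.target ∧ (f.symm (c.ρ y)).2 ∈ B}
    isOpen_W := ?_
    ρ := fun y => (f.symm (c.ρ y)).2
    smooth_s := ?_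
    smooth_ρ := ?_
    mem_W := ?_
    ρ_s := ?_
    mem_B := fun x hx => hx.2.2
    pr_s := ?_
    inj := hinj }, ?_, ?_⟩
  · refine isOpen_iff_mem_nhds.2 fun y hy => ?_
    have h1 := (c.smooth_ρ y hy.1).continuousAt
    filter_upwards [c.isOpen_W.mem_nhds hy.1,
      h1.preimage_mem_nhds (f.open_target.mem_nhds hy.2.1),
      (continuous_snd.continuousAt.comp ((f.continuousAt_symm hy.2.1).comp h1)).preimage_mem_nhds
        (hBo.mem_nhds hy.2.2)] with y' h2 h3 h4
    exact ⟨h2, h3, h4⟩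
  · intro x hx
    refine ContMDiffAt.comp (g := fun b => i (c.s b)) (f := fun x => b₀ + j x) x
      (c.smooth_s _ (hfS _ (hsrc x hx)).1.1.2) ?_
    exact contMDiffAt_const.add j.contMDiff.contMDiffAt
  · intro y hy
    exact (ContinuousLinearMap.snd ℝ (Eu d) (Eu q)).contMDiff.contMDiffAt.comp y
      ((hfs _ hy.2.1).contMDiffAt.comp y (c.smooth_ρ y hy.1))
  · intro x hx
    have h1 := (hfS _ (hsrc x hx)).1.1.2
    refine ⟨c.mem_W _ h1, ?_, ?_⟩
    · rw [c.ρ_s _ h1, ← hval x hx]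
      exact f.map_source (hsrc x hx)
    · rw [c.ρ_s _ h1, hsymm x hx]
      exact hx
  · intro x hx
    change (f.symm (c.ρ (i (c.s (b₀ + j x))))).2 = x
    rw [c.ρ_s _ (hfS _ (hsrc x hx)).1.1.2, hsymm x hx]
  -- The inverse of `f` writes `x` as a group element applied to a slice point, and `pr` forgets the
  -- group element.
  · rintro x ⟨h1, h2, h3⟩
    set z := f.symm (c.ρ (i x)) with hz
    have h4 := f.map_target h2
    have h5 : c.ρ (a z) = c.ρ (i x) := (hfA z).symm.trans (f.right_inv h2)
    have h6 : a z = i (φ.symm z.1 • c.s (b₀ + j z.2)) := (hequiv _ _).symm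
    have h7 : c.s (c.ρ (i x)) = x := c.pr_s x h1
    have h8 : c.s (c.ρ (a z)) = φ.symm z.1 • c.s (b₀ + j z.2) := by
      rw [h6]
      exact c.pr_s _ (h6 ▸ (hfS _ h4).1.2)
    rw [← h7, ← h5, h8, hpr]
  · refine ⟨hm, ?_, ?_⟩
    · have h1 := f.map_source (hsrc 0 h0B)
      rwa [hval 0 h0B, map_zero, add_zero] at h1
    · have h1 := hsymm 0 h0B
      rw [map_zero, add_zero] at h1
      rw [← hb₀, h1]
      exact h0B
  · have h1 := hsymm 0 h0B
    rw [map_zero, add_zero] at h1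
    change c.s (b₀ + j (f.symm b₀).2) = m
    rw [h1, map_zero, add_zero, hsm]

end OrbitSlice

/-! ### The inclusion is an embedding and the projection a submersion -/

section Immersion

variable {n p q d : ℕ} {M P N : Type*}
  [TopologicalSpace M] [ChartedSpace (Eu n) M] [IsManifold (𝓡 n) ∞ M]
  [TopologicalSpace P] {i : P → M}

theorem IsSliced.isSmoothEmbedding {F : Type*} [NormedAddCommGroup F] [NormedSpace ℝ F]
    (hP : IsSliced (n := n) p i id)
    (h : ∀ m, ∃ c : Slice (n := n) p i id, ∃ e ∈ IsManifold.maximalAtlas (𝓡 n) ∞ M,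
      ∃ L : (Eu p × F) ≃L[ℝ] Eu n, i m ∈ c.W ∧ c.W = e.source ∧
        ∀ b ∈ c.B, e (i (c.s b)) = L (b, 0)) :
    letI := hP.chartedSpace
    IsSmoothEmbedding (𝓡 p) (𝓡 n) ∞ i := by
  let := hP.chartedSpace
  refine ⟨IsImmersionOfComplement.isImmersion (F := F) fun m => ?_, hP.embedding⟩
  obtain ⟨c, e, he, L, hm, hW, hL⟩ := h m
  refine IsImmersionAtOfComplement.mk_of_charts L (c.chart hP) e ⟨m, hm, rfl⟩ (hW ▸ hm)
    (hP.chart_mem c) he ?_ ?_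
  · rintro _ ⟨x, hx, rfl⟩
    exact hW ▸ hx
  · intro b hb
    rw [OpenPartialHomeomorph.extend_target] at hb
    have hb' : b ∈ c.B := hb.1
    exact hL b hb'

end Immersion

section Submersion

variable {n p q d : ℕ} {M P N : Type*}
  [TopologicalSpace M] [ChartedSpace (Eu n) M]
  [TopologicalSpace P] [ChartedSpace (Eu p) P] [IsManifold (𝓡 p) ∞ P]
  [TopologicalSpace N] [ChartedSpace (Eu q) N] [IsManifold (𝓡 q) ∞ N]
  {i : P → M} {pr : P → N}

theorem IsQuotientManifold.isSubmersion
    (hQ : IsQuotientManifold (p := p) (q := q) (n := n) i pr) (hq : Nonempty P → q + d = p) :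
    IsSubmersion (𝓡 p) (𝓡 q) ∞ pr := by
  refine IsSubmersionOfComplement.isSubmersion (F := Eu d) fun m => ?_
  set φ := chartAt (Eu q) (pr m) with hφ
  have hprc : ContinuousAt pr m := hQ.smooth_proj.continuous.continuousAt
  have hS : ∀ᶠ x in 𝓝 m, pr x ∈ φ.source :=
    hprc.eventually (φ.open_source.mem_nhds (mem_chart_source _ _))
  have hf : ∀ᶠ x in 𝓝 m, ContMDiffAt (𝓡 p) 𝓘(ℝ, Eu q) ∞ (extChartAt (𝓡 q) (pr m) ∘ pr) x := by
    filter_upwards [hprc.eventually (extChartAt_smooth_eventually (q := q) (pr m))] with x hx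
    exact hx.2.1.comp x hQ.smooth_proj.contMDiffAt
  have hsurj : Function.Surjective (mvfderiv (𝓡 p) (extChartAt (𝓡 q) (pr m) ∘ pr) m) := by
    intro v
    obtain ⟨-, h2, h3⟩ := (extChartAt_smooth_eventually (q := q) (pr m)).self_of_nhds
    obtain ⟨w, hw⟩ := h3.surjective v
    obtain ⟨τ, hτ⟩ := hQ.mfderiv_proj_surjective m w
    refine ⟨τ, ?_⟩
    have h4 := DFunLike.congr_fun (mfderiv_comp m (h2.mdifferentiableAt (by decide))
      (hQ.smooth_proj.mdifferentiable (by decide) m)) τ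
    refine h4.trans ?_
    exact (congrArg (mfderiv (𝓡 q) 𝓘(ℝ, Eu q) (extChartAt (𝓡 q) (pr m)) (pr m)) hτ).trans hw
  obtain ⟨e, he, L, hm, hL⟩ := exists_submersion_chart (k := d) (F := Eu q)
    (by rw [finrank_euclideanSpace_fin, ← hq ⟨m⟩, add_comm]) hf hS hsurj
  refine IsSubmersionAtOfComplement.mk_of_charts
    (L.symm.trans (ContinuousLinearEquiv.prodComm ℝ (Eu d) (Eu q))) e φ hm
    (mem_chart_source _ _) he (IsManifold.chart_mem_maximalAtlas _) (fun x hx => (hL x hx).2) ?_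
  intro y hy
  have hy' : y ∈ e.target := by simpa using hy
  have h1 := (hL _ (e.map_target hy')).1
  rw [e.right_inv hy'] at h1
  exact h1.symm

end Submersion

/-! ### Properness, dimensions and slices for the moment map -/

section Action

/-- Following `(γ, x) ↦ (γ • x, x)` by the second projection gives `G × P → P`, which is proper as G
is compact; properness cancels since P is Hausdorff. -/
theorem properSMul_of_compactSpace {G P : Type*} [TopologicalSpace G] [CompactSpace G] [Group G]
    [TopologicalSpace P] [T2Space P] [MulAction G P] [ContinuousSMul G P] : ProperSMul G P :=
  ⟨isProperMap_of_comp_of_t2 (continuous_smul.prodMk continuous_snd) continuous_snd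
    isProperMap_snd_of_compactSpace⟩

variable {n d p q : ℕ} {M : Type*} [TopologicalSpace M]
    [ChartedSpace (Eu n) M] [IsManifold (𝓡 n) ∞ M]
    {G : Type*} [TopologicalSpace G]
    [ChartedSpace (Eu d) G] [Group G] [LieGroup (𝓡 d) ∞ G]
    [MulAction G M] [ContMDiffSMul (𝓡 d) (𝓡 n) ∞ G M]
    {𝓘c : HypercomplexStructure n M}
    {ν : Fin 3 → M → Eu d} {ζ : Fin 3 → Eu d}
    {hinv : ∀ (γ : G), ∀ m ∈ levelSet ν ζ, γ • m ∈ levelSet ν ζ}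

theorem IsMomentMap.exists_levelSlice (hν : IsMomentMap G 𝓘c ν)
    (hp : Nonempty (LevelSpace G ν ζ hinv) → p + 3 * d = n) (m : LevelSpace G ν ζ hinv) :
    ∃ c : Slice (n := n) p (incl G ν ζ hinv) id, ∃ e ∈ IsManifold.maximalAtlas (𝓡 n) ∞ M,
      ∃ L : (Eu p × (Fin 3 → Eu d)) ≃L[ℝ] Eu n, incl G ν ζ hinv m ∈ c.W ∧ c.W = e.source ∧
        ∀ b ∈ c.B, e (incl G ν ζ hinv (c.s b)) = L (b, 0) := by
  have hf : ContMDiff (𝓡 n) 𝓘(ℝ, Fin 3 → Eu d) ∞ fun x a => ν a x - ζ a :=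
    contMDiff_pi_space.2 fun a => (hν.smooth a).sub contMDiff_const
  refine HKT.exists_levelSlice Subtype.val_injective hf (fun x => ?_) ?_ m fun b => ?_
  · rw [funext_iff]
    simp only [Pi.zero_apply, sub_eq_zero]
    exact ⟨fun h => ⟨⟨x, h⟩, rfl⟩, fun ⟨y, hy⟩ => hy ▸ y.2⟩
  · simp [← hp ⟨m⟩, Module.finrank_pi_fintype]
  · obtain ⟨t, -, ht⟩ := hν.exists_vector hinv m.2 b
    refine ⟨t, funext fun a => ?_⟩
    have h1 := (hf.mdifferentiable (by decide) (incl G ν ζ hinv m)).hasMFDerivAt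
    have h2 := (ContinuousLinearMap.proj (R := ℝ) (φ := fun _ : Fin 3 => Eu d) a).hasMFDerivAt.comp
      (incl G ν ζ hinv m) h1
    have h3 := ((hν.smooth a).mdifferentiable (by decide) (incl G ν ζ hinv m)).hasMFDerivAt.sub
      (hasMFDerivAt_const (ζ a) (incl G ν ζ hinv m))
    have h4 := DFunLike.congr_fun (hasMFDerivAt_unique h2 h3) t
    refine h4.trans ?_
    exact (sub_zero _).trans (ht a)

theorem incl_smul (γ : G) (m : LevelSpace G ν ζ hinv) :
    incl G ν ζ hinv (γ • m) = γ • incl G ν ζ hinv m := rfl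

theorem isSliced_incl (hν : IsMomentMap G 𝓘c ν)
    (hp : Nonempty (LevelSpace G ν ζ hinv) → p + 3 * d = n) :
    IsSliced (n := n) p (incl G ν ζ hinv) id where
  embedding := .subtypeVal
  quot := .id
  symmetry x x' h := ⟨id, id, contMDiff_id, fun _ => rfl, fun _ => rfl, congrArg (incl G ν ζ hinv) h⟩
  exists_slice m := by
    obtain ⟨c, e, he, L, hm, -⟩ := hν.exists_levelSlice hp m
    exact ⟨c, hm, c.pr_s m hm⟩

theorem IsMomentMap.fundVec_injective (hν : IsMomentMap G 𝓘c ν) {m : M} {X : Eu d}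
    (h : fundVec (n := n) G X m = 0) : X = 0 := by
  by_contra hX
  exact hν.transversal 0 m X hX (by rw [h, map_zero])

theorem isSliced_proj [T2Space M] [CompactSpace G] (hν : IsMomentMap G 𝓘c ν)
    (hfree : ∀ (γ : G), ∀ m ∈ levelSet ν ζ, γ • m = m → γ = 1)
    (hp : Nonempty (LevelSpace G ν ζ hinv) → p + 3 * d = n)
    (hq : Nonempty (LevelSpace G ν ζ hinv) → q + d = p) :
    IsSliced (n := n) q (incl G ν ζ hinv) (proj G ν ζ hinv) where
  embedding := .subtypeVal
  quot := by
    have : ContinuousSMul G M := ContMDiffSMul.continuousSMul (I := 𝓡 d) (I' := 𝓡 n) ∞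
    exact MulAction.isOpenQuotientMap_quotientMk
  symmetry x x' h := by
    obtain ⟨γ, rfl⟩ := exists_smul_of_proj_eq h
    exact ⟨fun y => γ • y, fun y => γ • y,
      ContMDiffSMul.contMDiff_const_smul (I := 𝓡 d) (I' := 𝓡 n) (n := ∞) (M := M) γ,
      fun _ => rfl, proj_smul γ, rfl⟩
  exists_slice m := by
    have : ContinuousSMul G M := ContMDiffSMul.continuousSMul (I := 𝓡 d) (I' := 𝓡 n) ∞
    obtain ⟨c, e, he, L, hm, -⟩ := hν.exists_levelSlice hp m
    exact exists_orbitSlice (d := d) c .subtypeVal incl_smul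
      (fun γ x h => hfree γ _ x.2 (congrArg Subtype.val h)) proj_smul
      (fun x y => exists_smul_of_proj_eq) (hq ⟨m⟩) hm (fun ξ => hν.fundVec_injective)

theorem IsMomentMap.four_mul_le (hν : IsMomentMap G 𝓘c ν)
    (m : LevelSpace G ν ζ hinv) : 4 * d ≤ n := by
  let A : Eu n →L[ℝ] Eu d × (Fin 3 → Eu d) := (twisted (n := n) 𝓘c ν 0 (incl G ν ζ hinv m)).prod
    (ContinuousLinearMap.pi fun a => dval (ν a) (incl G ν ζ hinv m))
  have hA : Function.Surjective A.toLinearMap := by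
    rintro ⟨a, b⟩
    obtain ⟨t, ht, htb⟩ := hν.exists_vector (m := incl G ν ζ hinv m) hinv m.2 b
    obtain ⟨X, hX⟩ := hν.twisted_fundVec_surjective (G := G) (incl G ν ζ hinv m) a
    refine ⟨t + fundVec G X (incl G ν ζ hinv m), Prod.ext ?_ (funext fun c => ?_)⟩
    · refine (map_add (twisted 𝓘c ν 0 (incl G ν ζ hinv m)) _ _).trans ?_
      rw [ht, hX, zero_add]
    · refine (map_add (dval (ν c) (incl G ν ζ hinv m)) _ _).trans ?_
      rw [htb, hν.dval_fundVec (m := incl G ν ζ hinv m) hinv m.2, add_zero]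
  have h1 := LinearMap.finrank_le_finrank_of_surjective hA
  simp [Module.finrank_pi_fintype] at h1
  omega

/-- At a point of P the forms `(ω, dν)` map onto 𝔤⁴, so `4d ≤ n` and the truncated subtractions are
exact. An empty level set gives no such bound, hence the conditional form. -/
theorem exists_dimensions (hν : IsMomentMap G 𝓘c ν) : ∃ p q : ℕ,
    (Nonempty (LevelSpace G ν ζ hinv) → p + 3 * d = n) ∧
    (Nonempty (LevelSpace G ν ζ hinv) → q + d = p) :=
  ⟨n - 3 * d, n - 4 * d, fun ⟨m⟩ => by have := hν.four_mul_le m; omega,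
    fun ⟨m⟩ => by have := hν.four_mul_le m; omega⟩

end Action

end HKT

end

/-! ### The reduction theorem -/

theorem mainTheorem4 {n d : ℕ}
    {M : Type*} [TopologicalSpace M] [T2Space M] [SecondCountableTopology M]
    [ChartedSpace (HKT.Eu n) M] [IsManifold (𝓡 n) ∞ M]
    {G : Type*} [TopologicalSpace G] [T2Space G] [CompactSpace G]
    [ChartedSpace (HKT.Eu d) G] [Group G] [LieGroup (𝓡 d) ∞ G]
    [MulAction G M] [ContMDiffSMul (𝓡 d) (𝓡 n) ∞ G M]
    (𝓘c : HKT.HypercomplexStructure n M) (g : HKT.Metric n M) (nabla : HKT.Connection n M)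
    (hM : HKT.IsHKTConnection 𝓘c g nabla)
    (hG : HKT.ActsByHypercomplexIsometries G 𝓘c g)
    (ν : Fin 3 → M → HKT.Eu d) (hν : HKT.IsMomentMap G 𝓘c ν)
    (ζ : Fin 3 → HKT.Eu d)
    (hinv : ∀ (γ : G), ∀ m ∈ HKT.levelSet ν ζ, γ • m ∈ HKT.levelSet ν ζ)
    (hfree : ∀ (γ : G), ∀ m ∈ HKT.levelSet ν ζ, γ • m = m → γ = 1)
    (horth : ∀ m ∈ HKT.levelSet ν ζ, ∀ u ∈ HKT.distU 𝓘c ν m, ∀ X : HKT.Eu d,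
      g.inner m u (HKT.fundVec G X m) = 0) :
    T2Space (HKT.ReducedSpace G ν ζ hinv) ∧
    SecondCountableTopology (HKT.ReducedSpace G ν ζ hinv) ∧
    ∃ (p q : ℕ)
      (_ : ChartedSpace (HKT.Eu p) (HKT.LevelSpace G ν ζ hinv))
      (_ : IsManifold (𝓡 p) ∞ (HKT.LevelSpace G ν ζ hinv))
      (_ : ChartedSpace (HKT.Eu q) (HKT.ReducedSpace G ν ζ hinv))
      (_ : IsManifold (𝓡 q) ∞ (HKT.ReducedSpace G ν ζ hinv)),
      IsSmoothEmbedding (𝓡 p) (𝓡 n) ∞ (HKT.incl G ν ζ hinv) ∧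
      IsSubmersion (𝓡 p) (𝓡 q) ∞ (HKT.proj G ν ζ hinv) ∧
      ∃ (𝓘N : HKT.HypercomplexStructure q (HKT.ReducedSpace G ν ζ hinv))
        (h : HKT.Metric q (HKT.ReducedSpace G ν ζ hinv))
        (D : HKT.Connection q (HKT.ReducedSpace G ν ζ hinv)),
        HKT.IsHKTConnection 𝓘N h D ∧
        HKT.IsInduced (p := p) (HKT.incl G ν ζ hinv) (HKT.proj G ν ζ hinv) (HKT.distU 𝓘c ν)
          𝓘c g nabla 𝓘N h D := by
  have hcont : ContinuousSMul G M := ContMDiffSMul.continuousSMul (I := 𝓡 d) (I' := 𝓡 n) ∞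
  have hsec : SecondCountableTopology (HKT.LevelSpace G ν ζ hinv) :=
    inferInstanceAs (SecondCountableTopology (HKT.levelSet ν ζ))
  have hprop : ProperSMul G (HKT.LevelSpace G ν ζ hinv) := HKT.properSMul_of_compactSpace
  have hT2 : T2Space (HKT.ReducedSpace G ν ζ hinv) := t2Space_quotient_mulAction_of_properSMul
  refine ⟨hT2, ContinuousConstSMul.secondCountableTopology, ?_⟩
  obtain ⟨p, q, hp, hq⟩ := HKT.exists_dimensions (hinv := hinv) hν
  have hP := HKT.isSliced_incl (hinv := hinv) hν hp
  have hN := HKT.isSliced_proj (hinv := hinv) hν hfree hp hq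
  let := hP.chartedSpace
  let := hN.chartedSpace
  have := hP.isManifold
  have := hN.isManifold
  have hQ := hP.isQuotientManifold hN
  have hr := HKT.isReduction hν hG horth hQ hp hq
  refine ⟨p, q, hP.chartedSpace, hP.isManifold, hN.chartedSpace, hN.isManifold,
    hP.isSmoothEmbedding (hν.exists_levelSlice hp), hQ.isSubmersion hq,
    hr.redHypercomplex hM, hr.redMetric, hr.redConnection nabla hM, hr.isHKTConnection hM,
    hr.isInduced hM⟩
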